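/- Let $p>2$ be a prime. A \emph{$\sigma$-pro-$p$-group} is a pro-$p$-group with a continuous action of the group $\{1,\sigma\}$ of order $2$ by automorphisms; a \emph{$\sigma$-isomorphism} is a $\sigma$-equivariant topological isomorphism (written $\cong$), $\mathrm{Aut}_\sigma(G)$ is the group of $\sigma$-automorphisms of $G$, and $G^-:=\{a\in G\mid {}^\sigma a=a^{-1}\}$. The set $G^-$ carries its Haar measure: the probability measure for which, for every $\sigma$-invariant open normal subgroup $N$ of $G$, all fibers of $G^-\to(G/N)^-$ have measure $1/|(G/N)^-|$. For $n\ge0$ let $F_n$ be the free pro-$p$-group on $n$ generators $x_1,\ldots,x_n$, with the action of $\sigma$ for which ${}^\sigma x_i=x_i^{-1}$. For $r=(r_1,\ldots,r_n)\in(F_n^-)^n$ let $N_r$ be the closed normal subgroup of $F_n$ generated by all conjugates of $r_1,\ldots,r_n$, and put $G_r:=F_n/N_r$. A \emph{weak Schur $\sigma$-group} is a $\sigma$-pro-$p$-group that is $\sigma$-isomorphic to $G_r$ for some $n\ge0$ and some $r\in(F_n^-)^n$. Let $\mathrm{Sch}$ be the set of $\sigma$-isomorphism classes $[G]$ of weak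 Schur $\sigma$-groups $G$, with the topology that has as a basis the sets $$U_{i,G}:=\{[H]\in\mathrm{Sch}\mid H/D_i(H)\cong G/D_i(G)\}\qquad(i\ge2,\ [G]\in\mathrm{Sch}),$$ where $D_i$ denotes the $i$-th dimension subgroup (the Zassenhaus filtration for the prime $p$). For $n\ge0$ let $\mu_n$ be the Borel probability measure on $\mathrm{Sch}$ that is the pushforward, under the map $(F_n^-)^n\to\mathrm{Sch}$, $r\mapsto[G_r]$, of the product of the Haar measures on the factors $F_n^-$. Finally let $C_\infty:=\prod_{i\ge1}(1-p^{-i})$. Then for $n\to\infty$ the measures $\mu_n$ converge setwise (that is, on every Borel set) to a unique probability measure $\mu_\infty$ on $\mathrm{Sch}$, and for every finite weak Schur $\sigma$-group $G$ the singleton $\{[G]\}$ is open and closed in $\mathrm{Sch}$ and $$\mu_\infty(\{[G]\})=\frac{C_\infty}{|\mathrm{Aut}_\sigma(G)|}.$$ -/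

import Mathlib

namespace SchurSigma

open Topology MeasureTheory Filter

universe u v

/-! ### Groups with an involution `σ` -/

/-- A continuous action of the group `{1, σ}` of order two on a topological group `G`
by group automorphisms, given by the action of `σ`. -/
class SigmaGroup (G : Type u) [Group G] [TopologicalSpace G] where
  /-- the action of `σ` -/
  sigma : G →* G
  continuous_sigma : Continuous sigma
  sigma_sigma : ∀ g, sigma (sigma g) = g

open SigmaGroup

/-- A topological group is a pro-`p`-group: it is compact and Hausdorff, and the open normal
subgroups of `p`-power index form a basis of neighborhoods of `1`. -/
structure IsProP (p : ℕ) (G : Type u) [Group G] [TopologicalSpace G] : Prop where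
  isTopologicalGroup : IsTopologicalGroup G
  compactSpace : CompactSpace G
  t2Space : T2Space G
  exists_subgroup : ∀ U ∈ 𝓝 (1 : G), ∃ N : Subgroup G,
    N.Normal ∧ IsOpen (N : Set G) ∧ (∃ k : ℕ, N.index = p ^ k) ∧ (N : Set G) ⊆ U

/-- The odd part `G⁻ = {a | σ a = a⁻¹}`, with the subspace topology. -/
abbrev OddPart (G : Type u) [Group G] [TopologicalSpace G] [SigmaGroup G] : Type u :=
  {a : G // sigma a = a⁻¹}

/-- `σ`-isomorphisms: `σ`-equivariant topological isomorphisms. -/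
structure SigmaEquiv (G : Type u) (H : Type v) [Group G] [TopologicalSpace G] [SigmaGroup G]
    [Group H] [TopologicalSpace H] [SigmaGroup H] extends G ≃ₜ* H where
  map_sigma : ∀ g : G, toFun (sigma g) = sigma (toFun g)

/-- The set `Aut_σ(G)` of `σ`-automorphisms of `G`. -/
abbrev SigmaAut (G : Type u) [Group G] [TopologicalSpace G] [SigmaGroup G] : Type u :=
  SigmaEquiv G G

/-- A subgroup is `σ`-invariant. -/
class SigmaInvariant {G : Type u} [Group G] [TopologicalSpace G] [SigmaGroup G]
    (N : Subgroup G) : Prop where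
  le_comap : N ≤ N.comap sigma

/-- The action of `σ` on the quotient by a `σ`-invariant normal subgroup. -/
instance quotientSigmaGroup {G : Type u} [Group G] [TopologicalSpace G] [SigmaGroup G]
    (N : Subgroup G) [N.Normal] [SigmaInvariant N] : SigmaGroup (G ⧸ N) where
  sigma := QuotientGroup.map N N sigma SigmaInvariant.le_comap
  continuous_sigma :=
    (QuotientGroup.continuous_mk.comp continuous_sigma).quotient_lift _
  sigma_sigma := by
    intro g
    induction g using QuotientGroup.induction_on with
    | H g => simp [sigma_sigma]

/-! ### The Zassenhaus filtration -/

/-- The dimension subgroups `D_i(G)` of a topological group `G` for the prime `p`, with all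
subgroups taken closed: `D_1(G) = G`, and for `i ≥ 2` the subgroup `D_i(G)` is generated by the
`p`-th powers of the elements of `D_{⌈i/p⌉}(G)` and by all `[D_j(G), D_k(G)]` with `j, k ≥ 1` and
`j + k = i`. (The value at `i = 0` plays no role.) -/
def zassenhaus (p : ℕ) [hp : Fact p.Prime] (G : Type u) [Group G] [TopologicalSpace G]
    [IsTopologicalGroup G] (i : ℕ) : Subgroup G :=
  if i < 2 then ⊤ else
    (Subgroup.closure ((fun g => g ^ p) '' (zassenhaus p G ((i + p - 1) / p) : Set G)) ⊔
      ⨆ j : Fin (i - 1), ⁅zassenhaus p G (j + 1), zassenhaus p G (i - (j + 1))⁆).topologicalClosure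
termination_by i
decreasing_by
  · have := hp.out.two_le
    rw [Nat.div_lt_iff_lt_mul (by omega)]
    obtain ⟨a, rfl⟩ := Nat.exists_eq_add_of_le (show 2 ≤ i by omega)
    obtain ⟨b, rfl⟩ := Nat.exists_eq_add_of_le this
    have : (2 + a) * (2 + b) = 4 + 2 * a + 2 * b + a * b := by ring
    omega
  · have := j.2
    omega
  · have := j.2
    omega

theorem zassenhaus_le_comap (p : ℕ) [Fact p.Prime] {G : Type u} [Group G] [TopologicalSpace G]
    [IsTopologicalGroup G] (φ : G →* G) (hφ : Continuous φ) (i : ℕ) :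
    zassenhaus p G i ≤ (zassenhaus p G i).comap φ := by
  induction i using Nat.strong_induction_on with
  | _ i ih =>
    have hp := (Fact.out : p.Prime).two_le
    by_cases hi : i < 2
    · rw [zassenhaus, if_pos hi]; simp
    · rw [zassenhaus, if_neg hi]
      refine Subgroup.topologicalClosure_minimal _ ?_
        (IsClosed.preimage hφ (Subgroup.isClosed_topologicalClosure _))
      refine le_trans ?_ (Subgroup.comap_mono (Subgroup.le_topologicalClosure _))
      refine sup_le ?_ (iSup_le fun j => ?_)
      · rw [Subgroup.closure_le]
        rintro _ ⟨g, hg, rfl⟩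
        refine Subgroup.mem_sup_left (Subgroup.subset_closure ⟨φ g, ?_, by simp⟩)
        refine ih _ ?_ hg
        rw [Nat.div_lt_iff_lt_mul (by omega)]
        obtain ⟨a, rfl⟩ := Nat.exists_eq_add_of_le (show 2 ≤ i by omega)
        obtain ⟨b, rfl⟩ := Nat.exists_eq_add_of_le hp
        have : (2 + a) * (2 + b) = 4 + 2 * a + 2 * b + a * b := by ring
        omega
      · have := j.2
        rw [← Subgroup.map_le_iff_le_comap, Subgroup.map_commutator]
        refine le_trans (Subgroup.commutator_mono ?_ ?_)
          (le_sup_of_le_right (le_iSup (fun j : Fin (i - 1) =>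
            ⁅zassenhaus p G (j + 1), zassenhaus p G (i - (j + 1))⁆) j))
        · exact Subgroup.map_le_iff_le_comap.2 (ih _ (by omega))
        · exact Subgroup.map_le_iff_le_comap.2 (ih _ (by omega))

instance zassenhaus_normal (p : ℕ) [Fact p.Prime] (G : Type u) [Group G] [TopologicalSpace G]
    [IsTopologicalGroup G] (i : ℕ) : (zassenhaus p G i).Normal where
  conj_mem _ hn g :=
    zassenhaus_le_comap p (MulAut.conj g).toMonoidHom (IsTopologicalGroup.continuous_conj g) i hn

instance zassenhaus_sigmaInvariant (p : ℕ) [Fact p.Prime] (G : Type u) [Group G]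
    [TopologicalSpace G] [IsTopologicalGroup G] [SigmaGroup G] (i : ℕ) :
    SigmaInvariant (zassenhaus p G i) where
  le_comap := zassenhaus_le_comap p sigma continuous_sigma i

/-! ### The Haar measure on the odd part -/

/-- The Haar measure on a compact group, of total measure one. -/
noncomputable def haarProb (G : Type u) [Group G] [TopologicalSpace G] [IsTopologicalGroup G]
    [CompactSpace G] [MeasurableSpace G] [BorelSpace G] : Measure G :=
  Measure.haarMeasure ⊤

/-- For every `g` the element `(σ g)⁻¹ g` is odd. -/
def toOdd {G : Type u} [Group G] [TopologicalSpace G] [SigmaGroup G] (g : G) : OddPart G :=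
  ⟨(sigma g)⁻¹ * g, by simp [sigma_sigma]⟩

/-- The Haar measure on `G⁻`. It is the measure of total mass one for which, for every
`σ`-invariant open normal subgroup `N`, all fibers of `G⁻ → (G/N)⁻` have the same measure;
for pro-`p`-groups with `p` odd this is proved in `haarOdd_fiber` below. It is constructed as the
image of the Haar measure of `G` under `g ↦ (σ g)⁻¹ g`, that is `a b ↦ b ^ 2` for `a` even and `b`
odd. -/
noncomputable def haarOdd (G : Type u) [Group G] [TopologicalSpace G] [IsTopologicalGroup G]
    [CompactSpace G] [MeasurableSpace G] [BorelSpace G] [SigmaGroup G] : Measure (OddPart G) :=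
  (haarProb G).map toOdd

theorem continuous_toOdd {G : Type u} [Group G] [TopologicalSpace G] [IsTopologicalGroup G]
    [SigmaGroup G] : Continuous (toOdd : G → OddPart G) :=
  Continuous.subtype_mk (continuous_sigma.inv.mul continuous_id) _

instance isProbabilityMeasure_haarProb (G : Type u) [Group G] [TopologicalSpace G]
    [IsTopologicalGroup G] [CompactSpace G] [MeasurableSpace G] [BorelSpace G] :
    IsProbabilityMeasure (haarProb G) :=
  ⟨Measure.haarMeasure_self (K₀ := (⊤ : TopologicalSpace.PositiveCompacts G))⟩

instance isProbabilityMeasure_haarOdd (G : Type u) [Group G] [TopologicalSpace G]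
    [IsTopologicalGroup G] [CompactSpace G] [MeasurableSpace G] [BorelSpace G] [SigmaGroup G] :
    IsProbabilityMeasure (haarOdd G) :=
  Measure.isProbabilityMeasure_map continuous_toOdd.measurable.aemeasurable

/-- In a finite group of odd order with an action of `σ`, every fiber of `g ↦ (σ g)⁻¹ g` over
the odd part has cardinality `|G| / |G⁻|`. -/
theorem card_toOdd_fiber {Q : Type u} [Group Q] [TopologicalSpace Q] [SigmaGroup Q] [Finite Q]
    (hodd : Odd (Nat.card Q)) (y : OddPart Q) :
    Nat.card {x : Q // toOdd x = y} * Nat.card (OddPart Q) = Nat.card Q := by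
  have key : ∀ z : OddPart Q, Nat.card {x : Q // toOdd x = z} =
      Nat.card {a : Q // sigma a = a} := by
    intro z
    obtain ⟨k, hk⟩ : Odd (orderOf z.1) := hodd.of_dvd_nat (orderOf_dvd_natCard z.1)
    have hz : z.1 ^ (k + 1) * z.1 ^ (k + 1) = z.1 := by
      rw [← pow_add, show k + 1 + (k + 1) = orderOf z.1 + 1 by omega, pow_succ,
        pow_orderOf_eq_one, one_mul]
    set x₀ : Q := z.1 ^ (k + 1) with hx₀
    have h₀ : (sigma x₀)⁻¹ * x₀ = z.1 := by
      rw [hx₀, map_pow, z.2, inv_pow, inv_inv, hz]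
    refine Nat.card_congr
      { toFun := fun x => ⟨x.1 * x₀⁻¹, ?_⟩
        invFun := fun a => ⟨a.1 * x₀, ?_⟩
        left_inv := fun x => by simp
        right_inv := fun a => by simp }
    · have hx : (sigma x.1)⁻¹ * x.1 = z.1 := congrArg Subtype.val x.2
      rw [← h₀] at hx
      have h1 : x.1 = sigma x.1 * ((sigma x₀)⁻¹ * x₀) := by rw [← hx]; group
      rw [map_mul, map_inv]
      nth_rw 2 [h1]
      group
    · refine Subtype.ext ?_
      change (sigma (a.1 * x₀))⁻¹ * (a.1 * x₀) = z.1
      rw [map_mul, a.2, ← h₀]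
      group
  have htot : Nat.card Q = ∑ᶠ z : OddPart Q, Nat.card {x : Q // toOdd x = z} := by
    have := Fintype.ofFinite (OddPart Q)
    rw [finsum_eq_sum_of_fintype, ← Nat.card_sigma]
    exact Nat.card_congr (Equiv.sigmaFiberEquiv (toOdd : Q → OddPart Q)).symm
  have := Fintype.ofFinite (OddPart Q)
  rw [htot, finsum_eq_sum_of_fintype, Finset.sum_congr rfl (fun z _ => key z), key y]
  simp [Nat.card_eq_fintype_card, mul_comm]

theorem haarOdd_fiber (p : ℕ) [hp : Fact p.Prime] (hp2 : p ≠ 2) (G : Type u) [Group G]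
    [TopologicalSpace G] [IsTopologicalGroup G] [CompactSpace G] [MeasurableSpace G] [BorelSpace G]
    [SigmaGroup G] (hG : IsProP p G) (N : Subgroup G) [N.Normal] [SigmaInvariant N]
    (hN : IsOpen (N : Set G)) (y : OddPart (G ⧸ N)) :
    haarOdd G {x | (QuotientGroup.mk x.1 : G ⧸ N) = y.1} =
      (Nat.card (OddPart (G ⧸ N)) : ENNReal)⁻¹ := by
  have : DiscreteTopology (G ⧸ N) := QuotientGroup.discreteTopology hN
  have : Finite (G ⧸ N) := finite_of_compact_of_discrete
  have hodd : Odd (Nat.card (G ⧸ N)) := by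
    obtain ⟨M, -, -, ⟨k, hk⟩, hM⟩ := hG.exists_subgroup N (hN.mem_nhds N.one_mem)
    have h1 : N.index ∣ p ^ k := hk ▸ Subgroup.index_dvd_of_le hM
    exact (hp.out.odd_of_ne_two hp2).pow.of_dvd_nat h1
  have hcont : Continuous (QuotientGroup.mk : G → G ⧸ N) := QuotientGroup.continuous_mk
  have hmeas : ∀ A : Set (G ⧸ N), MeasurableSet (QuotientGroup.mk ⁻¹' A : Set G) :=
    fun A => ((isOpen_discrete A).preimage hcont).measurableSet
  have hinv : (haarProb G).IsMulLeftInvariant :=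
    inferInstanceAs (Measure.haarMeasure ⊤ : Measure G).IsMulLeftInvariant
  have hpt : ∀ q : G ⧸ N, haarProb G (QuotientGroup.mk ⁻¹' {q}) =
      haarProb G (QuotientGroup.mk ⁻¹' {(1 : G ⧸ N)}) := by
    intro q
    induction q using QuotientGroup.induction_on with
    | H g =>
      rw [← measure_preimage_mul (haarProb G) g]
      congr 1
      ext x
      simp
  have := Fintype.ofFinite (G ⧸ N)
  have hsum : ∀ A : Set (G ⧸ N), haarProb G (QuotientGroup.mk ⁻¹' A) =
      Nat.card A * haarProb G (QuotientGroup.mk ⁻¹' {(1 : G ⧸ N)}) := by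
    intro A
    classical
    have : (QuotientGroup.mk ⁻¹' A : Set G) =
        ⋃ q ∈ A.toFinset, QuotientGroup.mk ⁻¹' {q} := by ext; simp
    rw [this, measure_biUnion_finset _ (fun q _ => hmeas _),
      Finset.sum_congr rfl (fun q _ => hpt q)]
    · rw [Finset.sum_const, nsmul_eq_mul, Nat.card_eq_fintype_card, Set.toFinset_card]
    · intro q _ q' _ hqq'
      exact Disjoint.preimage _ (by simpa using hqq')
  have hone : (Nat.card (G ⧸ N) : ENNReal) *
      haarProb G (QuotientGroup.mk ⁻¹' {(1 : G ⧸ N)}) = 1 := by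
    have := hsum Set.univ
    rw [Set.preimage_univ, measure_univ, Nat.card_congr (Equiv.Set.univ _)] at this
    exact this.symm
  have hS : MeasurableSet {x : OddPart G | (QuotientGroup.mk x.1 : G ⧸ N) = y.1} :=
    ((isOpen_discrete {y.1}).preimage (hcont.comp continuous_subtype_val)).measurableSet
  have hpre : (toOdd : G → OddPart G) ⁻¹' {x | (QuotientGroup.mk x.1 : G ⧸ N) = y.1} =
      QuotientGroup.mk ⁻¹' {q : G ⧸ N | toOdd q = y} := by
    ext g
    exact (Subtype.ext_iff (a1 := toOdd (QuotientGroup.mk g : G ⧸ N)) (a2 := y)).symm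
  rw [haarOdd, Measure.map_apply continuous_toOdd.measurable hS, hpre, hsum]
  rw [← card_toOdd_fiber hodd y, Nat.cast_mul] at hone
  refine ENNReal.eq_inv_of_mul_eq_one_left ?_
  rw [← hone]
  change (Nat.card {q : G ⧸ N // toOdd q = y} : ENNReal) * _ * _ = _
  ring

/-! ### Free pro-`p`-groups with odd generators -/

/-- The normal subgroups of `p`-power index of an abstract group `Γ`. -/
abbrev PIndex (p : ℕ) (Γ : Type u) [Group Γ] : Type u :=
  {N : Subgroup Γ // N.Normal ∧ ∃ k : ℕ, N.index = p ^ k}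

instance {p : ℕ} {Γ : Type u} [Group Γ] (N : PIndex p Γ) : N.1.Normal := N.2.1

/-- The quotient `Γ/N`, as a discrete group. -/
def Level {p : ℕ} {Γ : Type u} [Group Γ] (N : PIndex p Γ) : Type u := Γ ⧸ N.1

instance {p : ℕ} {Γ : Type u} [Group Γ] (N : PIndex p Γ) : Group (Level N) :=
  inferInstanceAs (Group (Γ ⧸ N.1))

instance {p : ℕ} {Γ : Type u} [Group Γ] (N : PIndex p Γ) : TopologicalSpace (Level N) := ⊥

instance {p : ℕ} {Γ : Type u} [Group Γ] (N : PIndex p Γ) : DiscreteTopology (Level N) := ⟨rfl⟩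

instance {p : ℕ} [hp : Fact p.Prime] {Γ : Type u} [Group Γ] (N : PIndex p Γ) :
    Finite (Level N) := by
  obtain ⟨k, hk⟩ := N.2.2
  exact Nat.finite_of_card_ne_zero
    (show N.1.index ≠ 0 by rw [hk]; exact pow_ne_zero _ hp.out.ne_zero)

/-- The transition map `Γ/N → Γ/M` for `N ≤ M`. -/
def Level.trans {p : ℕ} {Γ : Type u} [Group Γ] {N M : PIndex p Γ} (h : N.1 ≤ M.1) :
    Level N →* Level M :=
  QuotientGroup.map N.1 M.1 (MonoidHom.id Γ) h

/-- The inverse limit of the groups `Γ/N`, as a subgroup of their product. -/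
def limitSubgroup (p : ℕ) (Γ : Type u) [Group Γ] : Subgroup (∀ N : PIndex p Γ, Level N) where
  carrier := {f | ∀ (N M : PIndex p Γ) (h : N.1 ≤ M.1), Level.trans h (f N) = f M}
  mul_mem' hf hg N M h := by simp [hf N M h, hg N M h]
  one_mem' N M h := by simp
  inv_mem' hf N M h := by simp [hf N M h]

/-- The pro-`p` completion of an abstract group `Γ`: the inverse limit of the discrete groups
`Γ/N` over all normal subgroups `N` of `p`-power index. -/
def ProPCompletion (p : ℕ) (Γ : Type u) [Group Γ] : Type u := limitSubgroup p Γ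

namespace ProPCompletion

variable (p : ℕ) (Γ : Type u) [Group Γ]

instance : Group (ProPCompletion p Γ) := inferInstanceAs (Group (limitSubgroup p Γ))

instance : TopologicalSpace (ProPCompletion p Γ) :=
  inferInstanceAs (TopologicalSpace (limitSubgroup p Γ))

instance : IsTopologicalGroup (ProPCompletion p Γ) :=
  inferInstanceAs (IsTopologicalGroup (limitSubgroup p Γ))

instance : T2Space (ProPCompletion p Γ) := inferInstanceAs (T2Space (limitSubgroup p Γ))

instance : MeasurableSpace (ProPCompletion p Γ) := borel _

instance : BorelSpace (ProPCompletion p Γ) := ⟨rfl⟩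

instance [Fact p.Prime] : CompactSpace (ProPCompletion p Γ) := by
  refine isCompact_iff_compactSpace.1 (IsClosed.isCompact ?_)
  have : ((limitSubgroup p Γ : Subgroup _) : Set (∀ N : PIndex p Γ, Level N)) =
      ⋂ (N : PIndex p Γ) (M : PIndex p Γ) (h : N.1 ≤ M.1), {f | Level.trans h (f N) = f M} := by
    ext f
    simp [limitSubgroup]
  rw [this]
  refine isClosed_iInter fun N => isClosed_iInter fun M => isClosed_iInter fun h => ?_
  exact isClosed_eq (continuous_of_discreteTopology.comp (continuous_apply N)) (continuous_apply M)

/-- The projection of the pro-`p` completion to `Γ/N`. -/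
def proj (N : PIndex p Γ) : ProPCompletion p Γ →* Level N :=
  (Pi.evalMonoidHom _ N).comp (limitSubgroup p Γ).subtype

/-- The canonical homomorphism from `Γ` to its pro-`p` completion. -/
def of : Γ →* ProPCompletion p Γ where
  toFun g := ⟨fun N => QuotientGroup.mk' N.1 g, fun _ _ _ => rfl⟩
  map_one' := rfl
  map_mul' _ _ := rfl

variable {p Γ}

/-- The inverse image of a normal subgroup of `p`-power index under an automorphism. -/
def comapIndex (φ : Γ ≃* Γ) (N : PIndex p Γ) : PIndex p Γ :=
  ⟨N.1.comap φ.toMonoidHom, inferInstance, by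
    rw [Subgroup.index_comap_of_surjective N.1 φ.surjective]; exact N.2.2⟩

/-- The map `Γ/φ⁻¹(N) → Γ/N` induced by an automorphism `φ`. -/
def levelMap (φ : Γ ≃* Γ) (N : PIndex p Γ) : Level (comapIndex φ N) →* Level N :=
  QuotientGroup.map _ N.1 φ.toMonoidHom le_rfl

/-- The endomorphism of the pro-`p` completion induced by an automorphism `φ` of `Γ`. -/
def map (φ : Γ ≃* Γ) : ProPCompletion p Γ →* ProPCompletion p Γ where
  toFun f := ⟨fun N => levelMap φ N (f.1 (comapIndex φ N)), by
    intro N M h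
    have h' : (comapIndex φ N).1 ≤ (comapIndex φ M).1 := Subgroup.comap_mono h
    have key : ∀ x : Level (comapIndex φ N), Level.trans h (levelMap φ N x) =
        levelMap φ M (Level.trans h' x) := by
      intro x
      induction x using QuotientGroup.induction_on with
      | H x => rfl
    exact (key _).trans (congrArg (levelMap φ M) (f.2 _ _ h'))⟩
  map_one' := Subtype.ext (funext fun N => map_one (levelMap φ N))
  map_mul' f g := Subtype.ext (funext fun N =>
    map_mul (levelMap φ N) (f.1 (comapIndex φ N)) (g.1 (comapIndex φ N)))

theorem continuous_map (φ : Γ ≃* Γ) : Continuous (map (p := p) φ) := by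
  refine Continuous.subtype_mk (continuous_pi fun N => ?_) _
  exact continuous_of_discreteTopology.comp
    ((continuous_apply (comapIndex φ N)).comp continuous_subtype_val)

theorem map_of (φ : Γ ≃* Γ) (g : Γ) : map (p := p) φ (of p Γ g) = of p Γ (φ g) := rfl

theorem map_map (φ : Γ ≃* Γ) (hφ : ∀ g, φ (φ g) = g) (f : ProPCompletion p Γ) :
    map φ (map φ f) = f := by
  refine Subtype.ext (funext fun N => ?_)
  have h : (comapIndex φ (comapIndex φ N)).1 ≤ N.1 := by
    intro g hg
    have : φ (φ g) ∈ N.1 := hg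
    rwa [hφ] at this
  rw [← f.2 _ N h]
  change levelMap φ N (levelMap φ (comapIndex φ N) (f.1 (comapIndex φ (comapIndex φ N)))) = _
  generalize f.1 (comapIndex φ (comapIndex φ N)) = x
  induction x using QuotientGroup.induction_on with
  | H x => exact congrArg (QuotientGroup.mk' N.1) (hφ x)

theorem isProP [hp : Fact p.Prime] : IsProP p (ProPCompletion p Γ) where
  isTopologicalGroup := inferInstance
  compactSpace := inferInstance
  t2Space := inferInstance
  exists_subgroup := by
    intro U hU
    obtain ⟨V, hV, hVU⟩ := mem_nhds_induced
      (Subtype.val : limitSubgroup p Γ → ∀ N : PIndex p Γ, Level N) 1 U |>.1 hU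
    rw [nhds_pi, Filter.mem_pi] at hV
    obtain ⟨I, hI, t, ht, htV⟩ := hV
    have hker : ∀ N : PIndex p Γ, ∃ k : ℕ, (proj p Γ N).ker.index = p ^ k := by
      intro N
      obtain ⟨k, hk⟩ := N.2.2
      have h1 : (proj p Γ N).ker.index ∣ p ^ k := by
        rw [Subgroup.index_ker, ← hk]
        exact Subgroup.card_subgroup_dvd_card (proj p Γ N).range
      obtain ⟨j, -, hj⟩ := (Nat.dvd_prime_pow hp.out).1 h1
      exact ⟨j, hj⟩
    have hcont : ∀ N : PIndex p Γ, Continuous (proj p Γ N) := fun N =>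
      (continuous_apply N).comp continuous_subtype_val
    refine ⟨⨅ N ∈ hI.toFinset, (proj p Γ N).ker, ?_, ?_, ?_, ?_⟩
    · exact Subgroup.normal_iInf_normal fun N => Subgroup.normal_iInf_normal fun _ => inferInstance
    · rw [Subgroup.coe_iInf]
      simp only [Subgroup.coe_iInf]
      refine isOpen_biInter_finset fun N _ => ?_
      exact (isOpen_discrete {(1 : Level N)}).preimage (hcont N)
    · induction hI.toFinset using Finset.cons_induction with
      | empty => exact ⟨0, by simp⟩
      | cons N s _ ih =>
        obtain ⟨a, ha⟩ := ih
        obtain ⟨b, hb⟩ := hker N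
        have hle : ((proj p Γ N).ker ⊓ ⨅ M ∈ s, (proj p Γ M).ker).index ∣ p ^ (b + a) := by
          rw [← Subgroup.relIndex_mul_index
            (inf_le_right : (proj p Γ N).ker ⊓ ⨅ M ∈ s, (proj p Γ M).ker ≤ _), ha, pow_add,
            Subgroup.inf_relIndex_right, ← hb]
          exact mul_dvd_mul_right (Subgroup.relIndex_dvd_index_of_normal _ _) _
        obtain ⟨j, -, hj⟩ := (Nat.dvd_prime_pow hp.out).1 hle
        refine ⟨j, ?_⟩
        rw [← hj]
        congr 1
        simp only [Finset.mem_cons, iInf_or, iInf_inf_eq, iInf_iInf_eq_left]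
    · intro f hf
      refine hVU (htV fun N hN => ?_)
      have : proj p Γ N f = 1 := by
        have h := hf
        simp only [SetLike.mem_coe, Subgroup.mem_iInf] at h
        exact h N (hI.mem_toFinset.2 hN)
      have h2 : f.1 N = 1 := this
      rw [h2]
      exact mem_of_mem_nhds (ht N)

end ProPCompletion

/-- The automorphism of the abstract free group that inverts each of the free generators. -/
def freeInv (n : ℕ) : FreeGroup (Fin n) ≃* FreeGroup (Fin n) :=
  MonoidHom.toMulEquiv (FreeGroup.lift fun i => (FreeGroup.of i)⁻¹)
    (FreeGroup.lift fun i => (FreeGroup.of i)⁻¹) (by ext; simp) (by ext; simp)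

theorem freeInv_freeInv (n : ℕ) (g : FreeGroup (Fin n)) : freeInv n (freeInv n g) = g :=
  (freeInv n).symm_apply_apply g

/-- The free pro-`p`-group `F_n` on `n` generators, as the pro-`p` completion of the abstract
free group on `n` generators. -/
abbrev FreeProP (p n : ℕ) : Type := ProPCompletion p (FreeGroup (Fin n))

/-- The action of `σ` on `F_n` for which the free generators are odd. -/
instance freeSigmaGroup (p n : ℕ) : SigmaGroup (FreeProP p n) where
  sigma := ProPCompletion.map (freeInv n)
  continuous_sigma := ProPCompletion.continuous_map _
  sigma_sigma := ProPCompletion.map_map _ (freeInv_freeInv n)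

/-- The free generators of `F_n`, as odd elements. -/
def FreeProP.gen (p n : ℕ) (i : Fin n) : OddPart (FreeProP p n) :=
  ⟨ProPCompletion.of p _ (FreeGroup.of i), by
    change ProPCompletion.map (freeInv n) _ = _
    rw [ProPCompletion.map_of, ← map_inv]
    exact congrArg _ (by simp [freeInv])⟩

/-! ### Weak Schur `σ`-groups -/

/-- The closed normal subgroup `N_r` of `F_n` generated by all conjugates of the entries of `r`. -/
def relSubgroup {p n : ℕ} (r : Fin n → OddPart (FreeProP p n)) : Subgroup (FreeProP p n) :=
  (Subgroup.normalClosure (Set.range fun i => (r i).1)).topologicalClosure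

instance {p n : ℕ} (r : Fin n → OddPart (FreeProP p n)) : (relSubgroup r).Normal :=
  Subgroup.is_normal_topologicalClosure _

instance {p n : ℕ} (r : Fin n → OddPart (FreeProP p n)) : SigmaInvariant (relSubgroup r) where
  le_comap := by
    refine Subgroup.topologicalClosure_minimal _ (Subgroup.normalClosure_le_normal ?_)
      (IsClosed.preimage continuous_sigma (Subgroup.isClosed_topologicalClosure _))
    rintro _ ⟨i, rfl⟩
    change sigma (r i).1 ∈ relSubgroup r
    rw [(r i).2]
    exact inv_mem (Subgroup.le_topologicalClosure _
      (Subgroup.subset_normalClosure (Set.mem_range_self i)))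

/-- The `σ`-pro-`p`-group `G_r = F_n / N_r`. -/
abbrev RelGroup {p n : ℕ} (r : Fin n → OddPart (FreeProP p n)) : Type :=
  FreeProP p n ⧸ relSubgroup r

theorem isProP_relGroup {p n : ℕ} [Fact p.Prime] (r : Fin n → OddPart (FreeProP p n)) :
    IsProP p (RelGroup r) where
  isTopologicalGroup := inferInstance
  compactSpace := inferInstance
  t2Space := by
    have : IsClosed ((relSubgroup r : Subgroup (FreeProP p n)) : Set (FreeProP p n)) :=
      Subgroup.isClosed_topologicalClosure _
    infer_instance
  exists_subgroup := by
    intro U hU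
    have hU' : (QuotientGroup.mk ⁻¹' U : Set (FreeProP p n)) ∈ 𝓝 1 :=
      QuotientGroup.continuous_mk.continuousAt.preimage_mem_nhds hU
    obtain ⟨N, hN, hNo, ⟨k, hk⟩, hNU⟩ := ProPCompletion.isProP.exists_subgroup _ hU'
    have hs := QuotientGroup.mk'_surjective (relSubgroup r)
    refine ⟨N.map (QuotientGroup.mk' (relSubgroup r)), hN.map _ hs, ?_, ?_, ?_⟩
    · exact QuotientGroup.isOpenMap_coe _ hNo
    · have h1 := Subgroup.index_map_dvd N hs
      rw [hk] at h1
      obtain ⟨j, -, hj⟩ := (Nat.dvd_prime_pow (Fact.out : p.Prime)).1 h1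
      exact ⟨j, hj⟩
    · rintro _ ⟨g, hg, rfl⟩
      exact hNU hg

/-- A weak Schur `σ`-group is a topological group with an action of `σ` that is `σ`-isomorphic to
`G_r` for some `n ≥ 0` and some tuple `r` of `n` odd elements of `F_n`. By `isProP_relGroup` it is
then in particular a `σ`-pro-`p`-group. -/
def IsWeakSchur (p : ℕ) (G : Type u) [Group G] [TopologicalSpace G] [SigmaGroup G] : Prop :=
  ∃ (n : ℕ) (r : Fin n → OddPart (FreeProP p n)), Nonempty (SigmaEquiv G (RelGroup r))

namespace SigmaEquiv

variable {G : Type u} {H : Type v} [Group G] [TopologicalSpace G] [SigmaGroup G]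
    [Group H] [TopologicalSpace H] [SigmaGroup H]

/-- The identity. -/
def refl : SigmaEquiv G G := ⟨ContinuousMulEquiv.refl G, fun _ => rfl⟩

/-- The inverse of a `σ`-isomorphism. -/
def symm (e : SigmaEquiv G H) : SigmaEquiv H G :=
  ⟨e.toContinuousMulEquiv.symm, fun h => by
    change e.toContinuousMulEquiv.symm (sigma h) = sigma (e.toContinuousMulEquiv.symm h)
    rw [ContinuousMulEquiv.symm_apply_eq]
    have := e.map_sigma (e.toContinuousMulEquiv.symm h)
    change e.toContinuousMulEquiv _ = sigma (e.toContinuousMulEquiv _) at this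
    rw [this, ContinuousMulEquiv.apply_symm_apply]⟩

/-- The composite of two `σ`-isomorphisms. -/
def trans {K : Type*} [Group K] [TopologicalSpace K] [SigmaGroup K]
    (e : SigmaEquiv G H) (f : SigmaEquiv H K) : SigmaEquiv G K :=
  ⟨e.toContinuousMulEquiv.trans f.toContinuousMulEquiv, fun g =>
    (congrArg f.toFun (e.map_sigma g)).trans (f.map_sigma (e.toFun g))⟩

end SigmaEquiv

/-- The tuples `r ∈ (F_n⁻)ⁿ` for all `n ≥ 0`; two of them are equivalent if the groups `G_r`
are `σ`-isomorphic. -/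
instance relSetoid (p : ℕ) : Setoid (Σ n : ℕ, Fin n → OddPart (FreeProP p n)) where
  r a b := Nonempty (SigmaEquiv (RelGroup a.2) (RelGroup b.2))
  iseqv :=
    { refl := fun _ => ⟨SigmaEquiv.refl⟩
      symm := fun ⟨e⟩ => ⟨e.symm⟩
      trans := fun ⟨e⟩ ⟨f⟩ => ⟨e.trans f⟩ }

/-- The set `Sch` of `σ`-isomorphism classes of the groups `G_r` for all `n ≥ 0` and
`r ∈ (F_n⁻)ⁿ`. -/
def Sch (p : ℕ) : Type := Quotient (relSetoid p)

/-- The map `Θ_n : (F_n⁻)ⁿ → Sch`, `r ↦ [G_r]`. -/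
def theta (p n : ℕ) (r : Fin n → OddPart (FreeProP p n)) : Sch p :=
  Quotient.mk (relSetoid p) ⟨n, r⟩

/-- The class `[G] ∈ Sch` of a weak Schur `σ`-group `G`. -/
noncomputable def Sch.classOf {p : ℕ} {G : Type u} [Group G] [TopologicalSpace G] [SigmaGroup G]
    (h : IsWeakSchur p G) : Sch p :=
  theta p h.choose h.choose_spec.choose

theorem Sch.classOf_eq_theta_iff {p : ℕ} {G : Type u} [Group G] [TopologicalSpace G] [SigmaGroup G]
    (h : IsWeakSchur p G) {n : ℕ} (r : Fin n → OddPart (FreeProP p n)) :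
    Sch.classOf h = theta p n r ↔ Nonempty (SigmaEquiv G (RelGroup r)) := by
  have e := h.choose_spec.choose_spec
  constructor
  · intro heq
    obtain ⟨e⟩ := e
    obtain ⟨f⟩ := Quotient.exact heq
    exact ⟨e.trans f⟩
  · rintro ⟨f⟩
    obtain ⟨e⟩ := e
    exact Quotient.sound ⟨e.symm.trans f⟩

/-! ### The topology and the measures on `Sch` -/

/-- The subset `U_{i,G} = {[H] | H / D_i(H) ≅ G / D_i(G)}` of `Sch` for `G = G_r`. -/
def basicSet (p : ℕ) [Fact p.Prime] (i : ℕ) {n : ℕ} (r : Fin n → OddPart (FreeProP p n)) :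
    Set (Sch p) :=
  {x | ∃ (m : ℕ) (s : Fin m → OddPart (FreeProP p m)), x = theta p m s ∧
    Nonempty (SigmaEquiv (RelGroup s ⧸ zassenhaus p (RelGroup s) i)
      (RelGroup r ⧸ zassenhaus p (RelGroup r) i))}

/-- The topology on `Sch` generated by the sets `U_{i,G}` for all `i ≥ 2` and `[G] ∈ Sch`. -/
instance (p : ℕ) [Fact p.Prime] : TopologicalSpace (Sch p) :=
  TopologicalSpace.generateFrom
    {U | ∃ (i n : ℕ) (r : Fin n → OddPart (FreeProP p n)), 2 ≤ i ∧ U = basicSet p i r}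

/-- The Borel `σ`-algebra. -/
instance (p : ℕ) [Fact p.Prime] : MeasurableSpace (Sch p) := borel _

instance (p : ℕ) [Fact p.Prime] : BorelSpace (Sch p) := ⟨rfl⟩

/-- The measure `μ_n` on `Sch`: the pushforward under `Θ_n` of the product of the Haar measures
on the factors of `(F_n⁻)ⁿ`. -/
noncomputable def schMeasure (p : ℕ) [Fact p.Prime] (n : ℕ) : Measure (Sch p) :=
  (Measure.pi fun _ : Fin n => haarOdd (FreeProP p n)).map (theta p n)

/-- `μ` is the limit measure `μ_∞` on `Sch`: the probability measure to which the measures `μ_n`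
converge setwise for `n → ∞`, that is, `μ_n(A) → μ(A)` for every Borel set `A`. -/
structure IsLimitMeasure (p : ℕ) [Fact p.Prime] (μ : Measure (Sch p)) : Prop where
  isProbabilityMeasure : IsProbabilityMeasure μ
  tendsto : ∀ A : Set (Sch p), MeasurableSet A →
    Tendsto (fun n => schMeasure p n A) atTop (𝓝 (μ A))

theorem IsLimitMeasure.unique {p : ℕ} [Fact p.Prime] {μ ν : Measure (Sch p)}
    (hμ : IsLimitMeasure p μ) (hν : IsLimitMeasure p ν) : μ = ν :=
  Measure.ext fun A hA => tendsto_nhds_unique (hμ.tendsto A hA) (hν.tendsto A hA)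

/-- The constant `C_∞ = ∏_{i ≥ 1} (1 - p⁻ⁱ)`. -/
noncomputable def cInf (p : ℕ) : ℝ := ∏' i : ℕ, (1 - ((p : ℝ) ^ (i + 1))⁻¹)

theorem multipliable_cInf (p : ℕ) [hp : Fact p.Prime] :
    Multipliable fun i : ℕ => 1 - ((p : ℝ) ^ (i + 1))⁻¹ := by
  have h1 : (1 : ℝ) < p := by exact_mod_cast hp.out.one_lt
  have h2 : Summable fun i : ℕ => ‖-((p : ℝ) ^ (i + 1))⁻¹‖ := by
    have h3 := (summable_geometric_of_lt_one (inv_nonneg.2 (by linarith))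
      (inv_lt_one_of_one_lt₀ h1)).mul_left (p : ℝ)⁻¹
    refine h3.congr fun i => ?_
    rw [norm_neg, norm_inv, norm_pow, Real.norm_of_nonneg (by linarith), pow_succ, mul_inv,
      inv_pow, mul_comm]
  simpa [sub_eq_add_neg] using multipliable_one_add_of_summable h2

end SchurSigma

/-!
The probability that `n` random odd relations in `F_n` present a given group is computed by three
elementary observations about free pro-`p` groups; no homological algebra is needed.

*Existence of the limit.* If the first of `n + 1` random relations in `F_{n+1}` lies outside the
Frattini subgroup, which happens with probability `1 - p⁻⁽ⁿ⁺¹⁾`, then it is a member of a system of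
free generators (`FreeProP.exists_eliminate`), because surjective endomorphisms of `F_{n+1}` are
bijective. Eliminating it leaves `n` random relations in `F_n`, since surjections preserve the Haar
measures of odd parts (`measurePreserving_odd`). Hence `(1 - p⁻⁽ⁿ⁺¹⁾) μ_n ≤ μ_{n+1}`
(`smul_schMeasure_le`). The measures `μ_n / ∏_{i ≤ n} (1 - p⁻ⁱ)` therefore increase, and as the
product converges to `C_∞ > 0`, the `μ_n` converge setwise (`exists_setwise_limit`).

*Topology.* The subgroup `D_i(F_n)` is open by Schreier's lemma, so `r ↦ [G_r]` is continuous. If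
`D_i(G) = 1`, and `H` agrees with `G` modulo `D_{p i}`, then `D_i(H) = D_{p i}(H)` is contained in
`D_i(H)^p [D_i(H), H]`, hence trivial by Nakayama's lemma (`zassenhaus_eq_bot_of_le`), and `H` is
isomorphic to `G`. So `{[G]}` is a basic open set, and by symmetry it is closed
(`isOpen_and_isClosed_singleton_theta`).

*Mass of a finite group `Q`.* Let `Q` be presented by `r ∈ (F_n⁻)ⁿ` with kernel `N`. The quotient of
`N` by `N^p [N, F_n]` is an odd elementary abelian `p`-group of rank exactly `n`
(`card_relModule`): with fewer relations `F_n` would have no finite quotient, as one sees in the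
abelian groups `(ℤ/p^k)^n`. By Nakayama's lemma `n` random relations generate `N` with probability
`|Q⁻|⁻ⁿ ∏_{i ≤ n} (1 - p⁻ⁱ)` (`measure_relSubgroup_eq`). Summing over the surjections `F_n → Q`,
that is over the generating `n`-tuples of odd elements of `Q`, counts each presentation
`|Aut_σ(Q)|` times (`sum_measure_presentedBy`). Almost all tuples of odd elements do
contribute: the kernels belonging to two tuples which agree on a generating subtuple differ by an
automorphism of `F_n` (`exists_sigmaEquiv_tupleHom`), so every tuple which generates `Q` already in
certain `n - O(1)` places is related in two steps to one obtained from the given presentation. Hence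
`|Aut_σ(Q)| μ_n({[Q]})` is `∏_{i ≤ n} (1 - p⁻ⁱ)` up to an error which tends to zero.
-/

namespace SchurSigma

open Topology MeasureTheory Filter

universe u v w

open SigmaGroup
open scoped commutatorElement ENNReal

/-! ### Equivariant homomorphisms -/

/-- A continuous `σ`-equivariant homomorphism. -/
structure IsSigmaHom {G : Type u} {H : Type v} [Group G] [TopologicalSpace G] [SigmaGroup G]
    [Group H] [TopologicalSpace H] [SigmaGroup H] (f : G →* H) : Prop where
  continuous : Continuous f
  map_sigma : ∀ g, f (sigma g) = sigma (f g)

section SigmaHom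

variable {G : Type u} {H : Type v} {K : Type w} [Group G] [TopologicalSpace G] [SigmaGroup G]
    [Group H] [TopologicalSpace H] [SigmaGroup H] [Group K] [TopologicalSpace K] [SigmaGroup K]

theorem IsSigmaHom.comp {f : H →* K} {g : G →* H} (hf : IsSigmaHom f) (hg : IsSigmaHom g) :
    IsSigmaHom (f.comp g) :=
  ⟨hf.continuous.comp hg.continuous, fun x => by simp [hg.map_sigma, hf.map_sigma]⟩

theorem IsSigmaHom.mk' (N : Subgroup G) [N.Normal] [SigmaInvariant N] :
    IsSigmaHom (QuotientGroup.mk' N) :=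
  ⟨QuotientGroup.continuous_mk, fun _ => rfl⟩

theorem SigmaEquiv.isSigmaHom (e : SigmaEquiv G H) :
    IsSigmaHom (e.toContinuousMulEquiv : G →* H) :=
  ⟨e.toContinuousMulEquiv.continuous, e.map_sigma⟩

theorem SigmaEquiv.ext {e e' : SigmaEquiv G H}
    (h : ∀ g, e.toContinuousMulEquiv g = e'.toContinuousMulEquiv g) : e = e' := by
  obtain ⟨e, he⟩ := e
  obtain ⟨e', he'⟩ := e'
  obtain rfl : e = e' := ContinuousMulEquiv.ext h
  rfl

/-- The map on odd parts induced by an equivariant homomorphism. -/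
def IsSigmaHom.odd {f : G →* H} (hf : IsSigmaHom f) (a : OddPart G) : OddPart H :=
  ⟨f a.1, by rw [← hf.map_sigma, a.2, map_inv]⟩

theorem IsSigmaHom.continuous_odd {f : G →* H} (hf : IsSigmaHom f) : Continuous hf.odd :=
  (hf.continuous.comp continuous_subtype_val).subtype_mk _

theorem IsSigmaHom.odd_toOdd {f : G →* H} (hf : IsSigmaHom f) (g : G) :
    hf.odd (toOdd g) = toOdd (f g) :=
  Subtype.ext (by
    change f ((sigma g)⁻¹ * g) = (sigma (f g))⁻¹ * f g
    rw [map_mul, map_inv, hf.map_sigma])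

/-- Two equivariant quotient maps of a compact group with the same kernel have isomorphic images,
compatibly with the maps. -/
theorem exists_sigmaEquiv_of_ker_eq [CompactSpace G] [T2Space H] [T2Space K]
    {f : G →* H} {g : G →* K} (hf : IsSigmaHom f) (hg : IsSigmaHom g)
    (hfs : Function.Surjective f) (hgs : Function.Surjective g) (hker : f.ker = g.ker) :
    ∃ e : SigmaEquiv H K, ∀ x, e.toContinuousMulEquiv (f x) = g x := by
  let φ : H ≃* K := (QuotientGroup.quotientKerEquivOfSurjective f hfs).symm.trans
    ((QuotientGroup.quotientMulEquivOfEq hker).trans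
      (QuotientGroup.quotientKerEquivOfSurjective g hgs))
  have hφ : ∀ x, φ (f x) = g x := by
    intro x
    have : (QuotientGroup.quotientKerEquivOfSurjective f hfs).symm (f x) = QuotientGroup.mk x := by
      rw [MulEquiv.symm_apply_eq]; rfl
    simp only [φ, MulEquiv.trans_apply, this]
    rfl
  have hqf : IsQuotientMap f := hf.continuous.isClosedMap.isQuotientMap hf.continuous hfs
  have hqg : IsQuotientMap g := hg.continuous.isClosedMap.isQuotientMap hg.continuous hgs
  have h1 : Continuous φ := hqf.continuous_iff.2 (by
    rw [show φ ∘ f = g from funext hφ]; exact hg.continuous)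
  have h2 : Continuous φ.symm := hqg.continuous_iff.2 (by
    rw [show φ.symm ∘ g = f from funext fun x => by simp [← hφ x]]; exact hf.continuous)
  refine ⟨⟨⟨φ, h1, h2⟩, ?_⟩, hφ⟩
  intro y
  obtain ⟨x, rfl⟩ := hfs y
  change φ (sigma (f x)) = sigma (φ (f x))
  rw [← hf.map_sigma, hφ, hφ, hg.map_sigma]

instance finite_sigmaAut [Finite G] [Finite H] : Finite (SigmaEquiv G H) :=
  Finite.of_injective (fun e : SigmaEquiv G H => (e.toContinuousMulEquiv : G → H))
    fun _ _ h => SigmaEquiv.ext (congrFun h)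

/-- In a finite group of odd order every odd element has the form `(σ g)⁻¹ g`. -/
theorem toOdd_surjective [Finite G] (hodd : Odd (Nat.card G)) :
    Function.Surjective (toOdd : G → OddPart G) := by
  intro y
  have h := card_toOdd_fiber hodd y
  have h0 : Nat.card {x : G // toOdd x = y} ≠ 0 := by
    intro h0
    rw [h0, zero_mul] at h
    exact Nat.card_pos.ne h
  obtain ⟨⟨x, hx⟩⟩ := (Nat.card_ne_zero.1 h0).1
  exact ⟨x, hx⟩

end SigmaHom

/-! ### Pro-`p` groups -/

section ProP

variable {p : ℕ} {G : Type u} {H : Type v} [Group G] [TopologicalSpace G]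
  [Group H] [TopologicalSpace H]

theorem IsProP.exists_le (hG : IsProP p G) {N : Subgroup G} (hN : IsOpen (N : Set G)) :
    ∃ M : Subgroup G, M.Normal ∧ IsOpen (M : Set G) ∧ (∃ k : ℕ, M.index = p ^ k) ∧ M ≤ N :=
  hG.exists_subgroup N (hN.mem_nhds N.one_mem)

/-- A closed subgroup `K` of a pro-`p` group is the intersection of the subgroups `K ⊔ U` for the
open normal subgroups `U`. -/
theorem IsProP.le_of_forall_le_sup (hG : IsProP p G) {A K : Subgroup G} (hK : IsClosed (K : Set G))
    (h : ∀ U : Subgroup G, U.Normal → IsOpen (U : Set G) → A ≤ K ⊔ U) : A ≤ K := by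
  have := hG.isTopologicalGroup
  intro a ha
  by_contra hne
  have hmem : (fun x => a * x) ⁻¹' (K : Set G)ᶜ ∈ 𝓝 (1 : G) := by
    refine ContinuousAt.preimage_mem_nhds (continuous_const_mul a).continuousAt ?_
    rw [mul_one]
    exact hK.isOpen_compl.mem_nhds hne
  obtain ⟨U, hU, hUo, -, hsub⟩ := hG.exists_subgroup _ hmem
  have h1 := h U hU hUo ha
  rw [Subgroup.mem_sup_of_normal_right] at h1
  obtain ⟨k, hk, x, hx, rfl⟩ := h1
  have := hsub (inv_mem hx)
  simp [hk] at this

variable [hp : Fact p.Prime]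

theorem IsProP.exists_index_eq (hG : IsProP p G) {N : Subgroup G} (hN : IsOpen (N : Set G)) :
    ∃ k : ℕ, N.index = p ^ k := by
  obtain ⟨M, -, -, ⟨k, hk⟩, hM⟩ := hG.exists_le hN
  obtain ⟨j, -, hj⟩ := (Nat.dvd_prime_pow hp.out).1 (hk ▸ Subgroup.index_dvd_of_le hM)
  exact ⟨j, hj⟩

theorem IsProP.isPGroup_quotient (hG : IsProP p G) {N : Subgroup G} [N.Normal]
    (hN : IsOpen (N : Set G)) : IsPGroup p (G ⧸ N) := by
  obtain ⟨k, hk⟩ := hG.exists_index_eq hN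
  exact IsPGroup.of_card hk

theorem IsProP.isPGroup [Finite G] (hG : IsProP p G) : IsPGroup p G := by
  have := hG.t2Space
  obtain ⟨k, hk⟩ := hG.exists_index_eq (N := (⊥ : Subgroup G)) (isOpen_discrete _)
  rw [Subgroup.index_bot] at hk
  exact IsPGroup.of_card hk

theorem odd_card_of_isPGroup {P : Type u} [Group P] [Finite P] (hP : IsPGroup p P) (hp2 : p ≠ 2) :
    Odd (Nat.card P) := by
  obtain ⟨k, hk⟩ := IsPGroup.iff_card.1 hP
  rw [hk]
  exact (hp.out.odd_of_ne_two hp2).pow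

end ProP

/-! ### Maps out of pro-`p` completions -/

namespace ProPCompletion

section Basic

variable {p : ℕ} {Γ : Type u} [Group Γ]

theorem isPGroup_level (N : PIndex p Γ) : IsPGroup p (Level N) := by
  obtain ⟨k, hk⟩ := N.2.2
  exact IsPGroup.of_card hk

theorem continuous_proj (N : PIndex p Γ) : Continuous (proj p Γ N) :=
  (continuous_apply N).comp continuous_subtype_val

theorem ext_proj {x y : ProPCompletion p Γ} (h : ∀ N, proj p Γ N x = proj p Γ N y) : x = y :=
  Subtype.ext (funext h)

variable [hp : Fact p.Prime]

/-- The kernel of a homomorphism to a finite `p`-group, as a normal subgroup of `p`-power index. -/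
def kerIndex {P : Type v} [Group P] [Finite P] (hP : IsPGroup p P) (f : Γ →* P) : PIndex p Γ :=
  ⟨f.ker, inferInstance, by
    obtain ⟨k, hk⟩ := IsPGroup.iff_card.1 (hP.to_subgroup f.range)
    exact ⟨k, by rw [Subgroup.index_ker, hk]⟩⟩

theorem exists_pIndex_le (I : Finset (PIndex p Γ)) : ∃ K : PIndex p Γ, ∀ N ∈ I, K.1 ≤ N.1 := by
  have hP : IsPGroup p (∀ N : I, Level N.1) := by
    have : ∃ k : ℕ, Nat.card (∀ N : I, Level N.1) = p ^ k := by
      choose k hk using fun N : I => N.1.2.2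
      exact ⟨∑ N, k N, by rw [Nat.card_pi, ← Finset.prod_pow_eq_pow_sum]
                          exact Finset.prod_congr rfl fun N _ => hk N⟩
    exact IsPGroup.iff_card.2 this
  refine ⟨kerIndex hP (MonoidHom.pi fun N : I => QuotientGroup.mk' N.1.1), fun N hN g hg => ?_⟩
  have := congrFun (MonoidHom.mem_ker.1 hg) ⟨N, hN⟩
  exact (QuotientGroup.eq_one_iff g).1 this

/-- The fibers of the projections to the finite levels form a basis of the topology. -/
theorem exists_proj_fiber_subset {x : ProPCompletion p Γ} {U : Set (ProPCompletion p Γ)}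
    (hU : U ∈ 𝓝 x) : ∃ K : PIndex p Γ, ∀ y, proj p Γ K y = proj p Γ K x → y ∈ U := by
  obtain ⟨V, hV, hVU⟩ := mem_nhds_induced
    (Subtype.val : limitSubgroup p Γ → ∀ N : PIndex p Γ, Level N) x U |>.1 hU
  rw [nhds_pi, Filter.mem_pi] at hV
  obtain ⟨I, hI, t, ht, htV⟩ := hV
  obtain ⟨K, hK⟩ := exists_pIndex_le hI.toFinset
  refine ⟨K, fun y hy => hVU (htV fun N hN => ?_)⟩
  have h1 : K.1 ≤ N.1 := hK N (hI.mem_toFinset.2 hN)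
  have h2 : y.1 N = x.1 N := by
    rw [← y.2 K N h1, ← x.2 K N h1]
    exact congrArg _ hy
  rw [h2]
  exact mem_of_mem_nhds (ht N)

theorem denseRange_of : DenseRange (of p Γ) := by
  intro x
  rw [mem_closure_iff_nhds]
  intro U hU
  obtain ⟨K, hK⟩ := exists_proj_fiber_subset hU
  obtain ⟨g, hg⟩ := QuotientGroup.mk'_surjective K.1 (proj p Γ K x)
  exact ⟨of p Γ g, hK _ hg, g, rfl⟩

/-- Continuous homomorphisms on the pro-`p` completion of `Γ` are determined on `Γ`. -/
theorem hom_ext {H : Type v} [Group H] [TopologicalSpace H] [T2Space H]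
    {f g : ProPCompletion p Γ →* H} (hf : Continuous f) (hg : Continuous g)
    (h : f.comp (of p Γ) = g.comp (of p Γ)) : f = g :=
  DFunLike.coe_injective (denseRange_of.equalizer hf hg (funext fun x => DFunLike.congr_fun h x))

/-- The extension to the pro-`p` completion of a homomorphism to a finite `p`-group. -/
def lift {P : Type v} [Group P] [Finite P] (hP : IsPGroup p P) (f : Γ →* P) :
    ProPCompletion p Γ →* P :=
  (QuotientGroup.kerLift f).comp (proj p Γ (kerIndex hP f))

theorem lift_of {P : Type v} [Group P] [Finite P] (hP : IsPGroup p P) (f : Γ →* P) (g : Γ) :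
    lift hP f (of p Γ g) = f g := rfl

theorem continuous_lift {P : Type v} [Group P] [Finite P] [TopologicalSpace P] (hP : IsPGroup p P)
    (f : Γ →* P) : Continuous (lift hP f) :=
  (continuous_of_discreteTopology (f := fun x : Level (kerIndex hP f) =>
    QuotientGroup.kerLift f x)).comp (continuous_proj _)

/-- The extension to the pro-`p` completion of a homomorphism to another pro-`p` completion. -/
def extend {Δ : Type v} [Group Δ] (f : Γ →* ProPCompletion p Δ) :
    ProPCompletion p Γ →* ProPCompletion p Δ where
  toFun x := ⟨fun N => lift (isPGroup_level N) ((proj p Δ N).comp f) x, fun N M h => by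
    refine DFunLike.congr_fun (f := (Level.trans h).comp (lift (isPGroup_level N)
      ((proj p Δ N).comp f))) (g := lift (isPGroup_level M) ((proj p Δ M).comp f)) ?_ x
    have hc : Continuous (Level.trans h) := continuous_of_discreteTopology
    refine hom_ext (hc.comp (continuous_lift _ _)) (continuous_lift _ _)
      (MonoidHom.ext fun g => ?_)
    exact (f g).2 N M h⟩
  map_one' := ext_proj fun N => map_one (lift (isPGroup_level N) ((proj p Δ N).comp f))
  map_mul' x y := ext_proj fun N => map_mul (lift (isPGroup_level N) ((proj p Δ N).comp f)) x y

theorem extend_of {Δ : Type v} [Group Δ] (f : Γ →* ProPCompletion p Δ) (g : Γ) :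
    extend f (of p Γ g) = f g := rfl

theorem continuous_extend {Δ : Type v} [Group Δ] (f : Γ →* ProPCompletion p Δ) :
    Continuous (extend f) :=
  Continuous.subtype_mk (continuous_pi fun _ => continuous_lift _ _) _

end Basic

end ProPCompletion

/-! ### Free pro-`p` groups -/

namespace FreeProP

open ProPCompletion

variable {p : ℕ} [hp : Fact p.Prime] {n m : ℕ}

theorem hom_ext {H : Type v} [Group H] [TopologicalSpace H] [T2Space H]
    {f g : FreeProP p n →* H} (hf : Continuous f) (hg : Continuous g)
    (h : ∀ i, f (gen p n i).1 = g (gen p n i).1) : f = g :=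
  ProPCompletion.hom_ext hf hg (FreeGroup.ext_hom _ _ h)

theorem eq_top_of_isClosed {H : Subgroup (FreeProP p n)} (hH : IsClosed (H : Set (FreeProP p n)))
    (h : ∀ i, (gen p n i).1 ∈ H) : H = ⊤ := by
  have h1 : (of p (FreeGroup (Fin n))).range ≤ H := by
    rw [MonoidHom.range_eq_map, ← FreeGroup.closure_range_of, MonoidHom.map_closure,
      Subgroup.closure_le]
    rintro _ ⟨_, ⟨i, rfl⟩, rfl⟩
    exact h i
  rw [eq_top_iff]
  intro x _
  exact closure_minimal (fun y hy => h1 hy) hH (denseRange_of x)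

/-- The continuous homomorphism from `F_n` to a finite `p`-group with prescribed values on the
generators. -/
def toFinite {P : Type v} [Group P] [Finite P] (hP : IsPGroup p P) (t : Fin n → P) :
    FreeProP p n →* P :=
  ProPCompletion.lift hP (FreeGroup.lift t)

theorem toFinite_gen {P : Type v} [Group P] [Finite P] (hP : IsPGroup p P) (t : Fin n → P)
    (i : Fin n) : toFinite hP t (gen p n i).1 = t i :=
  (lift_of hP (FreeGroup.lift t) (FreeGroup.of i)).trans (by simp)

theorem continuous_toFinite {P : Type v} [Group P] [Finite P] [TopologicalSpace P]
    (hP : IsPGroup p P) (t : Fin n → P) : Continuous (toFinite hP t) :=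
  continuous_lift _ _

/-- Equivariance has to be checked on the free generators only. -/
theorem isSigmaHom_of_gen {H : Type v} [Group H] [TopologicalSpace H] [T2Space H] [SigmaGroup H]
    {f : FreeProP p n →* H} (hf : Continuous f)
    (h : ∀ i, sigma (f (gen p n i).1) = (f (gen p n i).1)⁻¹) : IsSigmaHom f := by
  refine ⟨hf, fun x => ?_⟩
  refine DFunLike.congr_fun (f := f.comp sigma) (g := (sigma : H →* H).comp f) ?_ x
  refine hom_ext (hf.comp continuous_sigma) (continuous_sigma.comp hf) fun i => ?_
  rw [MonoidHom.comp_apply, MonoidHom.comp_apply, h, (gen p n i).2, map_inv]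

theorem isSigmaHom_toFinite {P : Type v} [Group P] [Finite P] [TopologicalSpace P] [T2Space P]
    [SigmaGroup P] (hP : IsPGroup p P) (t : Fin n → OddPart P) :
    IsSigmaHom (toFinite hP fun i => (t i).1) :=
  isSigmaHom_of_gen (continuous_toFinite _ _) fun i => by rw [toFinite_gen, (t i).2]

/-- The continuous homomorphism between free pro-`p` groups with prescribed odd values on the
generators. -/
def toFree (y : Fin n → OddPart (FreeProP p m)) : FreeProP p n →* FreeProP p m :=
  ProPCompletion.extend (FreeGroup.lift fun i => (y i).1)

theorem toFree_gen (y : Fin n → OddPart (FreeProP p m)) (i : Fin n) :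
    toFree y (gen p n i).1 = (y i).1 :=
  (extend_of (FreeGroup.lift fun i => (y i).1) (FreeGroup.of i)).trans (by simp)

theorem isSigmaHom_toFree (y : Fin n → OddPart (FreeProP p m)) : IsSigmaHom (toFree y) :=
  isSigmaHom_of_gen (continuous_extend _) fun i => by rw [toFree_gen, (y i).2]

instance : Countable (PIndex p (FreeGroup (Fin n))) := by
  have hfg : ∀ N : PIndex p (FreeGroup (Fin n)), N.1.FG := by
    intro N
    obtain ⟨k, hk⟩ := N.2.2
    have : N.1.FiniteIndex := ⟨by rw [hk]; exact pow_ne_zero _ hp.out.ne_zero⟩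
    exact (Group.fg_iff_subgroup_fg _).1 inferInstance
  choose S hS using hfg
  refine Function.Injective.countable (f := S) fun N M h => Subtype.ext ?_
  rw [← hS N, ← hS M, h]

instance : SecondCountableTopology (FreeProP p n) :=
  have : ∀ N : PIndex p (FreeGroup (Fin n)), SecondCountableTopology (Level N) :=
    fun _ => inferInstance
  TopologicalSpace.Subtype.secondCountableTopology
    {f | f ∈ limitSubgroup p (FreeGroup (Fin n))}

instance : SecondCountableTopology (OddPart (FreeProP p n)) :=
  TopologicalSpace.Subtype.secondCountableTopology {a : FreeProP p n | sigma a = a⁻¹}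

/-- The free pro-`p` group `F_n` is Hopfian: for a finite group `P`, composition with a surjective
endomorphism permutes the finite set of continuous homomorphisms `F_n → P`, and these separate the
points. -/
theorem injective_of_surjective {f : FreeProP p n →* FreeProP p n} (hf : Continuous f)
    (hs : Function.Surjective f) : Function.Injective f := by
  refine (injective_iff_map_eq_one f).2 fun x hx => ext_proj fun N => ?_
  let X := {φ : FreeProP p n →* Level N // Continuous φ}
  have : Finite X := by
    refine Finite.of_injective (fun φ i => φ.1 (gen p n i).1 : X → (Fin n → Level N)) ?_
    intro φ ψ h
    exact Subtype.ext (hom_ext φ.2 ψ.2 (congrFun h))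
  let F : X → X := fun φ => ⟨φ.1.comp f, φ.2.comp hf⟩
  have hF : Function.Injective F := by
    intro φ ψ h
    refine Subtype.ext (MonoidHom.ext fun y => ?_)
    obtain ⟨z, rfl⟩ := hs y
    exact DFunLike.congr_fun (congrArg Subtype.val h) z
  obtain ⟨φ, hφ⟩ := Finite.surjective_of_injective hF ⟨proj p _ N, continuous_proj N⟩
  have h2 := DFunLike.congr_fun (congrArg Subtype.val hφ) x
  change φ.1 (f x) = proj p _ N x at h2
  rw [← h2, hx, map_one, map_one]

end FreeProP

/-! ### Frattini subgroups -/

section Abstract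

theorem map_normalClosure_powers {p : ℕ} {P : Type u} {Q : Type v} [Group P] [Group Q]
    {f : P →* Q} (hf : Function.Surjective f)
    (N : Subgroup P) :
    (Subgroup.normalClosure ((fun x => x ^ p) '' (N : Set P)) ⊔ ⁅N, (⊤ : Subgroup P)⁆).map f =
      Subgroup.normalClosure ((fun x => x ^ p) '' (N.map f : Set Q)) ⊔
        ⁅N.map f, (⊤ : Subgroup Q)⁆ := by
  rw [Subgroup.map_sup, Subgroup.map_normalClosure _ _ hf, Subgroup.map_commutator,
    Subgroup.map_top_of_surjective f hf, Set.image_image, Subgroup.coe_map, Set.image_image]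
  simp

variable {p : ℕ} [hp : Fact p.Prime] {P : Type u} [Group P] [Finite P]

/-- Nakayama's lemma for a normal subgroup `N` of a finite `p`-group: modulo `[N, P]` the
subgroup `N` is abelian and `p`-divisible, hence trivial; so `N = [N, P]`, and `N = 1` because the
group is nilpotent. -/
theorem eq_bot_of_le_powers_sup_commutator (hP : IsPGroup p P) (N : Subgroup P) [N.Normal]
    (h : N ≤ Subgroup.normalClosure ((fun x => x ^ p) '' (N : Set P)) ⊔ ⁅N, (⊤ : Subgroup P)⁆) :
    N = ⊥ := by
  set C : Subgroup P := ⁅N, (⊤ : Subgroup P)⁆ with hC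
  have hcomm : ∀ x ∈ N, ∀ y : P, Commute (x : P ⧸ C) (y : P ⧸ C) := by
    intro x hx y
    rw [← commutatorElement_eq_one_iff_commute]
    exact (QuotientGroup.eq_one_iff ⁅x, y⁆).2
      (Subgroup.commutator_mem_commutator hx (Subgroup.mem_top y))
  -- the elements that are `p`-th powers of elements of `N` modulo `C`
  let T : Subgroup P :=
    { carrier := {x | ∃ y ∈ N, (x : P ⧸ C) = (y : P ⧸ C) ^ p}
      one_mem' := ⟨1, N.one_mem, by simp⟩
      mul_mem' := by
        rintro a b ⟨x, hx, hax⟩ ⟨y, hy, hby⟩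
        refine ⟨x * y, N.mul_mem hx hy, ?_⟩
        rw [QuotientGroup.mk_mul, QuotientGroup.mk_mul, (hcomm x hx y).mul_pow, hax, hby]
      inv_mem' := by
        rintro a ⟨x, hx, hax⟩
        refine ⟨x⁻¹, N.inv_mem hx, ?_⟩
        rw [QuotientGroup.mk_inv, QuotientGroup.mk_inv, hax, inv_pow] }
  have hT : T.Normal := ⟨by
    rintro a ⟨x, hx, hax⟩ g
    refine ⟨g * x * g⁻¹, Subgroup.Normal.conj_mem inferInstance x hx g, ?_⟩
    simp only [QuotientGroup.mk_mul, QuotientGroup.mk_inv, hax, conj_pow]⟩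
  have hNT : N ≤ T := by
    refine h.trans (sup_le (Subgroup.normalClosure_le_normal ?_) fun x hx => ?_)
    · rintro _ ⟨x, hx, rfl⟩
      exact ⟨x, hx, QuotientGroup.mk_pow _ _ _⟩
    · refine ⟨1, N.one_mem, ?_⟩
      rw [QuotientGroup.mk_one, one_pow]
      exact (QuotientGroup.eq_one_iff x).2 hx
  have hiter : ∀ k : ℕ, ∀ x ∈ N, ∃ y ∈ N, (x : P ⧸ C) = (y : P ⧸ C) ^ p ^ k := by
    intro k
    induction k with
    | zero => exact fun x hx => ⟨x, hx, by simp⟩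
    | succ k ih =>
      intro x hx
      obtain ⟨y, hy, hxy⟩ := ih x hx
      obtain ⟨z, hz, hyz⟩ := hNT hy
      exact ⟨z, hz, by rw [hxy, hyz, ← pow_mul, pow_succ' p k]⟩
  have hNC : N ≤ C := by
    intro x hx
    obtain ⟨k, hk⟩ := IsPGroup.iff_card.1 hP
    obtain ⟨y, -, hxy⟩ := hiter k x hx
    rw [← QuotientGroup.mk_pow, ← hk, pow_card_eq_one', QuotientGroup.mk_one] at hxy
    exact (QuotientGroup.eq_one_iff x).1 hxy
  have hlcs : ∀ k, N ≤ Subgroup.lowerCentralSeries ⊤ k := by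
    intro k
    induction k with
    | zero => simp
    | succ k ih =>
      rw [Subgroup.lowerCentralSeries_succ]
      exact hNC.trans (Subgroup.commutator_mono ih le_rfl)
  have hnil : Group.IsNilpotent P := hP.isNilpotent
  obtain ⟨k, hk⟩ := Subgroup.nilpotent_iff_lowerCentralSeries.1 hnil
  exact le_bot_iff.1 (hk ▸ hlcs k)

theorem le_of_le_sup_powers_sup_commutator (hP : IsPGroup p P) (N K : Subgroup P) [N.Normal]
    [K.Normal]
    (h : N ≤ K ⊔
      (Subgroup.normalClosure ((fun x => x ^ p) '' (N : Set P)) ⊔ ⁅N, (⊤ : Subgroup P)⁆)) :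
    N ≤ K := by
  have hs := QuotientGroup.mk'_surjective K
  have hn : (N.map (QuotientGroup.mk' K)).Normal := Subgroup.Normal.map inferInstance _ hs
  have h1 := Subgroup.map_mono (f := QuotientGroup.mk' K) h
  rw [Subgroup.map_sup, map_normalClosure_powers hs, QuotientGroup.map_mk'_self, bot_sup_eq] at h1
  have h2 := eq_bot_of_le_powers_sup_commutator (hP.to_quotient K) _ h1
  rwa [Subgroup.map_eq_bot_iff, QuotientGroup.ker_mk'] at h2

/-- A proper subgroup of a finite `p`-group is contained in a normal subgroup of index `p`. -/
theorem exists_normal_index_eq_of_isPGroup (hP : IsPGroup p P) {H : Subgroup P} (hH : H ≠ ⊤) :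
    ∃ M : Subgroup P, M.Normal ∧ M.index = p ∧ H ≤ M := by
  obtain ⟨k, hk⟩ := IsPGroup.iff_card.1 hP
  obtain ⟨j, hj⟩ := IsPGroup.iff_card.1 (hP.to_subgroup H)
  have hjk : j < k := by
    by_contra hle
    refine hH (Subgroup.eq_top_of_le_card H ?_)
    rw [hk, hj]
    exact Nat.pow_le_pow_right hp.out.pos (not_lt.1 hle)
  obtain ⟨l, rfl⟩ : ∃ l, k = l + 1 := ⟨k - 1, by omega⟩
  obtain ⟨M, hM, hHM⟩ := Sylow.exists_subgroup_card_pow_prime_le p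
    (show p ^ l ∣ Nat.card P from hk ▸ pow_dvd_pow p (Nat.le_succ l)) H hj (by omega)
  have hidx : M.index = p := by
    have := M.card_mul_index
    rw [hM, hk, pow_succ] at this
    exact Nat.eq_of_mul_eq_mul_left (pow_pos hp.out.pos l) this
  refine ⟨M, Subgroup.normal_of_index_eq_minFac_card ?_, hidx, hHM⟩
  rw [hidx, hk, hp.out.pow_minFac (Nat.succ_ne_zero l)]

end Abstract

section Frattini

variable (p : ℕ) {G : Type u} [Group G] [TopologicalSpace G] [IsTopologicalGroup G]

/-- The closed normal subgroup `N ^ p [N, G]` of a topological group `G`, for a normal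
subgroup `N`. -/
def frattini (N : Subgroup G) : Subgroup G :=
  (Subgroup.normalClosure ((fun x => x ^ p) '' (N : Set G)) ⊔
    ⁅N, (⊤ : Subgroup G)⁆).topologicalClosure

variable {p} {N : Subgroup G}

theorem isClosed_frattini : IsClosed (frattini p N : Set G) :=
  Subgroup.isClosed_topologicalClosure _

theorem pow_mem_frattini {x : G} (hx : x ∈ N) : x ^ p ∈ frattini p N :=
  Subgroup.le_topologicalClosure _
    (Subgroup.mem_sup_left (Subgroup.subset_normalClosure ⟨x, hx, rfl⟩))

theorem commutator_mem_frattini {x : G} (hx : x ∈ N) (y : G) : ⁅x, y⁆ ∈ frattini p N :=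
  Subgroup.le_topologicalClosure _
    (Subgroup.mem_sup_right (Subgroup.commutator_mem_commutator hx (Subgroup.mem_top y)))

theorem frattini_le {L : Subgroup G} [L.Normal] (hL : IsClosed (L : Set G))
    (h1 : ∀ x ∈ N, x ^ p ∈ L) (h2 : ⁅N, (⊤ : Subgroup G)⁆ ≤ L) : frattini p N ≤ L := by
  refine Subgroup.topologicalClosure_minimal _
    (sup_le (Subgroup.normalClosure_le_normal ?_) h2) hL
  rintro _ ⟨x, hx, rfl⟩
  exact h1 x hx

variable [N.Normal]

instance frattini_normal : (frattini p N).Normal :=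
  Subgroup.is_normal_topologicalClosure _

theorem frattini_le_self (hN : IsClosed (N : Set G)) : frattini p N ≤ N :=
  frattini_le hN (fun _ hx => pow_mem hx p) (Subgroup.commutator_le_left _ _)

instance frattini_sigmaInvariant [SigmaGroup G] [SigmaInvariant N] :
    SigmaInvariant (frattini p N) where
  le_comap := by
    have hc : IsClosed ((frattini p N).comap (sigma : G →* G) : Set G) :=
      isClosed_frattini.preimage continuous_sigma
    refine frattini_le hc (fun x hx => ?_) ?_
    · rw [Subgroup.mem_comap, map_pow]
      have h : sigma x ∈ N := SigmaInvariant.le_comap (N := N) hx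
      exact pow_mem_frattini h
    · rw [Subgroup.commutator_le]
      intro x hx y _
      rw [Subgroup.mem_comap, map_commutatorElement]
      have h : sigma x ∈ N := SigmaInvariant.le_comap (N := N) hx
      exact commutator_mem_frattini h _

/-- Nakayama's lemma for normal subgroups of a pro-`p` group. -/
theorem IsProP.le_of_le_sup_frattini [Fact p.Prime] [CompactSpace G] (hG : IsProP p G)
    {K : Subgroup G} [K.Normal] (hK : IsClosed (K : Set G)) (h : N ≤ K ⊔ frattini p N) :
    N ≤ K := by
  refine hG.le_of_forall_le_sup hK fun U hU hUo => ?_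
  have hs := QuotientGroup.mk'_surjective U
  have := Subgroup.quotient_finite_of_isOpen U hUo
  have := QuotientGroup.discreteTopology hUo
  have hn : (N.map (QuotientGroup.mk' U)).Normal := Subgroup.Normal.map inferInstance _ hs
  have hk : (K.map (QuotientGroup.mk' U)).Normal := Subgroup.Normal.map inferInstance _ hs
  set W := Subgroup.normalClosure ((fun x => x ^ p) '' (N : Set G)) ⊔ ⁅N, (⊤ : Subgroup G)⁆
  have hW : IsClosed ((W.map (QuotientGroup.mk' U)).comap (QuotientGroup.mk' U) : Set G) :=
    (isClosed_discrete (W.map (QuotientGroup.mk' U) : Set (G ⧸ U))).preimage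
      QuotientGroup.continuous_mk
  have h1 : (frattini p N).map (QuotientGroup.mk' U) ≤ W.map (QuotientGroup.mk' U) := by
    rw [Subgroup.map_le_iff_le_comap]
    exact Subgroup.topologicalClosure_minimal _ (Subgroup.le_comap_map _ _) hW
  rw [map_normalClosure_powers hs] at h1
  have h2 := Subgroup.map_mono (f := QuotientGroup.mk' U) h
  rw [Subgroup.map_sup] at h2
  have h3 := le_of_le_sup_powers_sup_commutator (hG.isPGroup_quotient hUo) _ _
    (h2.trans (sup_le_sup_left h1 _))
  rwa [Subgroup.map_le_iff_le_comap, QuotientGroup.comap_map_mk', sup_comm] at h3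

/-- A proper closed subgroup of a pro-`p` group is contained in an open normal subgroup of
index `p`. -/
theorem IsProP.exists_normal_index_eq [Fact p.Prime] [CompactSpace G] (hG : IsProP p G)
    {H : Subgroup G} (hH : IsClosed (H : Set G)) (hne : H ≠ ⊤) :
    ∃ M : Subgroup G, M.Normal ∧ IsOpen (M : Set G) ∧ M.index = p ∧ H ≤ M := by
  obtain ⟨U, hU, hUo, hHU⟩ : ∃ U : Subgroup G, U.Normal ∧ IsOpen (U : Set G) ∧ H ⊔ U ≠ ⊤ := by
    by_contra! hcon
    exact hne (top_le_iff.1 (hG.le_of_forall_le_sup hH fun U hU hUo => (hcon U hU hUo).ge))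
  have := Subgroup.quotient_finite_of_isOpen U hUo
  have := QuotientGroup.discreteTopology hUo
  have hs := QuotientGroup.mk'_surjective U
  obtain ⟨M, hM, hidx, hle⟩ := exists_normal_index_eq_of_isPGroup (hG.isPGroup_quotient hUo)
    (H := H.map (QuotientGroup.mk' U)) (fun htop => hHU (by
      rw [sup_comm, ← QuotientGroup.comap_map_mk', htop, Subgroup.comap_top]))
  refine ⟨M.comap (QuotientGroup.mk' U), inferInstance,
    (isOpen_discrete (M : Set (G ⧸ U))).preimage QuotientGroup.continuous_mk, ?_,
    Subgroup.map_le_iff_le_comap.1 hle⟩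
  rw [Subgroup.index_comap_of_surjective _ hs, hidx]

/-- The quotient of `N` by its Frattini subgroup is central in `G` modulo the Frattini
subgroup. -/
theorem commute_mk_frattini {v : G ⧸ frattini p N}
    (hv : v ∈ N.map (QuotientGroup.mk' (frattini p N))) (w : G ⧸ frattini p N) : Commute v w := by
  obtain ⟨x, hx, rfl⟩ := hv
  obtain ⟨y, rfl⟩ := QuotientGroup.mk'_surjective _ w
  rw [← commutatorElement_eq_one_iff_commute]
  exact (QuotientGroup.eq_one_iff ⁅x, y⁆).2 (commutator_mem_frattini hx y)

theorem pow_mk_frattini {v : G ⧸ frattini p N}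
    (hv : v ∈ N.map (QuotientGroup.mk' (frattini p N))) : v ^ p = 1 := by
  obtain ⟨x, hx, rfl⟩ := hv
  exact (QuotientGroup.eq_one_iff (x ^ p)).2 (pow_mem_frattini hx)

theorem normal_of_le_map_frattini {C : Subgroup (G ⧸ frattini p N)}
    (hC : C ≤ N.map (QuotientGroup.mk' (frattini p N))) : C.Normal :=
  ⟨fun c hc g => by rwa [← (commute_mk_frattini (hC hc) g).eq, mul_inv_cancel_right]⟩

/-- If `N` is topologically generated as a normal subgroup by a finite set `S`, then `N` modulo its
Frattini subgroup is finite and generated by the image of `S`. -/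
theorem map_frattini_eq_closure (hp : 0 < p) {S : Set G} (hS : S.Finite) (hSN : S ⊆ N)
    (hN : N ≤ (Subgroup.normalClosure S).topologicalClosure) :
    N.map (QuotientGroup.mk' (frattini p N)) =
        Subgroup.closure (QuotientGroup.mk' (frattini p N) '' S) ∧
      Finite (N.map (QuotientGroup.mk' (frattini p N))) := by
  set π := QuotientGroup.mk' (frattini p N)
  set C := Subgroup.closure (π '' S) with hC
  have hCN : C ≤ N.map π := (Subgroup.closure_le _).2 (Set.image_mono hSN)
  have hfin : Finite C := by
    let _ : CommGroup C := { (inferInstance : Group C) with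
      mul_comm := fun a b => Subtype.ext (commute_mk_frattini (hCN a.2) b.1).eq }
    have hfg : Group.FG C := (Group.fg_iff_subgroup_fg C).2
      ((Subgroup.fg_iff C).2 ⟨_, hC.symm, hS.image π⟩)
    refine CommGroup.finite_of_fg_isMulTorsion C (fun a => ?_)
    exact isOfFinOrder_iff_pow_eq_one.2 ⟨p, hp, Subtype.ext (pow_mk_frattini (hCN a.2))⟩
  have hcl : IsClosed (frattini p N : Set G) := isClosed_frattini
  have hCc : IsClosed (C : Set (G ⧸ frattini p N)) :=
    Set.Finite.isClosed (Set.toFinite (C : Set (G ⧸ frattini p N)))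
  have hCn : C.Normal := normal_of_le_map_frattini hCN
  have heq : N.map π = C := by
    refine le_antisymm ?_ hCN
    rw [Subgroup.map_le_iff_le_comap]
    refine hN.trans (Subgroup.topologicalClosure_minimal _ (Subgroup.normalClosure_le_normal ?_)
      (hCc.preimage QuotientGroup.continuous_mk))
    exact fun s hs => Subgroup.subset_closure ⟨s, hs, rfl⟩
  exact ⟨heq, heq ▸ hfin⟩

theorem isOpen_frattini [CompactSpace G] (hp : 0 < p) (hNo : IsOpen (N : Set G)) {S : Set G}
    (hS : S.Finite) (hSN : S ⊆ N) (hN : N ≤ (Subgroup.normalClosure S).topologicalClosure) :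
    IsOpen (frattini p N : Set G) := by
  have hfin := (map_frattini_eq_closure hp hS hSN hN).2
  have := Subgroup.quotient_finite_of_isOpen N hNo
  have h1 := (N.map (QuotientGroup.mk' (frattini p N))).card_mul_index
  rw [Subgroup.index_map_eq _ (QuotientGroup.mk'_surjective _)
    (by rw [QuotientGroup.ker_mk']; exact frattini_le_self (N.isClosed_of_isOpen hNo))] at h1
  have h2 : (frattini p N).FiniteIndex := ⟨by
    rw [Subgroup.index, ← h1]
    have : N.FiniteIndex := Subgroup.finiteIndex_of_finite_quotient
    exact mul_ne_zero Nat.card_pos.ne' this.index_ne_zero⟩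
  exact Subgroup.isOpen_of_isClosed_of_finiteIndex _ isClosed_frattini

end Frattini

/-- The Frattini subgroup of an open normal subgroup of `F_n` is open, because open subgroups
of `F_n` are topologically finitely generated by Schreier's lemma. -/
theorem FreeProP.isOpen_frattini {p n : ℕ} [hp : Fact p.Prime] {N : Subgroup (FreeProP p n)}
    [N.Normal] (hNo : IsOpen (N : Set (FreeProP p n))) :
    IsOpen (frattini p N : Set (FreeProP p n)) := by
  have := Subgroup.quotient_finite_of_isOpen N hNo
  have : N.FiniteIndex := Subgroup.finiteIndex_of_finite_quotient
  let ι := ProPCompletion.of p (FreeGroup (Fin n))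
  have hfi : (N.comap ι).FiniteIndex :=
    ⟨by rw [Subgroup.index_comap]; exact Subgroup.FiniteIndex.index_ne_zero⟩
  have hfg : (N.comap ι).FG := (Group.fg_iff_subgroup_fg _).1 inferInstance
  obtain ⟨S, hS, hSfin⟩ := (Subgroup.fg_iff _).1 hfg
  refine SchurSigma.isOpen_frattini hp.out.pos hNo (hSfin.image ι) ?_ ?_
  · rintro _ ⟨s, hs, rfl⟩
    exact (hS ▸ Subgroup.subset_closure hs : s ∈ N.comap ι)
  · intro x hx
    have hle : (N.comap ι).map ι ≤ Subgroup.normalClosure (ι '' S) := by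
      rw [← hS, MonoidHom.map_closure]
      exact Subgroup.closure_le_normalClosure
    refine closure_mono hle (mem_closure_iff_nhds.2 fun U hU => ?_)
    obtain ⟨_, ⟨hyU, hyN⟩, g, rfl⟩ := mem_closure_iff_nhds.1 (ProPCompletion.denseRange_of x) _
      (Filter.inter_mem hU (hNo.mem_nhds hx))
    exact ⟨ι g, hyU, g, hyN, rfl⟩

/-! ### The Zassenhaus filtration of pro-`p` groups -/

theorem ceil_div_lt {p : ℕ} (hp2 : 2 ≤ p) {i : ℕ} (hi : 2 ≤ i) : (i + p - 1) / p < i := by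
  rw [Nat.div_lt_iff_lt_mul (by omega)]
  obtain ⟨a, rfl⟩ := Nat.exists_eq_add_of_le hi
  obtain ⟨b, rfl⟩ := Nat.exists_eq_add_of_le hp2
  have : (2 + a) * (2 + b) = 4 + 2 * a + 2 * b + a * b := by ring
  omega

section Zassenhaus

variable {p : ℕ} [hp : Fact p.Prime] {G : Type u} [Group G] [TopologicalSpace G]
  [IsTopologicalGroup G]

theorem zassenhaus_of_lt_two {i : ℕ} (hi : i < 2) : zassenhaus p G i = ⊤ := by
  rw [zassenhaus, if_pos hi]

theorem zassenhaus_of_two_le {i : ℕ} (hi : 2 ≤ i) : zassenhaus p G i =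
    (Subgroup.closure ((fun g => g ^ p) '' (zassenhaus p G ((i + p - 1) / p) : Set G)) ⊔
      ⨆ j : Fin (i - 1),
        ⁅zassenhaus p G (j + 1), zassenhaus p G (i - (j + 1))⁆).topologicalClosure := by
  rw [zassenhaus, if_neg (by omega)]

theorem isClosed_zassenhaus (i : ℕ) : IsClosed (zassenhaus p G i : Set G) := by
  by_cases hi : i < 2
  · rw [zassenhaus_of_lt_two hi]; exact isClosed_univ
  · rw [zassenhaus_of_two_le (by omega)]; exact Subgroup.isClosed_topologicalClosure _

instance (i : ℕ) : T2Space (G ⧸ zassenhaus p G i) := by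
  have : IsClosed (zassenhaus p G i : Set G) := isClosed_zassenhaus i
  infer_instance

theorem pow_mem_zassenhaus {i : ℕ} (hi : 2 ≤ i) {x : G}
    (hx : x ∈ zassenhaus p G ((i + p - 1) / p)) : x ^ p ∈ zassenhaus p G i := by
  rw [zassenhaus_of_two_le hi]
  exact Subgroup.le_topologicalClosure _
    (Subgroup.mem_sup_left (Subgroup.subset_closure ⟨x, hx, rfl⟩))

theorem commutator_le_zassenhaus {j k : ℕ} (hj : 1 ≤ j) (hk : 1 ≤ k) :
    ⁅zassenhaus p G j, zassenhaus p G k⁆ ≤ zassenhaus p G (j + k) := by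
  rw [zassenhaus_of_two_le (show 2 ≤ j + k by omega)]
  have h := le_iSup (fun l : Fin (j + k - 1) =>
    ⁅zassenhaus p G (l + 1), zassenhaus p G (j + k - (l + 1))⁆) ⟨j - 1, by omega⟩
  simp only [Nat.sub_add_cancel hj, Nat.add_sub_cancel_left] at h
  exact (h.trans le_sup_right).trans (Subgroup.le_topologicalClosure _)

theorem zassenhaus_le {i : ℕ} (hi : 2 ≤ i) {L : Subgroup G} (hL : IsClosed (L : Set G))
    (h1 : ∀ x ∈ zassenhaus p G ((i + p - 1) / p), x ^ p ∈ L)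
    (h2 : ∀ j k, 1 ≤ j → 1 ≤ k → j + k = i → ⁅zassenhaus p G j, zassenhaus p G k⁆ ≤ L) :
    zassenhaus p G i ≤ L := by
  rw [zassenhaus_of_two_le hi]
  refine Subgroup.topologicalClosure_minimal _ (sup_le ?_ (iSup_le fun j => ?_)) hL
  · rw [Subgroup.closure_le]
    rintro _ ⟨x, hx, rfl⟩
    exact h1 x hx
  · have := j.2
    exact h2 _ _ (by omega) (by omega) (by omega)

theorem zassenhaus_succ_le (i : ℕ) : zassenhaus p G (i + 1) ≤ zassenhaus p G i := by
  induction i using Nat.strong_induction_on with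
  | _ i ih =>
    have hp2 := hp.out.two_le
    by_cases hi : i < 2
    · rw [zassenhaus_of_lt_two hi]; exact le_top
    have hanti : ∀ j k, j ≤ k → k ≤ i → zassenhaus p G k ≤ zassenhaus p G j := by
      intro j k hjk
      induction k, hjk using Nat.le_induction with
      | base => exact fun _ => le_rfl
      | succ k _ ihk => exact fun hk => (ih k (by omega)).trans (ihk (by omega))
    refine zassenhaus_le (by omega) (isClosed_zassenhaus i) (fun x hx => ?_) ?_
    · refine pow_mem_zassenhaus (by omega) (hanti _ _ (Nat.div_le_div_right (by omega)) ?_ hx)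
      have := ceil_div_lt hp2 (show 2 ≤ i + 1 by omega)
      omega
    · intro j k hj hk hjk
      rcases Nat.lt_or_ge 1 j with h | h
      · refine (Subgroup.commutator_mono (hanti (j - 1) j (by omega) (by omega)) le_rfl).trans ?_
        have := commutator_le_zassenhaus (p := p) (G := G) (show 1 ≤ j - 1 by omega) hk
        rwa [show j - 1 + k = i by omega] at this
      · obtain rfl : k = i := by omega
        exact Subgroup.commutator_le_right _ _

theorem zassenhaus_antitone : Antitone (zassenhaus p G) :=
  antitone_nat_of_succ_le zassenhaus_succ_le

theorem frattini_zassenhaus_le {i : ℕ} (hi : 1 ≤ i) :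
    frattini p (zassenhaus p G i) ≤ zassenhaus p G (i + 1) := by
  refine frattini_le (isClosed_zassenhaus _) (fun x hx => ?_) ?_
  · refine pow_mem_zassenhaus (by omega) (zassenhaus_antitone ?_ hx)
    have := ceil_div_lt hp.out.two_le (show 2 ≤ i + 1 by omega)
    omega
  · have := commutator_le_zassenhaus (p := p) (G := G) hi le_rfl
    rwa [zassenhaus_of_lt_two (show 1 < 2 by omega)] at this

/-- If the filtration is constant between `i` and `p * i`, then it vanishes at `i`: every
generator of the `p * i`-th term is a `p`-th power from the `i`-th term or a commutator with an
entry in it. -/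
theorem zassenhaus_eq_bot_of_le [CompactSpace G] (hG : IsProP p G) {i : ℕ} (hi : 1 ≤ i)
    (h : zassenhaus p G i ≤ zassenhaus p G (p * i)) : zassenhaus p G i = ⊥ := by
  have hp2 := hp.out.two_le
  have := hG.t2Space
  have h2i : i + i ≤ p * i := by nlinarith
  have hle : zassenhaus p G (p * i) ≤ frattini p (zassenhaus p G i) := by
    refine zassenhaus_le (by omega) isClosed_frattini (fun x hx => ?_) ?_
    · rw [Nat.add_sub_assoc (by omega), Nat.mul_add_div (by omega),
        Nat.div_eq_of_lt (by omega)] at hx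
      exact pow_mem_frattini hx
    · intro j k hj hk hjk
      rw [Subgroup.commutator_le]
      intro x hx y hy
      rcases le_total i j with hij | hij
      · exact commutator_mem_frattini (zassenhaus_antitone hij hx) y
      · rw [← commutatorElement_inv]
        exact inv_mem (commutator_mem_frattini (zassenhaus_antitone (by omega) hy) x)
  refine le_bot_iff.1 (hG.le_of_le_sup_frattini ?_ ((h.trans hle).trans le_sup_right))
  rw [Subgroup.coe_bot]
  exact isClosed_singleton

theorem exists_zassenhaus_eq_bot [Finite G] (hG : IsProP p G) :
    ∃ i, 1 ≤ i ∧ zassenhaus p G i = ⊥ := by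
  have := hG.compactSpace
  obtain ⟨m, hm⟩ := WellFoundedLT.antitone_chain_condition
    (zassenhaus_antitone (p := p) (G := G))
  refine ⟨m + 1, by omega, zassenhaus_eq_bot_of_le hG (by omega) ?_⟩
  have h1 := hm (m + 1) (by omega)
  have h2 := hm (p * (m + 1)) (by nlinarith [hp.out.two_le])
  exact (h1.symm.trans h2).le

/-- Surjective homomorphisms of compact groups map dimension subgroups onto dimension
subgroups. -/
theorem map_zassenhaus [CompactSpace G] {H : Type v} [Group H] [TopologicalSpace H]
    [IsTopologicalGroup H] [T2Space H] {f : G →* H} (hf : Continuous f)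
    (hs : Function.Surjective f) (i : ℕ) : (zassenhaus p G i).map f = zassenhaus p H i := by
  induction i using Nat.strong_induction_on with
  | _ i ih =>
    by_cases hi : i < 2
    · rw [zassenhaus_of_lt_two hi, zassenhaus_of_lt_two hi, Subgroup.map_top_of_surjective f hs]
    have hi2 : 2 ≤ i := by omega
    have hlt := ceil_div_lt hp.out.two_le hi2
    apply le_antisymm
    · rw [Subgroup.map_le_iff_le_comap]
      have hc : IsClosed ((zassenhaus p H i).comap f : Set G) := (isClosed_zassenhaus i).preimage hf
      refine zassenhaus_le hi2 hc (fun x hx => ?_) ?_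
      · rw [Subgroup.mem_comap, map_pow]
        refine pow_mem_zassenhaus hi2 ?_
        rw [← ih _ hlt]
        exact ⟨x, hx, rfl⟩
      · intro j k hj hk hjk
        rw [← Subgroup.map_le_iff_le_comap, Subgroup.map_commutator, ih j (by omega),
          ih k (by omega)]
        exact hjk ▸ commutator_le_zassenhaus hj hk
    · have hc : IsClosed ((zassenhaus p G i).map f : Set H) :=
        ((isClosed_zassenhaus i).isCompact.image hf).isClosed
      refine zassenhaus_le hi2 hc (fun x hx => ?_) ?_
      · rw [← ih _ hlt] at hx
        obtain ⟨y, hy, rfl⟩ := hx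
        exact ⟨y ^ p, pow_mem_zassenhaus hi2 hy, map_pow _ _ _⟩
      · intro j k hj hk hjk
        rw [← ih j (by omega), ← ih k (by omega), ← Subgroup.map_commutator]
        exact Subgroup.map_mono (hjk ▸ commutator_le_zassenhaus hj hk)

end Zassenhaus

theorem isOpen_zassenhaus_freeProP {p : ℕ} [hp : Fact p.Prime] (n i : ℕ) :
    IsOpen (zassenhaus p (FreeProP p n) i : Set (FreeProP p n)) := by
  induction i with
  | zero => rw [zassenhaus_of_lt_two (by omega)]; exact isOpen_univ
  | succ i ih =>
    rcases Nat.eq_zero_or_pos i with rfl | hi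
    · rw [zassenhaus_of_lt_two (by omega)]; exact isOpen_univ
    · exact Subgroup.isOpen_mono (frattini_zassenhaus_le hi) (FreeProP.isOpen_frattini ih)

/-! ### The topology of `Sch` -/

section QuotientEquiv

variable {p : ℕ} [hp : Fact p.Prime] {G : Type u} {H : Type v} [Group G] [TopologicalSpace G]
  [IsTopologicalGroup G] [SigmaGroup G] [Group H] [TopologicalSpace H] [IsTopologicalGroup H]
  [SigmaGroup H] [CompactSpace G]

theorem SigmaEquiv.quotient_zassenhaus [T2Space H] (e : SigmaEquiv G H) (i : ℕ) :
    Nonempty (SigmaEquiv (G ⧸ zassenhaus p G i) (H ⧸ zassenhaus p H i)) := by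
  obtain ⟨e', -⟩ := exists_sigmaEquiv_of_ker_eq (IsSigmaHom.mk' (zassenhaus p G i))
    ((IsSigmaHom.mk' (zassenhaus p H i)).comp e.isSigmaHom) (QuotientGroup.mk'_surjective _)
    ((QuotientGroup.mk'_surjective _).comp e.toContinuousMulEquiv.surjective) (by
      rw [← MonoidHom.comap_ker, QuotientGroup.ker_mk', QuotientGroup.ker_mk',
        ← map_zassenhaus e.isSigmaHom.continuous e.toContinuousMulEquiv.surjective,
        Subgroup.comap_map_eq_self_of_injective e.toContinuousMulEquiv.injective])
  exact ⟨e'⟩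

theorem nonempty_sigmaEquiv_quotient_of_eq_bot [T2Space G] {i : ℕ} (h : zassenhaus p G i = ⊥) :
    Nonempty (SigmaEquiv G (G ⧸ zassenhaus p G i)) := by
  obtain ⟨e, -⟩ := exists_sigmaEquiv_of_ker_eq (f := MonoidHom.id G) ⟨continuous_id, fun _ => rfl⟩
    (IsSigmaHom.mk' (zassenhaus p G i)) Function.surjective_id (QuotientGroup.mk'_surjective _) (by
      rw [QuotientGroup.ker_mk', h]; exact MonoidHom.ker_eq_bot_iff _ |>.2 Function.injective_id)
  exact ⟨e⟩

end QuotientEquiv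

section Topology

variable {p : ℕ} {n m : ℕ}

theorem mem_relSubgroup (r : Fin n → OddPart (FreeProP p n)) (i : Fin n) :
    (r i).1 ∈ relSubgroup r :=
  Subgroup.le_topologicalClosure _ (Subgroup.subset_normalClosure (Set.mem_range_self i))

theorem isClosed_relSubgroup (r : Fin n → OddPart (FreeProP p n)) :
    IsClosed (relSubgroup r : Set (FreeProP p n)) :=
  Subgroup.isClosed_topologicalClosure _

theorem relSubgroup_le {r : Fin n → OddPart (FreeProP p n)} {L : Subgroup (FreeProP p n)}
    [L.Normal] (hL : IsClosed (L : Set (FreeProP p n))) (h : ∀ i, (r i).1 ∈ L) :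
    relSubgroup r ≤ L := by
  refine Subgroup.topologicalClosure_minimal _ (Subgroup.normalClosure_le_normal ?_) hL
  rintro _ ⟨i, rfl⟩
  exact h i

instance (r : Fin n → OddPart (FreeProP p n)) : T2Space (RelGroup r) := by
  have := isClosed_relSubgroup r
  infer_instance

theorem theta_eq_theta_iff {r : Fin n → OddPart (FreeProP p n)}
    {s : Fin m → OddPart (FreeProP p m)} :
    theta p n r = theta p m s ↔ Nonempty (SigmaEquiv (RelGroup r) (RelGroup s)) :=
  Quotient.eq (r := relSetoid p)

variable [hp : Fact p.Prime]

theorem theta_mem_basicSet_iff {i : ℕ} {r : Fin n → OddPart (FreeProP p n)}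
    {s : Fin m → OddPart (FreeProP p m)} :
    theta p m s ∈ basicSet p i r ↔ Nonempty (SigmaEquiv (RelGroup s ⧸ zassenhaus p (RelGroup s) i)
      (RelGroup r ⧸ zassenhaus p (RelGroup r) i)) := by
  constructor
  · rintro ⟨k, t, hst, ⟨e⟩⟩
    obtain ⟨e'⟩ := theta_eq_theta_iff.1 hst
    obtain ⟨e''⟩ := e'.quotient_zassenhaus (p := p) i
    exact ⟨e''.trans e⟩
  · exact fun h => ⟨m, s, rfl, h⟩

theorem isOpen_basicSet {i : ℕ} (hi : 2 ≤ i) (r : Fin n → OddPart (FreeProP p n)) :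
    IsOpen (basicSet p i r) :=
  TopologicalSpace.isOpen_generateFrom_of_mem ⟨i, n, r, hi, rfl⟩

/-- Modulo dimension subgroups `G_r` depends only on `r` modulo dimension subgroups. -/
theorem nonempty_sigmaEquiv_quotient_zassenhaus {i : ℕ} {r s : Fin n → OddPart (FreeProP p n)}
    (h : ∀ j, (r j).1⁻¹ * (s j).1 ∈ zassenhaus p (FreeProP p n) i) :
    Nonempty (SigmaEquiv (RelGroup s ⧸ zassenhaus p (RelGroup s) i)
      (RelGroup r ⧸ zassenhaus p (RelGroup r) i)) := by
  set D := zassenhaus p (FreeProP p n) i with hD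
  have hDo : IsOpen (D : Set (FreeProP p n)) := isOpen_zassenhaus_freeProP n i
  let π : ∀ t : Fin n → OddPart (FreeProP p n),
      FreeProP p n →* RelGroup t ⧸ zassenhaus p (RelGroup t) i :=
    fun t => (QuotientGroup.mk' _).comp (QuotientGroup.mk' (relSubgroup t))
  have hπ : ∀ t, IsSigmaHom (π t) := fun t => (IsSigmaHom.mk' _).comp (IsSigmaHom.mk' _)
  have hπs : ∀ t, Function.Surjective (π t) := fun t =>
    (QuotientGroup.mk'_surjective _).comp (QuotientGroup.mk'_surjective _)
  have hker : ∀ t, (π t).ker = relSubgroup t ⊔ D := by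
    intro t
    rw [← MonoidHom.comap_ker, QuotientGroup.ker_mk',
      ← map_zassenhaus (QuotientGroup.continuous_mk (N := relSubgroup t))
        (QuotientGroup.mk'_surjective _), QuotientGroup.comap_map_mk']
  have hle : ∀ t t' : Fin n → OddPart (FreeProP p n), (∀ j, (t j).1⁻¹ * (t' j).1 ∈ D) →
      relSubgroup t' ⊔ D ≤ relSubgroup t ⊔ D := by
    intro t t' htt
    have ho : IsOpen ((relSubgroup t ⊔ D : Subgroup _) : Set (FreeProP p n)) :=
      Subgroup.isOpen_mono le_sup_right hDo
    refine sup_le (relSubgroup_le (Subgroup.isClosed_of_isOpen _ ho) fun j => ?_) le_sup_right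
    have := mul_mem (Subgroup.mem_sup_left (T := D) (mem_relSubgroup t j))
      (Subgroup.mem_sup_right (S := relSubgroup t) (htt j))
    rwa [mul_inv_cancel_left] at this
  obtain ⟨e, -⟩ := exists_sigmaEquiv_of_ker_eq (hπ s) (hπ r) (hπs s) (hπs r) (by
    rw [hker, hker]
    refine le_antisymm (hle r s h) (hle s r fun j => ?_)
    have := inv_mem (h j)
    rwa [mul_inv_rev, inv_inv] at this)
  exact ⟨e⟩

theorem continuous_theta (n : ℕ) : Continuous (theta p n) := by
  refine continuous_generateFrom_iff.2 ?_
  rintro _ ⟨i, m, r, -, rfl⟩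
  refine isOpen_iff_mem_nhds.2 fun s hs => ?_
  have hopen : IsOpen {t : Fin n → OddPart (FreeProP p n) |
      ∀ j, (s j).1⁻¹ * (t j).1 ∈ zassenhaus p (FreeProP p n) i} := by
    rw [Set.ofPred_forall]
    refine isOpen_iInter_of_finite fun j => ?_
    exact (isOpen_zassenhaus_freeProP n i).preimage
      (continuous_const.mul (continuous_subtype_val.comp (continuous_apply j)))
  refine Filter.mem_of_superset (hopen.mem_nhds fun j => by simp [one_mem]) fun t ht => ?_
  obtain ⟨e⟩ := nonempty_sigmaEquiv_quotient_zassenhaus ht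
  obtain ⟨e'⟩ := theta_mem_basicSet_iff.1 hs
  exact theta_mem_basicSet_iff.2 ⟨e.trans e'⟩

theorem measurable_theta (n : ℕ) : Measurable (theta p n) :=
  (continuous_theta n).measurable

/-- If `D_i` of the finite group `G_r` is trivial, then `G_r` is determined among all weak Schur
groups by its quotient by `D_{p i}`. -/
theorem basicSet_eq_singleton {r : Fin n → OddPart (FreeProP p n)} {i : ℕ} (hi : 1 ≤ i)
    (h : zassenhaus p (RelGroup r) i = ⊥) : basicSet p (p * i) r = {theta p n r} := by
  have hle : i ≤ p * i := Nat.le_mul_of_pos_left i hp.out.pos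
  have hr : zassenhaus p (RelGroup r) (p * i) = ⊥ := le_bot_iff.1 (h ▸ zassenhaus_antitone hle)
  ext x
  constructor
  · rintro ⟨m, s, rfl, ⟨e⟩⟩
    have hs : zassenhaus p (RelGroup s) i = ⊥ := by
      refine zassenhaus_eq_bot_of_le (isProP_relGroup s) hi ?_
      have h1 : (zassenhaus p (RelGroup r ⧸ zassenhaus p (RelGroup r) (p * i)) i) = ⊥ := by
        rw [← map_zassenhaus (QuotientGroup.continuous_mk (N := zassenhaus p (RelGroup r) (p * i)))
          (QuotientGroup.mk'_surjective _), h, Subgroup.map_bot]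
      rw [← map_zassenhaus e.isSigmaHom.continuous e.toContinuousMulEquiv.surjective,
        ← map_zassenhaus (QuotientGroup.continuous_mk (N := zassenhaus p (RelGroup s) (p * i)))
          (QuotientGroup.mk'_surjective _), Subgroup.map_map, Subgroup.map_eq_bot_iff,
        ← MonoidHom.comap_ker] at h1
      refine h1.trans ?_
      rw [(MonoidHom.ker_eq_bot_iff _).2 e.toContinuousMulEquiv.injective, MonoidHom.comap_bot,
        QuotientGroup.ker_mk']
    have hs' : zassenhaus p (RelGroup s) (p * i) = ⊥ :=
      le_bot_iff.1 (hs ▸ zassenhaus_antitone hle)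
    obtain ⟨e1⟩ := nonempty_sigmaEquiv_quotient_of_eq_bot hs'
    obtain ⟨e2⟩ := nonempty_sigmaEquiv_quotient_of_eq_bot hr
    exact theta_eq_theta_iff.2 ⟨(e1.trans e).trans e2.symm⟩
  · rintro rfl
    exact ⟨n, r, rfl, ⟨SigmaEquiv.refl⟩⟩

theorem isOpen_and_isClosed_singleton_theta (r : Fin n → OddPart (FreeProP p n))
    [Finite (RelGroup r)] : IsOpen {theta p n r} ∧ IsClosed {theta p n r} := by
  obtain ⟨i, hi, h⟩ := exists_zassenhaus_eq_bot (isProP_relGroup r)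
  have hpi : 2 ≤ p * i := le_trans hp.out.two_le (Nat.le_mul_of_pos_right p hi)
  have heq := basicSet_eq_singleton hi h
  refine ⟨heq ▸ isOpen_basicSet hpi r, isOpen_compl_iff.1 (isOpen_iff_mem_nhds.2 fun x hx => ?_)⟩
  obtain ⟨⟨m, s⟩, rfl⟩ := Quotient.exists_rep x
  refine Filter.mem_of_superset ((isOpen_basicSet hpi s).mem_nhds
    ⟨m, s, rfl, ⟨SigmaEquiv.refl⟩⟩) fun y hy hyr => hx ?_
  rw [Set.mem_singleton_iff.1 hyr] at hy
  obtain ⟨e⟩ := theta_mem_basicSet_iff.1 hy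
  rw [← heq]
  exact ⟨m, s, rfl, ⟨e.symm⟩⟩

end Topology

/-! ### Eliminating a generator by a relation -/

/-- A relation subgroup that contains the kernel of a surjection of free pro-`p` groups is the
preimage of another relation subgroup as soon as the relations correspond to each other. -/
theorem relSubgroup_eq_comap {p n m : ℕ} [Fact p.Prime] {π : FreeProP p m →* FreeProP p n}
    (hπ : Continuous π) (hs : Function.Surjective π) {r : Fin m → OddPart (FreeProP p m)}
    {s : Fin n → OddPart (FreeProP p n)} (hker : π.ker ≤ relSubgroup r)
    (hrs : ∀ i, π (r i).1 ∈ relSubgroup s) (hsr : ∀ j, ∃ x ∈ relSubgroup r, π x = (s j).1) :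
    relSubgroup r = (relSubgroup s).comap π := by
  apply le_antisymm
  · have hc : IsClosed ((relSubgroup s).comap π : Set (FreeProP p m)) :=
      (isClosed_relSubgroup s).preimage hπ
    exact relSubgroup_le hc hrs
  · have hn : ((relSubgroup r).map π).Normal := Subgroup.Normal.map inferInstance π hs
    have hc : IsClosed ((relSubgroup r).map π : Set (FreeProP p n)) :=
      ((isClosed_relSubgroup r).isCompact.image hπ).isClosed
    have h1 : relSubgroup s ≤ (relSubgroup r).map π := relSubgroup_le hc hsr
    refine (Subgroup.comap_mono h1).trans ?_
    rw [Subgroup.comap_map_eq]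
    exact sup_le le_rfl hker

theorem nonempty_sigmaEquiv_of_relSubgroup_eq_comap {p n m : ℕ} [Fact p.Prime]
    {π : FreeProP p m →* FreeProP p n} (hπ : IsSigmaHom π) (hs : Function.Surjective π)
    {r : Fin m → OddPart (FreeProP p m)} {s : Fin n → OddPart (FreeProP p n)}
    (h : relSubgroup r = (relSubgroup s).comap π) :
    Nonempty (SigmaEquiv (RelGroup r) (RelGroup s)) := by
  obtain ⟨e, -⟩ := exists_sigmaEquiv_of_ker_eq (IsSigmaHom.mk' (relSubgroup r))
    ((IsSigmaHom.mk' (relSubgroup s)).comp hπ) (QuotientGroup.mk'_surjective _)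
    ((QuotientGroup.mk'_surjective _).comp hs) (by
      rw [← MonoidHom.comap_ker, QuotientGroup.ker_mk', QuotientGroup.ker_mk', h])
  exact ⟨e⟩

instance {G : Type u} [Group G] [TopologicalSpace G] [SigmaGroup G] : One (OddPart G) :=
  ⟨⟨1, by simp⟩⟩

/-- The homomorphism from the cyclic group of order `q` that sends the generator to a given
element `z` with `z ^ q = 1`. -/
def zmodPowHom {V : Type u} [Group V] {q : ℕ} (z : V) (hz : z ^ q = 1) :
    Multiplicative (ZMod q) →* V :=
  AddMonoidHom.toMultiplicativeLeft (ZMod.lift q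
    ⟨zmultiplesHom (Additive V) (Additive.ofMul z), by
      rw [zmultiplesHom_apply, natCast_zsmul, ← ofMul_pow, hz]; rfl⟩)

theorem zmodPowHom_one {V : Type u} [Group V] {q : ℕ} (z : V) (hz : z ^ q = 1) :
    zmodPowHom z hz (Multiplicative.ofAdd 1) = z := by
  have := ZMod.lift_coe q ⟨zmultiplesHom (Additive V) (Additive.ofMul z), by
    rw [zmultiplesHom_apply, natCast_zsmul, ← ofMul_pow, hz]; rfl⟩ 1
  rw [Int.cast_one] at this
  exact this.trans (one_zsmul (Additive.ofMul z))

namespace FreeProP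

variable {p n : ℕ} [hp : Fact p.Prime]

/-- A surjective equivariant endomorphism of `F_n` is a `σ`-automorphism. -/
theorem exists_sigmaEquiv_of_surjective {f : FreeProP p n →* FreeProP p n} (hf : IsSigmaHom f)
    (hs : Function.Surjective f) :
    ∃ e : SigmaEquiv (FreeProP p n) (FreeProP p n), ∀ x, e.toContinuousMulEquiv x = f x := by
  obtain ⟨e, he⟩ := exists_sigmaEquiv_of_ker_eq (f := MonoidHom.id (FreeProP p n))
    ⟨continuous_id, fun _ => rfl⟩ hf Function.surjective_id hs (by
      rw [(MonoidHom.ker_eq_bot_iff f).2 (injective_of_surjective hf.continuous hs)]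
      exact (MonoidHom.ker_eq_bot_iff _).2 Function.injective_id)
  exact ⟨e, he⟩

theorem surjective_of_gen_mem_range {m : ℕ} {f : FreeProP p m →* FreeProP p n} (hf : Continuous f)
    (h : ∀ i, (gen p n i).1 ∈ f.range) : Function.Surjective f := by
  have hc : IsClosed (f.range : Set (FreeProP p n)) := by
    rw [MonoidHom.coe_range]; exact (isCompact_range hf).isClosed
  exact MonoidHom.range_eq_top.1 (eq_top_of_isClosed hc h)

/-- The retraction `F_{n+1} → F_n` that kills the first generator. -/
def dropFirst (p n : ℕ) [Fact p.Prime] : FreeProP p (n + 1) →* FreeProP p n :=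
  toFree (Fin.cons 1 (gen p n))

theorem isSigmaHom_dropFirst : IsSigmaHom (dropFirst p n) := isSigmaHom_toFree _

theorem dropFirst_gen_zero : dropFirst p n (gen p (n + 1) 0).1 = 1 := toFree_gen _ _

theorem dropFirst_gen_succ (i : Fin n) :
    dropFirst p n (gen p (n + 1) i.succ).1 = (gen p n i).1 := toFree_gen _ _

theorem dropFirst_surjective : Function.Surjective (dropFirst p n) :=
  surjective_of_gen_mem_range isSigmaHom_dropFirst.continuous
    fun i => ⟨_, dropFirst_gen_succ i⟩

theorem ker_dropFirst_le {L : Subgroup (FreeProP p (n + 1))} [L.Normal]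
    (hL : IsClosed (L : Set (FreeProP p (n + 1)))) (h : (gen p (n + 1) 0).1 ∈ L) :
    (dropFirst p n).ker ≤ L := by
  let ι : FreeProP p n →* FreeProP p (n + 1) := toFree fun i => gen p (n + 1) i.succ
  have hι : Continuous ι := (isSigmaHom_toFree _).continuous
  have key : QuotientGroup.mk' L = ((QuotientGroup.mk' L).comp ι).comp (dropFirst p n) := by
    refine hom_ext QuotientGroup.continuous_mk
      ((QuotientGroup.continuous_mk.comp hι).comp isSigmaHom_dropFirst.continuous) fun i => ?_
    refine Fin.cases ?_ (fun i => ?_) i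
    · rw [MonoidHom.comp_apply, dropFirst_gen_zero, map_one]
      exact (QuotientGroup.eq_one_iff _).2 h
    · rw [MonoidHom.comp_apply, dropFirst_gen_succ, MonoidHom.comp_apply, toFree_gen]
  intro x hx
  rw [← QuotientGroup.ker_mk' L, MonoidHom.mem_ker, key, MonoidHom.comp_apply,
    MonoidHom.mem_ker.1 hx, map_one]

/-! ### The abelian quotients of free pro-`p` groups -/

theorem isPGroup_pi_zmod (p n k : ℕ) [Fact p.Prime] :
    IsPGroup p (Fin n → Multiplicative (ZMod (p ^ k))) := by
  refine IsPGroup.of_card (n := k * n) ?_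
  rw [Nat.card_fun, Nat.card_congr Multiplicative.toAdd, Nat.card_zmod, Nat.card_fin, pow_mul]

instance (k : ℕ) : Finite (Multiplicative (ZMod (p ^ k))) :=
  have : NeZero (p ^ k) := ⟨pow_ne_zero k hp.out.ne_zero⟩
  inferInstanceAs (Finite (ZMod (p ^ k)))

/-- The homomorphism from `F_n` onto `(ℤ/p^k)^n`. -/
def toZMod (p n k : ℕ) [Fact p.Prime] :
    FreeProP p n →* (Fin n → Multiplicative (ZMod (p ^ k))) :=
  toFinite (isPGroup_pi_zmod p n k) fun i => Pi.mulSingle i (Multiplicative.ofAdd 1)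

theorem toZMod_gen (k : ℕ) (i : Fin n) :
    toZMod p n k (gen p n i).1 = Pi.mulSingle i (Multiplicative.ofAdd 1) := toFinite_gen _ _ _

theorem toZMod_surjective (k : ℕ) : Function.Surjective (toZMod p n k) := by
  have : NeZero (p ^ k) := ⟨pow_ne_zero k hp.out.ne_zero⟩
  intro v
  rw [← MonoidHom.mem_range, ← Finset.univ_prod_mulSingle v]
  refine Subgroup.prod_mem _ fun i _ => ?_
  have h : Pi.mulSingle i (v i) = toZMod p n k ((gen p n i).1 ^ (v i).toAdd.val) := by
    rw [map_pow, toZMod_gen, ← Pi.mulSingle_pow, ← ofAdd_nsmul, nsmul_one, ZMod.natCast_zmod_val,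
      ofAdd_toAdd]
  rw [h]
  exact ⟨_, rfl⟩

local instance (k : ℕ) : TopologicalSpace (Multiplicative (ZMod (p ^ k))) := ⊥

local instance (k : ℕ) : DiscreteTopology (Multiplicative (ZMod (p ^ k))) := ⟨rfl⟩

theorem continuous_toZMod (k : ℕ) : Continuous (toZMod p n k) := continuous_toFinite _ _

theorem isOpen_ker_toZMod (k : ℕ) : IsOpen ((toZMod p n k).ker : Set (FreeProP p n)) :=
  (isOpen_discrete {(1 : Fin n → Multiplicative (ZMod (p ^ k)))}).preimage (continuous_toZMod k)

theorem toZMod_sigma (k : ℕ) (x : FreeProP p n) :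
    toZMod p n k (sigma x) = (toZMod p n k x)⁻¹ := by
  refine DFunLike.congr_fun (f := (toZMod p n k).comp sigma) (g := (toZMod p n k)⁻¹) ?_ x
  refine hom_ext ((continuous_toZMod k).comp continuous_sigma)
    (show Continuous fun x => (toZMod p n k x)⁻¹ from
      (continuous_of_discreteTopology (f := fun v : Fin n → Multiplicative (ZMod (p ^ k)) =>
        v⁻¹)).comp (continuous_toZMod k)) fun i => ?_
  rw [MonoidHom.comp_apply, (gen p n i).2, map_inv, MonoidHom.inv_apply]

/-- If `y` is nonzero in the `j`-th coordinate of the Frattini quotient of `F_{n+1}`, then `y`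
together with the generators different from `x_j` generates `F_{n+1}`. -/
theorem surjective_toFree_cons {y : OddPart (FreeProP p (n + 1))} {j : Fin (n + 1)}
    (hy : toZMod p (n + 1) 1 y.1 j ≠ 1) :
    Function.Surjective (toFree (Fin.cons y fun i => gen p (n + 1) (j.succAbove i))) := by
  set α := toFree (Fin.cons y fun i => gen p (n + 1) (j.succAbove i)) with hα
  have hαc : Continuous α := (isSigmaHom_toFree _).continuous
  have hc : IsClosed (α.range : Set (FreeProP p (n + 1))) := by
    rw [MonoidHom.coe_range]; exact (isCompact_range hαc).isClosed
  rw [← MonoidHom.range_eq_top]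
  by_contra hne
  obtain ⟨M, hM, hMo, hidx, hle⟩ := ProPCompletion.isProP.exists_normal_index_eq hc hne
  have hyM : y.1 ∈ M := hle ⟨(gen p (n + 1) 0).1, toFree_gen _ _⟩
  have hgM : ∀ i, i ≠ j → (gen p (n + 1) i).1 ∈ M := by
    intro i hi
    obtain ⟨i, rfl⟩ := Fin.exists_succAbove_eq hi
    exact hle ⟨(gen p (n + 1) i.succ).1, toFree_gen _ _⟩
  have := QuotientGroup.discreteTopology hMo
  have hcard : Nat.card (FreeProP p (n + 1) ⧸ M) = p := hidx
  set z : FreeProP p (n + 1) ⧸ M := QuotientGroup.mk' M (gen p (n + 1) j).1 with hz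
  have hzp : z ^ p ^ 1 = 1 := 
    (congrArg (z ^ ·) ((pow_one p).trans hcard.symm)).trans pow_card_eq_one'
  -- the homomorphism `ℤ/p → F/M` that sends `1` to the class of `x_j`
  let ζ : Multiplicative (ZMod (p ^ 1)) →* FreeProP p (n + 1) ⧸ M := zmodPowHom z hzp
  have hζ1 : ζ (Multiplicative.ofAdd 1) = z := zmodPowHom_one z hzp
  let φ : FreeProP p (n + 1) →* FreeProP p (n + 1) ⧸ M :=
    (ζ.comp (Pi.evalMonoidHom (fun _ => Multiplicative (ZMod (p ^ 1))) j)).comp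
      (toZMod p (n + 1) 1)
  have hφ : QuotientGroup.mk' M = φ := by
    refine hom_ext QuotientGroup.continuous_mk
      ((continuous_of_discreteTopology (f := fun v : Fin (n + 1) → Multiplicative (ZMod (p ^ 1)) =>
        ζ (v j))).comp (continuous_toZMod 1)) fun i => ?_
    change _ = ζ (toZMod p (n + 1) 1 (gen p (n + 1) i).1 j)
    rw [toZMod_gen]
    by_cases hij : i = j
    · subst hij
      rw [Pi.mulSingle_eq_same, hζ1]
    · rw [Pi.mulSingle_eq_of_ne (Ne.symm hij), map_one]
      exact (QuotientGroup.eq_one_iff _).2 (hgM i hij)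
  -- `ζ` is injective on the cyclic group of prime order unless it is trivial
  have hζy : ζ (toZMod p (n + 1) 1 y.1 j) = 1 := by
    rw [show ζ (toZMod p (n + 1) 1 y.1 j) = φ y.1 from rfl, ← hφ]
    exact (QuotientGroup.eq_one_iff _).2 hyM
  have hkt : ζ.ker = ⊤ := by
    have hpr : (Nat.card (Multiplicative (ZMod (p ^ 1)))).Prime := by
      rw [Nat.card_congr Multiplicative.toAdd, Nat.card_zmod, pow_one]
      exact hp.out
    have : Fact (Nat.card (Multiplicative (ZMod (p ^ 1)))).Prime := ⟨hpr⟩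
    rcases ζ.ker.eq_bot_or_eq_top_of_prime_card with h | h
    · exact absurd ((Subgroup.mem_bot.1 (h ▸ MonoidHom.mem_ker.2 hζy))) hy
    · exact h
  have hz1 : (gen p (n + 1) j).1 ∈ M := by
    rw [← QuotientGroup.eq_one_iff]
    change z = 1
    rw [← hζ1]
    exact MonoidHom.mem_ker.1 (hkt ▸ Subgroup.mem_top _)
  have hMt : M = ⊤ := eq_top_of_isClosed (M.isClosed_of_isOpen hMo) fun i => by
    by_cases hij : i = j
    · exact hij ▸ hz1
    · exact hgM i hij
  rw [hMt, Subgroup.index_top] at hidx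
  exact hp.out.one_lt.ne hidx

/-- An odd element outside the Frattini subgroup of `F_{n+1}` can be taken for one of the free
generators, so that it can be eliminated. -/
theorem exists_eliminate {y : OddPart (FreeProP p (n + 1))} (hy : toZMod p (n + 1) 1 y.1 ≠ 1) :
    ∃ π : FreeProP p (n + 1) →* FreeProP p n, IsSigmaHom π ∧ Function.Surjective π ∧ π y.1 = 1 ∧
      ∀ L : Subgroup (FreeProP p (n + 1)), L.Normal → IsClosed (L : Set (FreeProP p (n + 1))) →
        y.1 ∈ L → π.ker ≤ L := by
  obtain ⟨j, hj⟩ := Function.ne_iff.1 hy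
  obtain ⟨e, he⟩ := exists_sigmaEquiv_of_surjective (isSigmaHom_toFree _)
    (surjective_toFree_cons hj)
  have he0 : e.toContinuousMulEquiv (gen p (n + 1) 0).1 = y.1 := (he _).trans (toFree_gen _ _)
  refine ⟨(dropFirst p n).comp (e.symm.toContinuousMulEquiv : _ →* _),
    isSigmaHom_dropFirst.comp e.symm.isSigmaHom,
    dropFirst_surjective.comp e.symm.toContinuousMulEquiv.surjective, ?_, ?_⟩
  · rw [← he0]
    change dropFirst p n (e.toContinuousMulEquiv.symm (e.toContinuousMulEquiv _)) = 1
    rw [ContinuousMulEquiv.symm_apply_apply, dropFirst_gen_zero]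
  · intro L hL hLc hyL x hx
    have hc : IsClosed
        (L.comap (e.toContinuousMulEquiv : FreeProP p (n + 1) →* FreeProP p (n + 1)) :
          Set (FreeProP p (n + 1))) :=
      hLc.preimage e.isSigmaHom.continuous
    have h1 := ker_dropFirst_le hc (show e.toContinuousMulEquiv _ ∈ L from he0 ▸ hyL)
      (show e.toContinuousMulEquiv.symm x ∈ (dropFirst p n).ker from hx)
    change e.toContinuousMulEquiv (e.toContinuousMulEquiv.symm x) ∈ L at h1
    rwa [ContinuousMulEquiv.apply_symm_apply] at h1

end FreeProP

/-- A relation that is also a free generator may be eliminated. -/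
theorem theta_cons_eq {p n : ℕ} [hp : Fact p.Prime] {y : OddPart (FreeProP p (n + 1))}
    {π : FreeProP p (n + 1) →* FreeProP p n} (hπ : IsSigmaHom π) (hs : Function.Surjective π)
    (hy : π y.1 = 1) (hL : ∀ L : Subgroup (FreeProP p (n + 1)), L.Normal →
      IsClosed (L : Set (FreeProP p (n + 1))) → y.1 ∈ L → π.ker ≤ L)
    (r : Fin n → OddPart (FreeProP p (n + 1))) :
    theta p (n + 1) (Fin.cons y r) = theta p n (fun i => hπ.odd (r i)) := by
  refine theta_eq_theta_iff.2 (nonempty_sigmaEquiv_of_relSubgroup_eq_comap hπ hs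
    (relSubgroup_eq_comap hπ.continuous hs ?_ ?_ fun j => ?_))
  · exact hL _ inferInstance (isClosed_relSubgroup _) (mem_relSubgroup (Fin.cons y r) 0)
  · refine Fin.cases ?_ fun i => ?_
    · rw [Fin.cons_zero, hy]; exact one_mem _
    · exact mem_relSubgroup (fun i => hπ.odd (r i)) i
  · exact ⟨(r j).1, mem_relSubgroup (Fin.cons y r) j.succ, rfl⟩

/-! ### Existence of the limit measure -/

/-- If `w n • μ n ≤ μ (n + 1)` for probability measures `μ n` and the product of the factors `w n`
converges to a nonzero number, then the measures `μ n`, divided by the partial products,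
increase; so they converge setwise. -/
theorem exists_setwise_limit {X : Type u} [MeasurableSpace X] (μ : ℕ → Measure X)
    [∀ n, IsProbabilityMeasure (μ n)] {w : ℕ → ℝ≥0∞} (hw : ∀ n, w n ≠ ∞)
    (h : ∀ n, w n • μ n ≤ μ (n + 1)) {C : ℝ≥0∞} (hC0 : C ≠ 0) (hC : C ≠ ∞)
    (hP0 : ∀ n, ∏ i ∈ Finset.range n, w i ≠ 0)
    (hP : Tendsto (fun n => ∏ i ∈ Finset.range n, w i) atTop (𝓝 C)) :
    ∃ ν : Measure X, IsProbabilityMeasure ν ∧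
      ∀ A, MeasurableSet A → Tendsto (fun n => μ n A) atTop (𝓝 (ν A)) := by
  set P : ℕ → ℝ≥0∞ := fun n => ∏ i ∈ Finset.range n, w i
  have hPtop : ∀ n, P n ≠ ∞ := fun n => ENNReal.prod_ne_top fun i _ => hw i
  let l : ℕ → Measure X := fun n => (P n)⁻¹ • μ n
  have hfin : ∀ n, IsFiniteMeasure (l n) := fun n =>
    Measure.smul_finite _ (ENNReal.inv_ne_top.2 (hP0 n))
  have hl : ∀ n, l n ≤ l (n + 1) := by
    intro n
    have hwn : w n ≠ 0 := fun h0 => hP0 (n + 1) (by rw [Finset.prod_range_succ, h0, mul_zero])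
    have h1 : (P n)⁻¹ = (P (n + 1))⁻¹ * w n := by
      rw [show P (n + 1) = P n * w n from Finset.prod_range_succ _ _,
        ENNReal.mul_inv (Or.inl (hP0 n)) (Or.inl (hPtop n)), mul_assoc,
        ENNReal.inv_mul_cancel hwn (hw n), mul_one]
    intro A
    change (P n)⁻¹ * μ n A ≤ (P (n + 1))⁻¹ * μ (n + 1) A
    rw [h1, mul_assoc]
    exact mul_le_mul_right (h n A) _
  -- the increments of the increasing sequence `l`
  let κ : ℕ → Measure X := fun n => Nat.rec (l 0) (fun k _ => l (k + 1) - l k) n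
  have hκ : ∀ n A, ∑ i ∈ Finset.range (n + 1), κ i A = l n A := by
    intro n A
    induction n with
    | zero => simp [κ]
    | succ n ih =>
      rw [Finset.sum_range_succ, ih]
      change l n A + (l (n + 1) - l n) A = l (n + 1) A
      rw [add_comm, ← Measure.add_apply, Measure.sub_add_cancel_of_le (hl n)]
  have hlim : ∀ A, MeasurableSet A →
      Tendsto (fun n => μ n A) atTop (𝓝 ((C • Measure.sum κ) A)) := by
    intro A hA
    rw [Measure.smul_apply, Measure.sum_apply _ hA, smul_eq_mul]
    have h1 := (ENNReal.tendsto_nat_tsum fun i => κ i A).comp (tendsto_add_atTop_nat 1)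
    refine (ENNReal.Tendsto.mul hP (Or.inl hC0) h1 (Or.inr hC)).congr fun n => ?_
    change P n * ∑ i ∈ Finset.range (n + 1), κ i A = μ n A
    rw [hκ]
    change P n * ((P n)⁻¹ * μ n A) = μ n A
    rw [← mul_assoc, ENNReal.mul_inv_cancel (hP0 n) (hPtop n), one_mul]
  refine ⟨C • Measure.sum κ, ⟨?_⟩, hlim⟩
  refine tendsto_nhds_unique (hlim _ MeasurableSet.univ) ?_
  simp

section Constant

variable {p : ℕ} [hp : Fact p.Prime]

/-- The partial products of `C_∞` as extended nonnegative real numbers. -/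
noncomputable def cPart (p n : ℕ) : ℝ≥0∞ :=
  ∏ i ∈ Finset.range n, ENNReal.ofReal (1 - ((p : ℝ) ^ (i + 1))⁻¹)

theorem one_sub_inv_pow_nonneg (i : ℕ) : 0 ≤ 1 - ((p : ℝ) ^ i)⁻¹ := by
  have h1 : (1 : ℝ) ≤ p := by exact_mod_cast hp.out.one_lt.le
  exact sub_nonneg.2 (inv_le_one_of_one_le₀ (one_le_pow₀ h1))

theorem cPart_eq_ofReal (n : ℕ) :
    cPart p n = ENNReal.ofReal (∏ i ∈ Finset.range n, (1 - ((p : ℝ) ^ (i + 1))⁻¹)) :=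
  (ENNReal.ofReal_prod_of_nonneg fun i _ => one_sub_inv_pow_nonneg (i + 1)).symm

theorem tendsto_prod_cInf :
    Tendsto (fun n => ∏ i ∈ Finset.range n, (1 - ((p : ℝ) ^ (i + 1))⁻¹)) atTop (𝓝 (cInf p)) :=
  (multipliable_cInf p).hasProd.tendsto_prod_nat

theorem tendsto_cPart : Tendsto (cPart p) atTop (𝓝 (ENNReal.ofReal (cInf p))) := by
  refine ((ENNReal.continuous_ofReal.tendsto _).comp tendsto_prod_cInf).congr fun n => ?_
  exact (cPart_eq_ofReal n).symm

/-- An explicit positive lower bound, whose second summand makes the induction work. -/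
theorem half_le_prod (hp2 : p ≠ 2) (n : ℕ) :
    (1 + ((p : ℝ) ^ n)⁻¹) / 2 ≤ ∏ i ∈ Finset.range n, (1 - ((p : ℝ) ^ (i + 1))⁻¹) := by
  have h3 : (3 : ℝ) ≤ p := by
    exact_mod_cast (lt_of_le_of_ne hp.out.two_le (Ne.symm hp2) : 2 < p)
  induction n with
  | zero => simp
  | succ n ih =>
    rw [Finset.prod_range_succ]
    refine le_trans ?_ (mul_le_mul_of_nonneg_right ih (one_sub_inv_pow_nonneg (n + 1)))
    have hx0 : 0 ≤ ((p : ℝ) ^ n)⁻¹ := by positivity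
    have hx1 : ((p : ℝ) ^ n)⁻¹ ≤ 1 := inv_le_one_of_one_le₀ (one_le_pow₀ (by linarith))
    have hq0 : 0 ≤ (p : ℝ)⁻¹ := by positivity
    have hq1 : (p : ℝ)⁻¹ ≤ 1 / 3 := by
      rw [one_div]; exact inv_anti₀ (by norm_num) h3
    rw [pow_succ, mul_inv]
    set x := ((p : ℝ) ^ n)⁻¹
    set q := (p : ℝ)⁻¹
    have h4 : 0 ≤ 1 - 2 * q - x * q := by nlinarith
    nlinarith [mul_nonneg hx0 h4]

theorem cPart_ne_zero (hp2 : p ≠ 2) (n : ℕ) : cPart p n ≠ 0 := by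
  rw [cPart_eq_ofReal, Ne, ENNReal.ofReal_eq_zero, not_le]
  refine lt_of_lt_of_le ?_ (half_le_prod hp2 n)
  positivity

theorem cInf_pos (hp2 : p ≠ 2) : 0 < cInf p := by
  refine lt_of_lt_of_le (show (0 : ℝ) < 1 / 2 by norm_num)
    (ge_of_tendsto tendsto_prod_cInf (Eventually.of_forall fun n => ?_))
  refine le_trans ?_ (half_le_prod hp2 n)
  have : 0 ≤ ((p : ℝ) ^ n)⁻¹ := by positivity
  linarith

end Constant

/-- Surjective equivariant homomorphisms preserve the Haar measure on odd parts. -/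
theorem measurePreserving_odd {G : Type u} {H : Type v} [Group G] [TopologicalSpace G]
    [IsTopologicalGroup G] [CompactSpace G] [MeasurableSpace G] [BorelSpace G] [SigmaGroup G]
    [Group H] [TopologicalSpace H] [IsTopologicalGroup H] [CompactSpace H] [MeasurableSpace H]
    [BorelSpace H] [SigmaGroup H] {f : G →* H} (hf : IsSigmaHom f)
    (hs : Function.Surjective f) : MeasurePreserving hf.odd (haarOdd G) (haarOdd H) := by
  refine ⟨hf.continuous_odd.measurable, ?_⟩
  have h1 : (haarProb G).IsHaarMeasure :=
    inferInstanceAs (Measure.haarMeasure ⊤ : Measure G).IsHaarMeasure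
  have h2 : (haarProb H).IsHaarMeasure :=
    inferInstanceAs (Measure.haarMeasure ⊤ : Measure H).IsHaarMeasure
  have h3 : ((haarProb G).map f).IsHaarMeasure :=
    Measure.isHaarMeasure_map_of_isFiniteMeasure _ f hf.continuous hs
  have h4 : IsProbabilityMeasure ((haarProb G).map f) :=
    Measure.isProbabilityMeasure_map hf.continuous.measurable.aemeasurable
  have h5 : (haarProb G).map f = haarProb H := Measure.isHaarMeasure_eq_of_isProbabilityMeasure _ _
  rw [haarOdd, haarOdd, Measure.map_map hf.continuous_odd.measurable continuous_toOdd.measurable,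
    ← h5, Measure.map_map continuous_toOdd.measurable hf.continuous.measurable]
  congr 1
  exact funext hf.odd_toOdd

section Recursion

variable {p : ℕ} [hp : Fact p.Prime]

theorem haarOdd_toZMod_ne_one (hp2 : p ≠ 2) (n : ℕ) :
    haarOdd (FreeProP p n) {y | FreeProP.toZMod p n 1 y.1 ≠ 1} =
      ENNReal.ofReal (1 - ((p : ℝ) ^ n)⁻¹) := by
  set N := (FreeProP.toZMod p n 1).ker with hN
  have hNo : IsOpen (N : Set (FreeProP p n)) := FreeProP.isOpen_ker_toZMod 1
  have hinv : SigmaInvariant N := ⟨fun x hx => by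
    rw [Subgroup.mem_comap, MonoidHom.mem_ker, FreeProP.toZMod_sigma, MonoidHom.mem_ker.1 hx,
      inv_one]⟩
  have hodd : ∀ q : FreeProP p n ⧸ N, sigma q = q⁻¹ := by
    intro q
    obtain ⟨x, rfl⟩ := QuotientGroup.mk'_surjective N q
    rw [← (IsSigmaHom.mk' N).map_sigma, ← map_inv]
    refine (QuotientGroup.eq (s := N)).2 ?_
    rw [MonoidHom.mem_ker, map_mul, map_inv, FreeProP.toZMod_sigma, map_inv, inv_inv,
      mul_inv_cancel]
  have hcard : Nat.card (OddPart (FreeProP p n ⧸ N)) = p ^ n := by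
    rw [Nat.card_congr (Equiv.subtypeUnivEquiv hodd),
      Nat.card_congr (QuotientGroup.quotientKerEquivOfSurjective _
        (FreeProP.toZMod_surjective 1)).toEquiv, Nat.card_fun,
      Nat.card_congr Multiplicative.toAdd, Nat.card_zmod, Nat.card_fin, pow_one]
  have hmeas : MeasurableSet {y : OddPart (FreeProP p n) | FreeProP.toZMod p n 1 y.1 = 1} :=
    (hNo.preimage continuous_subtype_val).measurableSet
  have h1 : haarOdd (FreeProP p n) {y | FreeProP.toZMod p n 1 y.1 = 1} = ((p : ℝ≥0∞) ^ n)⁻¹ := by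
    have := haarOdd_fiber p hp2 (FreeProP p n) ProPCompletion.isProP N hNo 1
    rw [hcard, Nat.cast_pow] at this
    rw [← this]
    congr 1
    ext y
    exact (QuotientGroup.eq_one_iff (N := N) y.1).symm
  have h2 := prob_compl_eq_one_sub (μ := haarOdd (FreeProP p n)) hmeas
  rw [h1] at h2
  refine h2.trans ?_
  have hp0 : (0 : ℝ) < (p : ℝ) ^ n := by have := hp.out.pos; positivity
  rw [ENNReal.ofReal_sub _ (inv_nonneg.2 hp0.le), ENNReal.ofReal_one,
    ENNReal.ofReal_inv_of_pos hp0, ENNReal.ofReal_pow (by positivity), ENNReal.ofReal_natCast]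

instance (n : ℕ) : IsProbabilityMeasure (schMeasure p n) :=
  Measure.isProbabilityMeasure_map (measurable_theta n).aemeasurable

/-- With probability `1 - p⁻⁽ⁿ⁺¹⁾` the first of `n + 1` random relations in `F_{n+1}` is part of
a system of free generators; and then eliminating it yields `n` random relations in `F_n`. -/
theorem smul_schMeasure_le (hp2 : p ≠ 2) (n : ℕ) :
    ENNReal.ofReal (1 - ((p : ℝ) ^ (n + 1))⁻¹) • schMeasure p n ≤ schMeasure p (n + 1) := by
  refine Measure.le_iff.2 fun A hA => ?_
  set Y : Set (OddPart (FreeProP p (n + 1))) := {y | FreeProP.toZMod p (n + 1) 1 y.1 ≠ 1} with hY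
  have hYm : MeasurableSet Y :=
    ((FreeProP.isOpen_ker_toZMod 1).preimage continuous_subtype_val).measurableSet.compl
  have hAm : MeasurableSet (theta p (n + 1) ⁻¹' A) := measurable_theta (n + 1) hA
  let e := MeasurableEquiv.piFinSuccAbove (fun _ : Fin (n + 1) => OddPart (FreeProP p (n + 1))) 0
  have hpres : MeasurePreserving e (Measure.pi fun _ => haarOdd (FreeProP p (n + 1)))
      ((haarOdd (FreeProP p (n + 1))).prod
        (Measure.pi fun _ : Fin n => haarOdd (FreeProP p (n + 1)))) :=
    measurePreserving_piFinSuccAbove (fun _ => haarOdd (FreeProP p (n + 1))) 0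
  have hslice : ∀ y ∈ Y, (Measure.pi fun _ : Fin n => haarOdd (FreeProP p (n + 1)))
      (Prod.mk y ⁻¹' (e.symm ⁻¹' (theta p (n + 1) ⁻¹' A))) = schMeasure p n A := by
    intro y hy
    obtain ⟨π, hπ, hs, hy1, hL⟩ := FreeProP.exists_eliminate hy
    have hpi := measurePreserving_pi (fun _ : Fin n => haarOdd (FreeProP p (n + 1)))
      (fun _ : Fin n => haarOdd (FreeProP p n)) (f := fun _ => hπ.odd)
      (fun _ => measurePreserving_odd hπ hs)
    rw [schMeasure, Measure.map_apply (measurable_theta n) hA,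
      ← hpi.measure_preimage (measurable_theta n hA).nullMeasurableSet]
    congr 1
    ext r
    have hr : e.symm (y, r) = Fin.cons y r := Fin.insertNth_zero' y r
    change theta p (n + 1) (e.symm (y, r)) ∈ A ↔ theta p n (fun i => hπ.odd (r i)) ∈ A
    rw [hr, theta_cons_eq hπ hs hy1 hL]
  have hsucc : schMeasure p (n + 1) A =
      (Measure.pi fun _ => haarOdd (FreeProP p (n + 1))) (theta p (n + 1) ⁻¹' A) :=
    Measure.map_apply (measurable_theta (n + 1)) hA
  rw [Measure.smul_apply, smul_eq_mul, ← haarOdd_toZMod_ne_one hp2 (n + 1), hsucc,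
    ← hpres.symm.measure_preimage hAm.nullMeasurableSet,
    Measure.prod_apply (e.symm.measurable hAm)]
  calc haarOdd (FreeProP p (n + 1)) Y * schMeasure p n A
      = ∫⁻ _ in Y, schMeasure p n A ∂haarOdd (FreeProP p (n + 1)) := by
        rw [setLIntegral_const, mul_comm]
    _ = ∫⁻ y in Y, (Measure.pi fun _ : Fin n => haarOdd (FreeProP p (n + 1)))
          (Prod.mk y ⁻¹' (e.symm ⁻¹' (theta p (n + 1) ⁻¹' A))) ∂haarOdd (FreeProP p (n + 1)) :=
        (setLIntegral_congr_fun hYm hslice).symm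
    _ ≤ _ := setLIntegral_le_lintegral _ _

theorem exists_isLimitMeasure (hp2 : p ≠ 2) : ∃ μ : Measure (Sch p), IsLimitMeasure p μ := by
  obtain ⟨μ, h1, h2⟩ := exists_setwise_limit (schMeasure p)
    (w := fun i => ENNReal.ofReal (1 - ((p : ℝ) ^ (i + 1))⁻¹)) (fun _ => ENNReal.ofReal_ne_top)
    (smul_schMeasure_le hp2) (ENNReal.ofReal_pos.2 (cInf_pos hp2)).ne' ENNReal.ofReal_ne_top
    (cPart_ne_zero hp2) tendsto_cPart
  exact ⟨μ, h1, h2⟩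

end Recursion

/-! ### Generating tuples of elementary abelian groups -/

section ElementaryAbelian

variable {p : ℕ} [hp : Fact p.Prime]

/-- The rank `d` of a finite elementary abelian `p`-group, with the number of its generating
`d`-tuples. The group is allowed to be a subgroup of a noncommutative group, so that its
commutativity is a hypothesis. -/
theorem exists_rank_of_elementaryAbelian {V : Type u} [Group V] [Finite V]
    (hcomm : ∀ a b : V, a * b = b * a) (hexp : ∀ a : V, a ^ p = 1) :
    ∃ d : ℕ, Nat.card V = p ^ d ∧ (∃ s : Fin d → V, Subgroup.closure (Set.range s) = ⊤) ∧
      (∀ (k : ℕ) (s : Fin k → V), Subgroup.closure (Set.range s) = ⊤ → d ≤ k) ∧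
      Nat.card {t : Fin d → V // Subgroup.closure (Set.range t) = ⊤} =
        ∏ i : Fin d, (p ^ d - p ^ i.val) := by
  let _ : CommGroup V := { (inferInstance : Group V) with mul_comm := hcomm }
  let _ : Module (ZMod p) (Additive V) := AddCommGroup.zmodModule (n := p) hexp
  have key : ∀ (k : ℕ) (s : Fin k → V), Subgroup.closure (Set.range s) = ⊤ ↔
      Submodule.span (ZMod p) (Set.range (Additive.ofMul ∘ s)) = ⊤ := by
    intro k s
    constructor
    · intro h
      let S : Submodule (ZMod p) (Additive V) :=
        Submodule.span (ZMod p) (Set.range (Additive.ofMul ∘ s))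
      let C : Subgroup V := AddSubgroup.toSubgroup' S.toAddSubgroup
      have hC : Subgroup.closure (Set.range s) ≤ C := by
        rw [Subgroup.closure_le]
        rintro _ ⟨i, rfl⟩
        have hi : (Additive.ofMul ∘ s) i ∈ S := Submodule.subset_span (Set.mem_range_self i)
        exact hi
      rw [eq_top_iff]
      intro x _
      exact hC (h ▸ Subgroup.mem_top (Additive.toMul x))
    · intro h
      let S : AddSubgroup (Additive V) :=
        Subgroup.toAddSubgroup (Subgroup.closure (Set.range s))
      let C : Submodule (ZMod p) (Additive V) := AddSubgroup.toZModSubmodule p S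
      have hC : Submodule.span (ZMod p) (Set.range (Additive.ofMul ∘ s)) ≤ C := by
        rw [Submodule.span_le]
        rintro _ ⟨i, rfl⟩
        have hi : s i ∈ Subgroup.closure (Set.range s) :=
          Subgroup.subset_closure (Set.mem_range_self i)
        exact hi
      rw [eq_top_iff]
      intro x _
      exact hC (h ▸ Submodule.mem_top (x := Additive.ofMul x))
  have : Finite (Additive V) := inferInstanceAs (Finite V)
  refine ⟨Module.finrank (ZMod p) (Additive V), ?_, ?_, ?_, ?_⟩
  · have := Module.natCard_eq_pow_finrank (K := ZMod p) (V := Additive V)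
    rwa [Nat.card_zmod] at this
  · let b := Module.finBasis (ZMod p) (Additive V)
    exact ⟨Additive.toMul ∘ b, (key _ _).2 b.span_eq⟩
  · intro k s hs
    have := finrank_le_of_span_eq_top ((key k s).1 hs)
    rwa [Fintype.card_fin] at this
  · have h1 := card_linearIndependent (K := ZMod p) (V := Additive V) le_rfl
    rw [ZMod.card] at h1
    rw [← h1]
    refine Nat.card_congr (Equiv.subtypeEquivRight fun s => ?_)
    rw [key]
    constructor
    · intro h
      exact linearIndependent_of_top_le_span_of_card_eq_finrank h.ge (Fintype.card_fin _)
    · intro h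
      exact h.span_eq_top_of_card_eq_finrank' (Fintype.card_fin _)

theorem prod_sub_eq_cPart (n : ℕ) :
    ((∏ i : Fin n, (p ^ n - p ^ i.val) : ℕ) : ℝ≥0∞) = ((p : ℝ≥0∞) ^ n) ^ n * cPart p n := by
  have hp0 : (0 : ℝ) < p := by exact_mod_cast hp.out.pos
  have h : ((∏ i : Fin n, (p ^ n - p ^ i.val) : ℕ) : ℝ) =
      ((p : ℝ) ^ n) ^ n * ∏ i ∈ Finset.range n, (1 - ((p : ℝ) ^ (i + 1))⁻¹) := by
    rw [Fin.prod_univ_eq_prod_range (fun i => p ^ n - p ^ i), Nat.cast_prod,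
      ← Finset.prod_range_reflect]
    conv_rhs => rw [← Finset.card_range n, ← Finset.prod_const, Finset.card_range,
      ← Finset.prod_mul_distrib]
    refine Finset.prod_congr rfl fun i hi => ?_
    have hi' := Finset.mem_range.1 hi
    rw [Nat.cast_sub (Nat.pow_le_pow_right hp.out.pos (by omega)), Nat.cast_pow, Nat.cast_pow,
      mul_sub, mul_one]
    congr 1
    rw [eq_mul_inv_iff_mul_eq₀ (pow_pos hp0 _).ne', ← pow_add]
    congr 1
    omega
  rw [← ENNReal.ofReal_natCast, h, ENNReal.ofReal_mul (by positivity), cPart_eq_ofReal,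
    ENNReal.ofReal_pow (by positivity), ENNReal.ofReal_pow hp0.le, ENNReal.ofReal_natCast]

end ElementaryAbelian

/-! ### The number of relations of a finite group -/

/-- A subgroup of a finite abelian group of exponent `q` with `d` generators has at most `q ^ d`
elements. -/
theorem card_closure_range_le {V : Type u} [CommGroup V] {q d : ℕ} [NeZero q]
    (hV : ∀ v : V, v ^ q = 1) (s : Fin d → V) :
    Nat.card (Subgroup.closure (Set.range s)) ≤ q ^ d := by
  let φ : (Fin d → Multiplicative (ZMod q)) →* V :=
    ∏ i, (zmodPowHom (s i) (hV (s i))).comp (Pi.evalMonoidHom _ i)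
  have hle : Subgroup.closure (Set.range s) ≤ φ.range := by
    rw [Subgroup.closure_le]
    rintro _ ⟨i, rfl⟩
    refine ⟨Pi.mulSingle i (Multiplicative.ofAdd 1), ?_⟩
    rw [MonoidHom.finsetProd_apply, Finset.prod_eq_single i]
    · simp [zmodPowHom_one]
    · intro j _ hji
      simp [hji]
    · simp
  have : Finite (Multiplicative (ZMod q)) := inferInstanceAs (Finite (ZMod q))
  have hfin : Finite φ.range := Finite.of_surjective _ φ.rangeRestrict_surjective
  calc Nat.card (Subgroup.closure (Set.range s)) ≤ Nat.card φ.range :=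
        Nat.card_le_card_of_injective _ (Subgroup.inclusion_injective hle)
    _ ≤ Nat.card (Fin d → Multiplicative (ZMod q)) :=
        Nat.card_le_card_of_surjective _ φ.rangeRestrict_surjective
    _ = q ^ d := by
        rw [Nat.card_fun, Nat.card_congr Multiplicative.toAdd, Nat.card_zmod, Nat.card_fin]

namespace FreeProP

variable {p n : ℕ} [hp : Fact p.Prime]

/-- A finite quotient of `F_n` needs at least `n` relations: with fewer relations, the abelian
quotients `(ℤ/p^k)^n` of `F_n` induce arbitrarily large quotients. -/
theorem le_of_finiteIndex_of_le_normalClosure {N : Subgroup (FreeProP p n)}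
    [N.FiniteIndex] {d : ℕ} (s : Fin d → FreeProP p n)
    (h : N ≤ (Subgroup.normalClosure (Set.range s)).topologicalClosure) : n ≤ d := by
  by_contra hlt
  set I := N.index with hI
  have hI0 : I ≠ 0 := Subgroup.FiniteIndex.index_ne_zero
  set q := p ^ I with hq
  have hq0 : 0 < q := pow_pos hp.out.pos I
  have : NeZero q := ⟨hq0.ne'⟩
  let χ := toZMod p n I
  have hexp : ∀ v : Fin n → Multiplicative (ZMod q), v ^ q = 1 := by
    intro v
    funext i
    change Multiplicative.ofAdd (q • (v i).toAdd) = 1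
    rw [nsmul_eq_mul, ZMod.natCast_self, zero_mul, ofAdd_zero]
  set C := Subgroup.closure (Set.range (χ ∘ s))
  have hker : IsOpen (C.comap χ : Set (FreeProP p n)) :=
    Subgroup.isOpen_mono (χ.ker_le_comap C) (isOpen_ker_toZMod I)
  have hle : N ≤ C.comap χ := by
    refine h.trans (Subgroup.topologicalClosure_minimal _ (Subgroup.normalClosure_le_normal ?_)
      (Subgroup.isClosed_of_isOpen _ hker))
    rintro _ ⟨i, rfl⟩
    exact Subgroup.subset_closure ⟨i, rfl⟩
  have h1 : C.index ≤ I := by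
    rw [← Subgroup.index_comap_of_surjective C (toZMod_surjective I)]
    exact Nat.le_of_dvd (Nat.pos_of_ne_zero hI0) (Subgroup.index_dvd_of_le hle)
  have h2 : Nat.card C ≤ q ^ d := card_closure_range_le hexp (χ ∘ s)
  have h3 : Nat.card C * C.index = q ^ n := by
    rw [C.card_mul_index, Nat.card_fun, Nat.card_congr Multiplicative.toAdd, Nat.card_zmod,
      Nat.card_fin]
  have h4 : q ^ d * q ≤ q ^ d * I := by
    calc q ^ d * q = q ^ (d + 1) := (pow_succ _ _).symm
      _ ≤ q ^ n := Nat.pow_le_pow_right hq0 (by omega)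
      _ = Nat.card C * C.index := h3.symm
      _ ≤ q ^ d * I := Nat.mul_le_mul h2 h1
  have h5 : q ≤ I := Nat.le_of_mul_le_mul_left h4 (pow_pos hq0 d)
  exact absurd h5 (not_le.2 (Nat.lt_pow_self hp.out.one_lt))

end FreeProP

section RelationModule

variable {p n : ℕ} [hp : Fact p.Prime] (r : Fin n → OddPart (FreeProP p n))

/-- The image of the relation subgroup `N_r` in the quotient of `F_n` by its Frattini subgroup. -/
def relModule : Subgroup (FreeProP p n ⧸ frattini p (relSubgroup r)) :=
  (relSubgroup r).map (QuotientGroup.mk' (frattini p (relSubgroup r)))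

theorem relModule_eq_closure :
    relModule r = Subgroup.closure (Set.range fun i =>
      QuotientGroup.mk' (frattini p (relSubgroup r)) (r i).1) ∧ Finite (relModule r) := by
  have h := map_frattini_eq_closure (N := relSubgroup r) hp.out.pos
    (Set.finite_range fun i => (r i).1) (by rintro _ ⟨i, rfl⟩; exact mem_relSubgroup r i) le_rfl
  rwa [← Set.range_comp] at h

instance : Finite (relModule r) := (relModule_eq_closure r).2

/-- The relation module is generated by odd elements, hence odd. -/
theorem sigma_eq_inv_of_mem_relModule {v : FreeProP p n ⧸ frattini p (relSubgroup r)}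
    (hv : v ∈ relModule r) : sigma v = v⁻¹ := by
  have hcomm := fun a ha => commute_mk_frattini (p := p) (N := relSubgroup r) (v := a) ha
  rw [(relModule_eq_closure r).1] at hv
  have hle : Subgroup.closure (Set.range fun i =>
      QuotientGroup.mk' (frattini p (relSubgroup r)) (r i).1) ≤ relModule r :=
    (relModule_eq_closure r).1.ge
  induction hv using Subgroup.closure_induction with
  | mem x hx =>
    obtain ⟨i, rfl⟩ := hx
    rw [← (IsSigmaHom.mk' (frattini p (relSubgroup r))).map_sigma, (r i).2, map_inv]
  | one => simp
  | mul x y hx hy ihx ihy =>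
    rw [map_mul, ihx, ihy, ← mul_inv_rev, (hcomm x (hle hx) y).eq]
  | inv x hx ih => rw [map_inv, ih]

/-- If `G_r` is finite, then `N_r` modulo its Frattini subgroup has rank exactly `n`: it is
generated by the `n` relations, and by Nakayama's lemma fewer relations would suffice if the rank
were smaller. -/
theorem card_relModule [Finite (RelGroup r)] : Nat.card (relModule r) = p ^ n ∧
    Nat.card {t : Fin n → relModule r // Subgroup.closure (Set.range t) = ⊤} =
      ∏ i : Fin n, (p ^ n - p ^ i.val) := by
  obtain ⟨d, h1, ⟨s, hs⟩, h3, h4⟩ :=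
    exists_rank_of_elementaryAbelian (V := relModule r)
      (fun a b => Subtype.ext (commute_mk_frattini a.2 b.1).eq)
      (fun a => Subtype.ext (pow_mk_frattini a.2))
  suffices hd : d = n by subst hd; exact ⟨h1, h4⟩
  apply le_antisymm
  · refine h3 n (fun i => ⟨_, Subgroup.mem_map_of_mem _ (mem_relSubgroup r i)⟩) ?_
    refine Subgroup.map_injective (relModule r).subtype_injective ?_
    rw [MonoidHom.map_closure, ← Set.range_comp, ← MonoidHom.range_eq_map, Subgroup.range_subtype]
    exact (relModule_eq_closure r).1.symm
  · choose x hx hxs using fun i => (s i).2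
    have hfi : (relSubgroup r).FiniteIndex := Subgroup.finiteIndex_of_finite_quotient
    refine FreeProP.le_of_finiteIndex_of_le_normalClosure (N := relSubgroup r) x ?_
    have hn : (Subgroup.normalClosure (Set.range x)).topologicalClosure.Normal :=
      Subgroup.is_normal_topologicalClosure _
    refine ProPCompletion.isProP.le_of_le_sup_frattini (Subgroup.isClosed_topologicalClosure _) ?_
    rw [sup_comm, ← QuotientGroup.comap_map_mk', ← Subgroup.map_le_iff_le_comap]
    change relModule r ≤ _
    have h5 : relModule r = Subgroup.closure (Set.range fun i => (s i).1) := by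
      have := congrArg (Subgroup.map (relModule r).subtype) hs
      rw [MonoidHom.map_closure, ← Set.range_comp, ← MonoidHom.range_eq_map,
        Subgroup.range_subtype] at this
      exact this.symm
    rw [h5, Subgroup.closure_le]
    rintro _ ⟨i, rfl⟩
    exact ⟨x i, Subgroup.le_topologicalClosure _
      (Subgroup.subset_normalClosure (Set.mem_range_self i)), hxs i⟩

/-- A tuple of odd elements generates the same relation subgroup as `r` if and only if its image
generates the relation module. -/
theorem relSubgroup_eq_iff [Finite (RelGroup r)] (s : Fin n → OddPart (FreeProP p n)) :
    relSubgroup s = relSubgroup r ↔ Subgroup.closure (Set.range fun i =>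
      QuotientGroup.mk' (frattini p (relSubgroup r)) (s i).1) = relModule r := by
  set M := frattini p (relSubgroup r) with hM
  have hMN : M ≤ relSubgroup r := frattini_le_self (isClosed_relSubgroup r)
  have hfi : (relSubgroup r).FiniteIndex := Subgroup.finiteIndex_of_finite_quotient
  have hNo : IsOpen (relSubgroup r : Set (FreeProP p n)) :=
    Subgroup.isOpen_of_isClosed_of_finiteIndex _ (isClosed_relSubgroup r)
  have hMo : IsOpen (M : Set (FreeProP p n)) := FreeProP.isOpen_frattini hNo
  constructor
  · intro h
    have hle : Subgroup.closure (Set.range fun i => QuotientGroup.mk' M (s i).1) ≤ relModule r := by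
      rw [Subgroup.closure_le]
      rintro _ ⟨i, rfl⟩
      exact Subgroup.mem_map_of_mem _ (h ▸ mem_relSubgroup s i)
    refine le_antisymm hle ?_
    have hn := normal_of_le_map_frattini hle
    rw [relModule, Subgroup.map_le_iff_le_comap]
    refine h.ge.trans ?_
    have ho : IsOpen ((Subgroup.closure (Set.range fun i => QuotientGroup.mk' M (s i).1)).comap
        (QuotientGroup.mk' M) : Set (FreeProP p n)) :=
      Subgroup.isOpen_mono (by
        conv_lhs => rw [← QuotientGroup.ker_mk' M]
        exact (QuotientGroup.mk' M).ker_le_comap _) hMo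
    exact relSubgroup_le (Subgroup.isClosed_of_isOpen _ ho)
      fun i => Subgroup.subset_closure (Set.mem_range_self i)
  · intro h
    apply le_antisymm
    · refine relSubgroup_le (isClosed_relSubgroup r) fun i => ?_
      have h1 : QuotientGroup.mk' M (s i).1 ∈ relModule r :=
        h ▸ Subgroup.subset_closure (Set.mem_range_self i)
      have h2 : (s i).1 ∈ (relModule r).comap (QuotientGroup.mk' M) := h1
      rwa [relModule, QuotientGroup.comap_map_mk', sup_eq_right.2 hMN] at h2
    · refine ProPCompletion.isProP.le_of_le_sup_frattini (isClosed_relSubgroup s) ?_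
      rw [sup_comm, ← QuotientGroup.comap_map_mk', ← Subgroup.map_le_iff_le_comap]
      change relModule r ≤ _
      rw [← h, Subgroup.closure_le]
      rintro _ ⟨i, rfl⟩
      exact Subgroup.mem_map_of_mem _ (mem_relSubgroup s i)

end RelationModule

/-! ### The probability of a given relation subgroup -/

section RelationMeasure

variable {p n : ℕ} [hp : Fact p.Prime]

/-- The probability that `n` random relations in `F_n` have the same normal closure as the
relations `r` of a finite group: they have to lie in `N_r`, and then to generate the relation module
of rank `n`. -/
theorem measure_relSubgroup_eq (hp2 : p ≠ 2) (r : Fin n → OddPart (FreeProP p n))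
    [Finite (RelGroup r)] :
    MeasurableSet {s : Fin n → OddPart (FreeProP p n) | relSubgroup s = relSubgroup r} ∧
      (Measure.pi fun _ => haarOdd (FreeProP p n)) {s | relSubgroup s = relSubgroup r} =
        ((Nat.card (OddPart (RelGroup r)) : ℝ≥0∞)⁻¹) ^ n * cPart p n := by
  have hfi : (relSubgroup r).FiniteIndex := Subgroup.finiteIndex_of_finite_quotient
  have hNo : IsOpen (relSubgroup r : Set (FreeProP p n)) :=
    Subgroup.isOpen_of_isClosed_of_finiteIndex _ (isClosed_relSubgroup r)
  set M := frattini p (relSubgroup r) with hM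
  have hMN : M ≤ relSubgroup r := frattini_le_self (isClosed_relSubgroup r)
  have hMo : IsOpen (M : Set (FreeProP p n)) := FreeProP.isOpen_frattini hNo
  have := QuotientGroup.discreteTopology hMo
  set β : ℝ≥0∞ := (Nat.card (OddPart (FreeProP p n ⧸ M)) : ℝ≥0∞)⁻¹ with hβ
  let f : OddPart (FreeProP p n) → FreeProP p n ⧸ M := fun y => QuotientGroup.mk' M y.1
  have hf : Continuous f := QuotientGroup.continuous_mk.comp continuous_subtype_val
  have hfm : ∀ v, MeasurableSet (f ⁻¹' {v}) := fun v =>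
    ((isOpen_discrete {v}).preimage hf).measurableSet
  have hfv : ∀ v ∈ relModule r, haarOdd (FreeProP p n) (f ⁻¹' {v}) = β := fun v hv =>
    haarOdd_fiber p hp2 (FreeProP p n) ProPCompletion.isProP M hMo
      ⟨v, sigma_eq_inv_of_mem_relModule r hv⟩
  obtain ⟨hcard, htuples⟩ := card_relModule r
  have hfin : Finite (relModule r) := inferInstance
  -- `N_r` is the disjoint union of `p ^ n` cosets of its Frattini subgroup, and the odd elements of
  -- each coset have the same measure `β`
  have hQ : (Nat.card (OddPart (RelGroup r)) : ℝ≥0∞)⁻¹ = (p : ℝ≥0∞) ^ n * β := by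
    have h1 := haarOdd_fiber p hp2 (FreeProP p n) ProPCompletion.isProP (relSubgroup r) hNo 1
    have h2 : {x : OddPart (FreeProP p n) |
        (QuotientGroup.mk x.1 : RelGroup r) = (1 : OddPart (RelGroup r)).1} =
          f ⁻¹' ((Set.toFinite (relModule r : Set (FreeProP p n ⧸ M))).toFinset) := by
      ext x
      rw [Set.Finite.coe_toFinset]
      change (QuotientGroup.mk x.1 : RelGroup r) = 1 ↔
        x.1 ∈ (relModule r).comap (QuotientGroup.mk' M)
      rw [QuotientGroup.eq_one_iff, relModule, QuotientGroup.comap_map_mk', sup_eq_right.2 hMN]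
    rw [← h1, h2, ← sum_measure_preimage_singleton _ fun v _ => hfm v,
      Finset.sum_congr rfl fun v hv => hfv v ((Set.Finite.mem_toFinset _).1 hv),
      Finset.sum_const, nsmul_eq_mul, ← Nat.card_eq_card_finite_toFinset]
    congr 1
    rw [← Nat.cast_pow]
    exact congrArg _ hcard
  let φ : (Fin n → OddPart (FreeProP p n)) → (Fin n → FreeProP p n ⧸ M) := fun s i => f (s i)
  let T : Set (Fin n → FreeProP p n ⧸ M) := {t | Subgroup.closure (Set.range t) = relModule r}
  have hφ : ∀ t : Fin n → FreeProP p n ⧸ M, φ ⁻¹' {t} = Set.univ.pi fun i => f ⁻¹' {t i} := by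
    intro t
    ext s
    simp [φ, funext_iff]
  have hφm : ∀ t, MeasurableSet (φ ⁻¹' {t}) := by
    intro t
    rw [hφ]
    exact MeasurableSet.univ_pi fun i => hfm _
  have hTV : ∀ t ∈ T, ∀ i, t i ∈ relModule r := fun t ht i =>
    (show Subgroup.closure (Set.range t) = relModule r from ht) ▸
      Subgroup.subset_closure (Set.mem_range_self i)
  have hTcard : Nat.card T = ∏ i : Fin n, (p ^ n - p ^ i.val) := by
    rw [← htuples]
    refine Nat.card_congr
      { toFun := fun t => ⟨fun i => ⟨t.1 i, hTV t.1 t.2 i⟩, ?_⟩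
        invFun := fun t => ⟨fun i => (t.1 i).1, ?_⟩
        left_inv := fun t => rfl
        right_inv := fun t => rfl }
    · refine Subgroup.map_injective (relModule r).subtype_injective ?_
      rw [MonoidHom.map_closure, ← Set.range_comp, ← MonoidHom.range_eq_map,
        Subgroup.range_subtype]
      exact t.2
    · have := congrArg (Subgroup.map (relModule r).subtype) t.2
      rw [MonoidHom.map_closure, ← Set.range_comp, ← MonoidHom.range_eq_map,
        Subgroup.range_subtype] at this
      exact this
  have hfinQ : Finite (FreeProP p n ⧸ M) := Subgroup.quotient_finite_of_isOpen M hMo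
  have hset : {s : Fin n → OddPart (FreeProP p n) | relSubgroup s = relSubgroup r} =
      φ ⁻¹' (Set.toFinite T).toFinset := by
    ext s
    rw [Set.Finite.coe_toFinset]
    exact relSubgroup_eq_iff r s
  refine ⟨?_, ?_⟩
  · rw [hset, ← Set.biUnion_preimage_singleton]
    exact Finset.measurableSet_biUnion _ fun t _ => hφm t
  · have hpt : ∀ t ∈ T, (Measure.pi fun _ => haarOdd (FreeProP p n)) (φ ⁻¹' {t}) = β ^ n := by
      intro t ht
      rw [hφ, Measure.pi_pi, Finset.prod_congr rfl fun i _ => hfv (t i) (hTV t ht i),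
        Finset.prod_const, Finset.card_univ, Fintype.card_fin]
    rw [hset, ← sum_measure_preimage_singleton _ fun t _ => hφm t,
      Finset.sum_congr rfl fun t ht => hpt t ((Set.Finite.mem_toFinset _).1 ht),
      Finset.sum_const, nsmul_eq_mul, ← Nat.card_eq_card_finite_toFinset, hTcard,
      prod_sub_eq_cPart, hQ, mul_pow]
    ring

end RelationMeasure

/-! ### Presentations of a finite group -/

section Presentations

variable {p n : ℕ} [hp : Fact p.Prime] {Q : Type} [Group Q] [TopologicalSpace Q]
  [SigmaGroup Q] [Finite Q] (hQ : IsPGroup p Q)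

/-- The homomorphism `F_n → Q` defined by a tuple of odd elements of a finite `p`-group `Q`. -/
def tupleHom (t : Fin n → OddPart Q) : FreeProP p n →* Q :=
  FreeProP.toFinite hQ fun i => (t i).1

theorem tupleHom_gen (t : Fin n → OddPart Q) (i : Fin n) :
    tupleHom hQ t (FreeProP.gen p n i).1 = (t i).1 := FreeProP.toFinite_gen _ _ _

theorem tupleHom_surjective {t : Fin n → OddPart Q} {J : Finset (Fin n)}
    (h : Subgroup.closure ((fun i => (t i).1) '' J) = ⊤) : Function.Surjective (tupleHom hQ t) := by
  rw [← MonoidHom.range_eq_top, eq_top_iff, ← h, Subgroup.closure_le]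
  rintro _ ⟨i, -, rfl⟩
  exact ⟨_, tupleHom_gen hQ t i⟩

variable [T2Space Q]

theorem isSigmaHom_tupleHom (t : Fin n → OddPart Q) : IsSigmaHom (tupleHom hQ t) :=
  FreeProP.isSigmaHom_toFinite hQ t

theorem eq_tupleHom {f : FreeProP p n →* Q} (hf : IsSigmaHom f) :
    f = tupleHom hQ fun i => hf.odd (FreeProP.gen p n i) :=
  FreeProP.hom_ext hf.continuous (isSigmaHom_tupleHom hQ _).continuous
    fun i => (tupleHom_gen hQ (fun i => hf.odd (FreeProP.gen p n i)) i).symm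

/-- The surjections from `F_n` to `Q` with kernel `N_r` correspond to the `σ`-isomorphisms from
`G_r` to `Q`. -/
theorem card_tuples_eq_card_sigmaEquiv (r : Fin n → OddPart (FreeProP p n)) :
    Nat.card {t : Fin n → OddPart Q //
      Function.Surjective (tupleHom hQ t) ∧ relSubgroup r = (tupleHom hQ t).ker} =
        Nat.card (SigmaEquiv (RelGroup r) Q) := by
  let π := QuotientGroup.mk' (relSubgroup r)
  have hπ : IsSigmaHom π := IsSigmaHom.mk' _
  have hπs : Function.Surjective π := QuotientGroup.mk'_surjective _
  have hcomp : ∀ e : SigmaEquiv (RelGroup r) Q, IsSigmaHom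
      ((e.toContinuousMulEquiv : RelGroup r →* Q).comp π) := fun e => e.isSigmaHom.comp hπ
  let F : SigmaEquiv (RelGroup r) Q → {t : Fin n → OddPart Q //
      Function.Surjective (tupleHom hQ t) ∧ relSubgroup r = (tupleHom hQ t).ker} := fun e =>
    ⟨fun i => (hcomp e).odd (FreeProP.gen p n i), by
      rw [← eq_tupleHom hQ (hcomp e)]
      refine ⟨e.toContinuousMulEquiv.surjective.comp hπs, ?_⟩
      rw [← MonoidHom.comap_ker, (MonoidHom.ker_eq_bot_iff _).2 e.toContinuousMulEquiv.injective,
        MonoidHom.comap_bot, QuotientGroup.ker_mk']⟩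
  refine (Nat.card_congr (Equiv.ofBijective F ⟨?_, ?_⟩)).symm
  · intro e e' h
    have h1 := congrArg (fun t => tupleHom hQ t.1) h
    change tupleHom hQ (fun i => (hcomp e).odd (FreeProP.gen p n i)) =
      tupleHom hQ (fun i => (hcomp e').odd (FreeProP.gen p n i)) at h1
    rw [← eq_tupleHom hQ (hcomp e), ← eq_tupleHom hQ (hcomp e')] at h1
    refine SigmaEquiv.ext fun g => ?_
    obtain ⟨x, rfl⟩ := hπs g
    exact DFunLike.congr_fun h1 x
  · rintro ⟨t, hs, hk⟩
    obtain ⟨e, he⟩ := exists_sigmaEquiv_of_ker_eq hπ (isSigmaHom_tupleHom hQ t) hπs hs (by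
      rw [QuotientGroup.ker_mk', hk])
    refine ⟨e, Subtype.ext (funext fun i => Subtype.ext ?_)⟩
    exact (he _).trans (tupleHom_gen hQ t i)

/-- The kernel of the homomorphism defined by a tuple is generated, as a closed normal subgroup,
by `n` odd elements. -/
def IsBalanced (t : Fin n → OddPart Q) : Prop :=
  ∃ r : Fin n → OddPart (FreeProP p n), relSubgroup r = (tupleHom hQ t).ker

/-- Two tuples that agree on a generating subtuple differ by a `σ`-automorphism of `F_n`. It maps
the remaining generators `x_i` to `(σ w)⁻¹ x_i w` with suitable `w` in the subgroup generated by the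
fixed generators; every odd value in `Q` can be achieved because every odd element has the
form `(σ q)⁻¹ q`. -/
theorem exists_sigmaEquiv_tupleHom (hp2 : p ≠ 2) {t t' : Fin n → OddPart Q} {J : Finset (Fin n)}
    (hJ : ∀ i ∈ J, t i = t' i) (hgen : Subgroup.closure ((fun i => (t i).1) '' J) = ⊤) :
    ∃ e : SigmaEquiv (FreeProP p n) (FreeProP p n),
      ∀ x, tupleHom hQ t (e.toContinuousMulEquiv x) = tupleHom hQ t' x := by
  have hodd := odd_card_of_isPGroup hQ hp2
  set X : Subgroup (FreeProP p n) :=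
    Subgroup.closure ((fun i => (FreeProP.gen p n i).1) '' J) with hX
  have hXQ : X.map (tupleHom hQ t) = ⊤ := by
    rw [hX, MonoidHom.map_closure, Set.image_image, ← hgen]
    congr 1
    exact Set.image_congr fun i _ => tupleHom_gen hQ t i
  have hσX : ∀ w ∈ X, sigma w ∈ X := by
    change X ≤ X.comap sigma
    rw [hX, Subgroup.closure_le]
    rintro _ ⟨i, hi, rfl⟩
    change sigma (FreeProP.gen p n i).1 ∈ X
    rw [(FreeProP.gen p n i).2]
    exact inv_mem (Subgroup.subset_closure ⟨i, hi, rfl⟩)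
  have hw : ∀ i, ∃ w ∈ X,
      (sigma (tupleHom hQ t w))⁻¹ * (t i).1 * tupleHom hQ t w = (t' i).1 := by
    intro i
    obtain ⟨q₁, h₁⟩ := toOdd_surjective hodd (t i)
    obtain ⟨q₂, h₂⟩ := toOdd_surjective hodd (t' i)
    obtain ⟨w, hw, hwq⟩ : q₁⁻¹ * q₂ ∈ X.map (tupleHom hQ t) := hXQ ▸ Subgroup.mem_top _
    refine ⟨w, hw, ?_⟩
    rw [hwq, ← h₁, ← h₂]
    change (sigma (q₁⁻¹ * q₂))⁻¹ * ((sigma q₁)⁻¹ * q₁) * (q₁⁻¹ * q₂) = (sigma q₂)⁻¹ * q₂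
    rw [map_mul, map_inv]
    group
  choose w hwX hwt using hw
  classical
  let y : Fin n → OddPart (FreeProP p n) := fun i =>
    if i ∈ J then FreeProP.gen p n i else
      ⟨(sigma (w i))⁻¹ * (FreeProP.gen p n i).1 * w i, by
        rw [map_mul, map_mul, map_inv, sigma_sigma, (FreeProP.gen p n i).2]
        group⟩
  have hyJ : ∀ i ∈ J, y i = FreeProP.gen p n i := fun i hi => if_pos hi
  have hyJ' : ∀ i, i ∉ J → (y i).1 = (sigma (w i))⁻¹ * (FreeProP.gen p n i).1 * w i :=
    fun i hi => congrArg Subtype.val (if_neg hi)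
  set α := FreeProP.toFree y with hα
  have hαs : IsSigmaHom α := FreeProP.isSigmaHom_toFree y
  have hXα : X ≤ α.range := by
    rw [hX, Subgroup.closure_le]
    rintro _ ⟨i, hi, rfl⟩
    exact ⟨(FreeProP.gen p n i).1, by rw [FreeProP.toFree_gen, hyJ i hi]⟩
  have hsurj : Function.Surjective α := by
    refine FreeProP.surjective_of_gen_mem_range hαs.continuous fun i => ?_
    by_cases hi : i ∈ J
    · exact hXα (Subgroup.subset_closure ⟨i, hi, rfl⟩)
    · have h1 : (y i).1 ∈ α.range := ⟨_, FreeProP.toFree_gen y i⟩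
      have h2 := mul_mem (mul_mem (hXα (hσX _ (hwX i))) h1) (inv_mem (hXα (hwX i)))
      rw [hyJ' i hi] at h2
      convert h2 using 1
      group
  obtain ⟨e, he⟩ := FreeProP.exists_sigmaEquiv_of_surjective hαs hsurj
  refine ⟨e, fun x => ?_⟩
  rw [he]
  refine DFunLike.congr_fun (f := (tupleHom hQ t).comp α) (g := tupleHom hQ t') ?_ x
  refine FreeProP.hom_ext ((isSigmaHom_tupleHom hQ t).continuous.comp hαs.continuous)
    (isSigmaHom_tupleHom hQ t').continuous fun i => ?_
  rw [MonoidHom.comp_apply, FreeProP.toFree_gen, tupleHom_gen]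
  by_cases hi : i ∈ J
  · rw [hyJ i hi, tupleHom_gen, hJ i hi]
  · rw [hyJ' i hi, map_mul, map_mul, map_inv, tupleHom_gen, (isSigmaHom_tupleHom hQ t).map_sigma,
      hwt]

theorem IsBalanced.congr (hp2 : p ≠ 2) {t t' : Fin n → OddPart Q} {J : Finset (Fin n)}
    (hJ : ∀ i ∈ J, t i = t' i) (hgen : Subgroup.closure ((fun i => (t i).1) '' J) = ⊤)
    (h : IsBalanced hQ t) : IsBalanced hQ t' := by
  obtain ⟨r, hr⟩ := h
  obtain ⟨e, he⟩ := exists_sigmaEquiv_tupleHom hQ hp2 hJ hgen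
  refine ⟨fun i => e.symm.isSigmaHom.odd (r i), ?_⟩
  have h1 : relSubgroup (fun i => e.symm.isSigmaHom.odd (r i)) =
      (relSubgroup r).comap (e.toContinuousMulEquiv : FreeProP p n →* FreeProP p n) := by
    refine relSubgroup_eq_comap e.isSigmaHom.continuous e.toContinuousMulEquiv.surjective ?_ ?_ ?_
    · rw [(MonoidHom.ker_eq_bot_iff _).2 e.toContinuousMulEquiv.injective]
      exact bot_le
    · intro i
      change e.toContinuousMulEquiv (e.toContinuousMulEquiv.symm (r i).1) ∈ _
      rw [ContinuousMulEquiv.apply_symm_apply]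
      exact mem_relSubgroup r i
    · intro j
      exact ⟨_, mem_relSubgroup _ j, ContinuousMulEquiv.apply_symm_apply _ _⟩
  rw [h1, hr, MonoidHom.comap_ker]
  congr 1
  exact MonoidHom.ext he

/-- A presentation of `Q` on `k` generators yields a balanced tuple of length `k + m` with `m`
redundant trivial entries, by adding the redundant generators to the relations. -/
theorem exists_isBalanced {k : ℕ} {r : Fin k → OddPart (FreeProP p k)}
    (e : SigmaEquiv (RelGroup r) Q) (m : ℕ) :
    ∃ (J : Finset (Fin (k + m))) (t : Fin (k + m) → OddPart Q), J.card = m ∧ IsBalanced hQ t ∧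
      Subgroup.closure ((fun i => (t i).1) '' (Jᶜ : Finset (Fin (k + m)))) = ⊤ := by
  induction m with
  | zero =>
    have hc := e.isSigmaHom.comp (IsSigmaHom.mk' (relSubgroup r))
    have hs : Function.Surjective ((e.toContinuousMulEquiv : RelGroup r →* Q).comp
        (QuotientGroup.mk' (relSubgroup r))) :=
      e.toContinuousMulEquiv.surjective.comp (QuotientGroup.mk'_surjective _)
    refine ⟨∅, fun i => hc.odd (FreeProP.gen p k i), rfl, ⟨r, ?_⟩, ?_⟩
    · refine Eq.trans ?_ (congrArg MonoidHom.ker (eq_tupleHom hQ hc))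
      rw [← MonoidHom.comap_ker,
        (MonoidHom.ker_eq_bot_iff _).2 e.toContinuousMulEquiv.injective, MonoidHom.comap_bot,
        QuotientGroup.ker_mk']
    · set C := Subgroup.closure ((fun i => (hc.odd (FreeProP.gen p k i)).1) ''
        ((∅ᶜ : Finset (Fin k)) : Set (Fin k)))
      have h1 : C.comap ((e.toContinuousMulEquiv : RelGroup r →* Q).comp
          (QuotientGroup.mk' (relSubgroup r))) = ⊤ := by
        refine FreeProP.eq_top_of_isClosed ((Set.toFinite (C : Set Q)).isClosed.preimage
          hc.continuous) fun i => Subgroup.subset_closure ⟨i, by simp, rfl⟩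
      rw [eq_top_iff]
      intro q _
      obtain ⟨x, rfl⟩ := hs q
      exact (h1 ▸ Subgroup.mem_top x : x ∈ C.comap _)
  | succ m ih =>
    obtain ⟨J, t, hJ, ⟨s, hs⟩, hgen⟩ := ih
    let π := FreeProP.dropFirst p (k + m)
    let ι : FreeProP p (k + m) →* FreeProP p (k + m + 1) :=
      FreeProP.toFree fun i => FreeProP.gen p (k + m + 1) i.succ
    have hι : IsSigmaHom ι := FreeProP.isSigmaHom_toFree _
    have hπι : ∀ x, π (ι x) = x := by
      intro x
      refine DFunLike.congr_fun (f := π.comp ι) (g := MonoidHom.id _) ?_ x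
      refine FreeProP.hom_ext (FreeProP.isSigmaHom_dropFirst.continuous.comp hι.continuous)
        continuous_id fun i => ?_
      rw [MonoidHom.comp_apply, FreeProP.toFree_gen, FreeProP.dropFirst_gen_succ]
      rfl
    refine ⟨insert 0 (J.map (Fin.succEmb _)), Fin.cons 1 t, ?_,
      ⟨Fin.cons (FreeProP.gen p (k + m + 1) 0) fun i => hι.odd (s i), ?_⟩, ?_⟩
    · rw [Finset.card_insert_of_notMem (by simp), Finset.card_map, hJ]
    · have h1 : tupleHom hQ (Fin.cons 1 t) = (tupleHom hQ t).comp π := by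
        refine FreeProP.hom_ext (isSigmaHom_tupleHom hQ _).continuous
          ((isSigmaHom_tupleHom hQ t).comp FreeProP.isSigmaHom_dropFirst).continuous fun i => ?_
        rw [tupleHom_gen, MonoidHom.comp_apply]
        refine Fin.cases ?_ (fun i => ?_) i
        · rw [FreeProP.dropFirst_gen_zero, map_one]; rfl
        · rw [FreeProP.dropFirst_gen_succ, tupleHom_gen]; rfl
      refine (relSubgroup_eq_comap FreeProP.isSigmaHom_dropFirst.continuous
        FreeProP.dropFirst_surjective (s := s) ?_ ?_ ?_).trans ?_
      · exact FreeProP.ker_dropFirst_le (isClosed_relSubgroup _)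
          (mem_relSubgroup (Fin.cons (FreeProP.gen p (k + m + 1) 0) fun i => hι.odd (s i)) 0)
      · refine Fin.cases ?_ fun i => ?_
        · rw [Fin.cons_zero, FreeProP.dropFirst_gen_zero]
          exact one_mem _
        · change π (ι (s i).1) ∈ _
          rw [hπι]
          exact mem_relSubgroup s i
      · intro j
        exact ⟨_, mem_relSubgroup
          (Fin.cons (FreeProP.gen p (k + m + 1) 0) fun i => hι.odd (s i)) j.succ, hπι _⟩
      · exact (congrArg (Subgroup.comap π) hs).trans
          ((MonoidHom.comap_ker _ _).trans (congrArg MonoidHom.ker h1.symm))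
    · rw [← top_le_iff, ← hgen]
      refine Subgroup.closure_mono ?_
      rintro _ ⟨i, hi, rfl⟩
      refine ⟨i.succ, ?_, rfl⟩
      simpa [Fin.succ_ne_zero] using hi

end Presentations

/-! ### The mass of a finite weak Schur group -/

theorem SigmaEquiv.card_congr {G G' H H' : Type*} [Group G] [TopologicalSpace G] [SigmaGroup G]
    [Group G'] [TopologicalSpace G'] [SigmaGroup G'] [Group H] [TopologicalSpace H] [SigmaGroup H]
    [Group H'] [TopologicalSpace H'] [SigmaGroup H'] (e : SigmaEquiv G G') (f : SigmaEquiv H H') :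
    Nat.card (SigmaEquiv G H) = Nat.card (SigmaEquiv G' H') := by
  refine Nat.card_congr
    { toFun := fun φ => e.symm.trans (φ.trans f)
      invFun := fun ψ => e.trans (ψ.trans f.symm)
      left_inv := fun φ => SigmaEquiv.ext fun g => ?_
      right_inv := fun ψ => SigmaEquiv.ext fun g => ?_ }
  · change f.toContinuousMulEquiv.symm (f.toContinuousMulEquiv (φ.toContinuousMulEquiv
      (e.toContinuousMulEquiv.symm (e.toContinuousMulEquiv g)))) = φ.toContinuousMulEquiv g
    simp
  · change f.toContinuousMulEquiv (f.toContinuousMulEquiv.symm (ψ.toContinuousMulEquiv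
      (e.toContinuousMulEquiv (e.toContinuousMulEquiv.symm g)))) = ψ.toContinuousMulEquiv g
    simp

theorem SigmaEquiv.card_oddPart {G H : Type*} [Group G] [TopologicalSpace G] [SigmaGroup G]
    [Group H] [TopologicalSpace H] [SigmaGroup H] (e : SigmaEquiv G H) :
    Nat.card (OddPart G) = Nat.card (OddPart H) := by
  refine Nat.card_congr (e.toContinuousMulEquiv.toEquiv.subtypeEquiv fun g => ?_)
  change _ ↔ sigma (e.toContinuousMulEquiv g) = (e.toContinuousMulEquiv g)⁻¹
  rw [← map_inv, ← e.toContinuousMulEquiv.injective.eq_iff]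
  exact Eq.congr_left (e.map_sigma g)

section PointMass

variable {p : ℕ} [hp : Fact p.Prime] {Q : Type} [Group Q] [TopologicalSpace Q]
  [SigmaGroup Q] [Finite Q] (hQ : IsPGroup p Q)

/-- The set of tuples of relations in `F_n` that generate the kernel of the surjection defined by a
tuple of odd elements; it is empty if the tuple does not generate `Q`. -/
def presentedBy {n : ℕ} (t : Fin n → OddPart Q) : Set (Fin n → OddPart (FreeProP p n)) :=
  {r | Function.Surjective (tupleHom hQ t) ∧ relSubgroup r = (tupleHom hQ t).ker}

/-- The tuples whose entries in `J` do not generate `Q` miss some odd element in all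
these places. -/
theorem card_not_generating_le (hgen : Subgroup.closure (Set.range fun q : OddPart Q => q.1) = ⊤)
    {n : ℕ} (J : Finset (Fin n)) :
    Nat.card {t : Fin n → OddPart Q //
      Subgroup.closure ((fun i => (t i).1) '' (J : Set (Fin n))) ≠ ⊤} ≤
      Nat.card (OddPart Q) * ((Nat.card (OddPart Q) - 1) ^ J.card *
        Nat.card (OddPart Q) ^ (n - J.card)) := by
  classical
  have := Fintype.ofFinite (OddPart Q)
  have hsub : (Finset.univ.filter fun t : Fin n → OddPart Q =>
      Subgroup.closure ((fun i => (t i).1) '' (J : Set (Fin n))) ≠ ⊤) ⊆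
      Finset.univ.biUnion fun q : OddPart Q => Fintype.piFinset fun i =>
        if i ∈ J then Finset.univ.erase q else Finset.univ := by
    intro t ht
    by_contra hcon
    refine (Finset.mem_filter.1 ht).2 ?_
    rw [← top_le_iff, ← hgen, Subgroup.closure_le]
    rintro _ ⟨q, rfl⟩
    by_contra hq
    refine hcon (Finset.mem_biUnion.2 ⟨q, Finset.mem_univ q, Fintype.mem_piFinset.2 fun i => ?_⟩)
    split_ifs with hi
    · refine Finset.mem_erase.2 ⟨fun hiq => hq ?_, Finset.mem_univ _⟩
      exact Subgroup.subset_closure ⟨i, hi, congrArg Subtype.val hiq⟩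
    · exact Finset.mem_univ _
  rw [Nat.card_eq_fintype_card, Fintype.card_subtype, Nat.card_eq_fintype_card]
  refine (Finset.card_le_card hsub).trans (Finset.card_biUnion_le.trans ?_)
  refine (Finset.sum_le_card_nsmul _ _ _ fun q _ => ?_).trans
    (by rw [Finset.card_univ, smul_eq_mul])
  rw [Fintype.card_piFinset]
  refine le_of_eq ?_
  rw [← Finset.prod_mul_prod_compl J,
    Finset.prod_congr rfl fun i hi => show _ = Fintype.card (OddPart Q) - 1 by
      rw [if_pos hi, Finset.card_erase_of_mem (Finset.mem_univ q), Finset.card_univ],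
    Finset.prod_congr (s₁ := Jᶜ) rfl fun i hi => show _ = Fintype.card (OddPart Q) by
      rw [if_neg (Finset.mem_compl.1 hi), Finset.card_univ],
    Finset.prod_const, Finset.prod_const, Finset.card_compl, Fintype.card_fin]

variable [T2Space Q]

theorem measure_presentedBy (hp2 : p ≠ 2) {n : ℕ} {t : Fin n → OddPart Q}
    (hs : Function.Surjective (tupleHom hQ t)) (hb : IsBalanced hQ t) :
    MeasurableSet (presentedBy hQ t) ∧
      (Measure.pi fun _ => haarOdd (FreeProP p n)) (presentedBy hQ t) =
        ((Nat.card (OddPart Q) : ℝ≥0∞)⁻¹) ^ n * cPart p n := by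
  obtain ⟨r, hr⟩ := hb
  obtain ⟨e, -⟩ := exists_sigmaEquiv_of_ker_eq (IsSigmaHom.mk' (relSubgroup r))
    (isSigmaHom_tupleHom hQ t) (QuotientGroup.mk'_surjective _) hs (by
      rw [QuotientGroup.ker_mk', hr])
  have : Finite (RelGroup r) := Finite.of_equiv Q e.symm.toContinuousMulEquiv.toEquiv
  have hset : presentedBy hQ t = {s | relSubgroup s = relSubgroup r} := by
    ext s
    change Function.Surjective (tupleHom hQ t) ∧ relSubgroup s = (tupleHom hQ t).ker ↔
      relSubgroup s = relSubgroup r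
    rw [hr, and_iff_right hs]
  rw [hset, ← e.card_oddPart]
  exact measure_relSubgroup_eq hp2 r

theorem measure_presentedBy_le (hp2 : p ≠ 2) {n : ℕ} (t : Fin n → OddPart Q) :
    MeasurableSet (presentedBy hQ t) ∧
      (Measure.pi fun _ => haarOdd (FreeProP p n)) (presentedBy hQ t) ≤
        ((Nat.card (OddPart Q) : ℝ≥0∞)⁻¹) ^ n * cPart p n := by
  by_cases h : Function.Surjective (tupleHom hQ t) ∧ IsBalanced hQ t
  · exact ⟨(measure_presentedBy hQ hp2 h.1 h.2).1, (measure_presentedBy hQ hp2 h.1 h.2).2.le⟩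
  · have hempty : presentedBy hQ t = ∅ :=
      Set.eq_empty_of_forall_notMem fun r hr => h ⟨hr.1, r, hr.2⟩
    rw [hempty]
    exact ⟨MeasurableSet.empty, by simp⟩

/-- Summing over all surjections from `F_n` to `Q` counts every presentation of `Q` as often as `Q`
has `σ`-automorphisms. -/
theorem sum_measure_presentedBy (hp2 : p ≠ 2) {k : ℕ} {r₀ : Fin k → OddPart (FreeProP p k)}
    (e : SigmaEquiv (RelGroup r₀) Q) (n : ℕ) [Fintype (Fin n → OddPart Q)]
    (hmeas : MeasurableSet {theta p k r₀}) :
    ∑ t : Fin n → OddPart Q, (Measure.pi fun _ => haarOdd (FreeProP p n)) (presentedBy hQ t) =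
      Nat.card (SigmaAut Q) * schMeasure p n {theta p k r₀} := by
  have hA : MeasurableSet (theta p n ⁻¹' {theta p k r₀}) := measurable_theta n hmeas
  have hpt : ∀ r : Fin n → OddPart (FreeProP p n),
      ∑ t : Fin n → OddPart Q, (presentedBy hQ t).indicator (fun _ => (1 : ℝ≥0∞)) r =
        (theta p n ⁻¹' {theta p k r₀}).indicator (fun _ => (Nat.card (SigmaAut Q) : ℝ≥0∞)) r := by
    intro r
    classical
    have h1 : ∑ t : Fin n → OddPart Q, (presentedBy hQ t).indicator (fun _ => (1 : ℝ≥0∞)) r =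
        (Nat.card (SigmaEquiv (RelGroup r) Q) : ℝ≥0∞) := by
      rw [← card_tuples_eq_card_sigmaEquiv hQ r, Nat.card_eq_fintype_card, Fintype.card_subtype,
        Finset.card_filter, Nat.cast_sum]
      refine Finset.sum_congr rfl fun t _ => ?_
      rw [Set.indicator_apply, Nat.cast_ite, Nat.cast_one, Nat.cast_zero]
      exact if_congr Iff.rfl rfl rfl
    rw [h1, Set.indicator_apply]
    split_ifs with h
    · obtain ⟨f⟩ := theta_eq_theta_iff.1 (Set.mem_singleton_iff.1 h)
      rw [SigmaEquiv.card_congr (f.trans e) (SigmaEquiv.refl (G := Q))]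
    · have : IsEmpty (SigmaEquiv (RelGroup r) Q) :=
        ⟨fun f => h (theta_eq_theta_iff.2 ⟨f.trans e.symm⟩)⟩
      rw [Nat.card_of_isEmpty, Nat.cast_zero]
  have hsch : schMeasure p n {theta p k r₀} =
      (Measure.pi fun _ => haarOdd (FreeProP p n)) (theta p n ⁻¹' {theta p k r₀}) :=
    Measure.map_apply (measurable_theta n) hmeas
  rw [hsch, ← lintegral_indicator_const hA, ← lintegral_congr hpt,
    lintegral_finsetSum _ fun t _ =>
      (measurable_const.indicator (measure_presentedBy_le hQ hp2 t).1)]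
  exact Finset.sum_congr rfl fun t _ =>
    (lintegral_indicator_one (measure_presentedBy_le hQ hp2 t).1).symm

/-- All tuples whose entries in suitable `m` places generate `Q` are balanced. -/
theorem exists_finset_forall_isBalanced (hp2 : p ≠ 2) {k : ℕ}
    {r₀ : Fin k → OddPart (FreeProP p k)} (e : SigmaEquiv (RelGroup r₀) Q) (m : ℕ) :
    ∃ J : Finset (Fin (k + m)), J.card = m ∧ ∀ t : Fin (k + m) → OddPart Q,
      Subgroup.closure ((fun i => (t i).1) '' J) = ⊤ → IsBalanced hQ t := by
  classical
  obtain ⟨J, t₁, hJ, hb, hgen⟩ := exists_isBalanced hQ e m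
  refine ⟨J, hJ, fun t ht => ?_⟩
  -- pass from `t₁` to `t` through the tuple with entries from `t` in `J` and from `t₁` elsewhere
  have h1 : IsBalanced hQ (J.piecewise t t₁) :=
    hb.congr hQ hp2 (J := Jᶜ)
      (fun i hi => (Finset.piecewise_eq_of_notMem _ _ _ (Finset.mem_compl.1 hi)).symm) hgen
  refine h1.congr hQ hp2 (J := J) (fun i hi => Finset.piecewise_eq_of_mem _ _ _ hi) ?_
  rw [← ht]
  congr 1
  refine Set.image_congr fun i hi => ?_
  rw [Finset.piecewise_eq_of_mem _ _ _ hi]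

theorem closure_odd_eq_top (hQ : IsPGroup p Q) {k : ℕ} {r₀ : Fin k → OddPart (FreeProP p k)}
    (e : SigmaEquiv (RelGroup r₀) Q) :
    Subgroup.closure (Set.range fun q : OddPart Q => q.1) = ⊤ := by
  obtain ⟨J, t, -, -, hgen⟩ := exists_isBalanced hQ e 0
  rw [← top_le_iff, ← hgen]
  refine Subgroup.closure_mono ?_
  rintro _ ⟨i, -, rfl⟩
  exact ⟨t i, rfl⟩

/-- Bounds for the mass of `[Q]` under `μ_n`: by `measure_presentedBy` it would be exactly
`∏_{i ≤ n} (1 - p⁻ⁱ) / |Aut_σ(Q)|` if all tuples of odd elements generated `Q`. -/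
theorem schMeasure_bounds (hQ : IsPGroup p Q) (hp2 : p ≠ 2) {k : ℕ}
    {r₀ : Fin k → OddPart (FreeProP p k)}
    (e : SigmaEquiv (RelGroup r₀) Q) (hmeas : MeasurableSet {theta p k r₀}) (m : ℕ) :
    Nat.card (SigmaAut Q) * schMeasure p (k + m) {theta p k r₀} ≤ cPart p (k + m) ∧
      cPart p (k + m) ≤ Nat.card (SigmaAut Q) * schMeasure p (k + m) {theta p k r₀} +
        Nat.card (OddPart Q) *
          (((Nat.card (OddPart Q) - 1 : ℕ) : ℝ≥0∞) * (Nat.card (OddPart Q) : ℝ≥0∞)⁻¹) ^ m *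
            cPart p (k + m) := by
  classical
  have := Fintype.ofFinite (OddPart Q)
  set K := Nat.card (OddPart Q) with hK
  have hK0 : (K : ℝ≥0∞) ≠ 0 := Nat.cast_ne_zero.2 Nat.card_pos.ne'
  have hKtop : (K : ℝ≥0∞) ≠ ∞ := ENNReal.natCast_ne_top K
  have hinv : ∀ j, (K : ℝ≥0∞) ^ j * ((K : ℝ≥0∞)⁻¹) ^ j = 1 := fun j => by
    rw [← mul_pow, ENNReal.mul_inv_cancel hK0 hKtop, one_pow]
  set n := k + m with hn
  set c : ℝ≥0∞ := ((K : ℝ≥0∞)⁻¹) ^ n * cPart p n with hc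
  have hall : (K : ℝ≥0∞) ^ n * c = cPart p n := by
    rw [hc, ← mul_assoc, hinv, one_mul]
  have hcard : ((Finset.univ : Finset (Fin n → OddPart Q)).card : ℝ≥0∞) = (K : ℝ≥0∞) ^ n := by
    rw [Finset.card_univ, Fintype.card_fun, Fintype.card_fin, Nat.cast_pow, hK,
      Nat.card_eq_fintype_card]
  rw [← sum_measure_presentedBy hQ hp2 e n hmeas]
  constructor
  · refine (Finset.sum_le_card_nsmul _ _ _ fun t _ => (measure_presentedBy_le hQ hp2 t).2).trans ?_
    rw [nsmul_eq_mul, hcard, hall]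
  · obtain ⟨J, hJ, hbal⟩ := exists_finset_forall_isBalanced hQ hp2 e m
    let good : (Fin n → OddPart Q) → Prop := fun t =>
      Subgroup.closure ((fun i => (t i).1) '' (J : Set (Fin n))) = ⊤
    have hgood : ∀ t ∈ Finset.univ.filter good,
        c ≤ (Measure.pi fun _ => haarOdd (FreeProP p n)) (presentedBy hQ t) := by
      intro t ht
      have ht' : good t := (Finset.mem_filter.1 ht).2
      exact (measure_presentedBy hQ hp2 (tupleHom_surjective hQ ht') (hbal t ht')).2.ge
    have hbad : ((Finset.univ.filter fun t => ¬ good t).card : ℝ≥0∞) * c ≤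
        K * (((K - 1 : ℕ) : ℝ≥0∞) * (K : ℝ≥0∞)⁻¹) ^ m * cPart p n := by
      have h1 := card_not_generating_le (closure_odd_eq_top hQ e) J
      rw [Nat.card_eq_fintype_card, Fintype.card_subtype, hJ, Nat.add_sub_cancel] at h1
      have h2 : ((Finset.univ.filter fun t => ¬ good t).card : ℝ≥0∞) ≤
          K * (((K - 1 : ℕ) : ℝ≥0∞) ^ m * (K : ℝ≥0∞) ^ k) := by
        have h3 : (Finset.univ.filter fun t => ¬ good t).card ≤ K * ((K - 1) ^ m * K ^ k) :=
          le_trans (le_of_eq (by congr)) h1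
        exact_mod_cast h3
      refine (mul_le_mul_left h2 c).trans (le_of_eq ?_)
      calc (K : ℝ≥0∞) * (((K - 1 : ℕ) : ℝ≥0∞) ^ m * (K : ℝ≥0∞) ^ k) * c
          = K * (((K - 1 : ℕ) : ℝ≥0∞) ^ m * ((K : ℝ≥0∞)⁻¹) ^ m) *
              ((K : ℝ≥0∞) ^ k * ((K : ℝ≥0∞)⁻¹) ^ k) * cPart p n := by
            rw [hc, hn, pow_add]; ring
        _ = _ := by rw [hinv, mul_one, ← mul_pow]
    calc cPart p n = ((Finset.univ.filter good).card : ℝ≥0∞) * c +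
          ((Finset.univ.filter fun t => ¬ good t).card : ℝ≥0∞) * c := by
          rw [← add_mul, ← Nat.cast_add, Finset.card_filter_add_card_filter_not, hcard, hall]
      _ ≤ _ := by
          refine add_le_add ?_ hbad
          rw [← nsmul_eq_mul]
          exact (Finset.card_nsmul_le_sum _ _ _ hgood).trans
            (Finset.sum_le_sum_of_subset (Finset.filter_subset _ _))

/-- The mass of a finite weak Schur group under the limit measure. -/
theorem IsLimitMeasure.measure_singleton (hQ : IsPGroup p Q) (hp2 : p ≠ 2) {μ : Measure (Sch p)}
    (hμ : IsLimitMeasure p μ) {k : ℕ} {r₀ : Fin k → OddPart (FreeProP p k)}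
    (e : SigmaEquiv (RelGroup r₀) Q) (hmeas : MeasurableSet {theta p k r₀}) :
    μ {theta p k r₀} = ENNReal.ofReal (cInf p / (Nat.card (SigmaAut Q) : ℝ)) := by
  have : Nonempty (SigmaAut Q) := ⟨SigmaEquiv.refl⟩
  have hN : 0 < Nat.card (SigmaAut Q) := Nat.card_pos
  set N := Nat.card (SigmaAut Q)
  have hN0 : (N : ℝ≥0∞) ≠ 0 := Nat.cast_ne_zero.2 hN.ne'
  have hNtop : (N : ℝ≥0∞) ≠ ∞ := ENNReal.natCast_ne_top N
  have hshift : Tendsto (fun m => k + m) atTop atTop := 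
    (tendsto_add_atTop_nat k).congr fun m => add_comm m k
  have h1 : Tendsto (fun m => (N : ℝ≥0∞) * schMeasure p (k + m) {theta p k r₀}) atTop
      (𝓝 (N * μ {theta p k r₀})) :=
    ENNReal.Tendsto.const_mul ((hμ.tendsto _ hmeas).comp hshift) (Or.inr hNtop)
  have h2 : Tendsto (fun m => cPart p (k + m)) atTop (𝓝 (ENNReal.ofReal (cInf p))) :=
    tendsto_cPart.comp hshift
  have h3 : Tendsto (fun m => (Nat.card (OddPart Q) : ℝ≥0∞) *
      (((Nat.card (OddPart Q) - 1 : ℕ) : ℝ≥0∞) * (Nat.card (OddPart Q) : ℝ≥0∞)⁻¹) ^ m *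
        cPart p (k + m)) atTop (𝓝 0) := by
    have hlt : ((Nat.card (OddPart Q) - 1 : ℕ) : ℝ≥0∞) * (Nat.card (OddPart Q) : ℝ≥0∞)⁻¹ < 1 := by
      have hK : 0 < Nat.card (OddPart Q) := Nat.card_pos
      rw [← div_eq_mul_inv]
      refine ENNReal.div_lt_of_lt_mul ?_
      rw [one_mul]
      exact_mod_cast Nat.sub_lt hK one_pos
    have h4 := ENNReal.Tendsto.const_mul (a := (Nat.card (OddPart Q) : ℝ≥0∞))
      (ENNReal.tendsto_pow_atTop_nhds_zero_of_lt_one hlt) (Or.inr (ENNReal.natCast_ne_top _))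
    rw [mul_zero] at h4
    have h5 := ENNReal.Tendsto.mul h4 (Or.inr ENNReal.ofReal_ne_top) h2 (Or.inr ENNReal.zero_ne_top)
    rwa [zero_mul] at h5
  have hle := le_of_tendsto_of_tendsto' h1 h2 fun m => (schMeasure_bounds hQ hp2 e hmeas m).1
  have hge := le_of_tendsto_of_tendsto' h2 (h1.add h3)
    fun m => (schMeasure_bounds hQ hp2 e hmeas m).2
  rw [add_zero] at hge
  rw [ENNReal.ofReal_div_of_pos (by exact_mod_cast hN), ENNReal.ofReal_natCast,
    ← le_antisymm hle hge, mul_div_assoc, ENNReal.mul_div_cancel hN0 hNtop]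

end PointMass

end SchurSigma

/-- The limit measure `μ_∞` on `Sch` exists (it is unique by `IsLimitMeasure.unique`), and for every
finite weak Schur `σ`-group `G` the singleton `{[G]}` is open and closed in `Sch` and has measure
`C_∞ / |Aut_σ(G)|`. -/
theorem mainTheorem4 (p : ℕ) [Fact p.Prime] (hp : p ≠ 2) :
    ∃ μ : MeasureTheory.Measure (SchurSigma.Sch p), SchurSigma.IsLimitMeasure p μ ∧
      ∀ (G : Type*) [Group G] [TopologicalSpace G] [SchurSigma.SigmaGroup G] [Finite G]
        (hG : SchurSigma.IsWeakSchur p G),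
        IsOpen {SchurSigma.Sch.classOf hG} ∧ IsClosed {SchurSigma.Sch.classOf hG} ∧
          μ {SchurSigma.Sch.classOf hG} =
            ENNReal.ofReal (SchurSigma.cInf p / (Nat.card (SchurSigma.SigmaAut G) : ℝ)) := by
  obtain ⟨μ, hμ⟩ := SchurSigma.exists_isLimitMeasure hp
  refine ⟨μ, hμ, fun G _ _ _ _ hG => ?_⟩
  obtain ⟨n, r, ⟨e⟩⟩ := id hG
  have : Finite (SchurSigma.RelGroup r) := Finite.of_equiv G e.toContinuousMulEquiv.toEquiv
  rw [(SchurSigma.Sch.classOf_eq_theta_iff hG r).2 ⟨e⟩, SchurSigma.SigmaEquiv.card_congr e e]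
  obtain ⟨ho, hc⟩ := SchurSigma.isOpen_and_isClosed_singleton_theta r
  exact ⟨ho, hc, hμ.measure_singleton (Q := SchurSigma.RelGroup r)
    (SchurSigma.isProP_relGroup r).isPGroup hp
    SchurSigma.SigmaEquiv.refl hc.measurableSet⟩
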